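/- Let $n\ge 1$ be an integer, $\mathbb T=\mathbb R/\mathbb Z$, and let $M=(\mathbb C^{n+1})^*\times_\mu(\mathbb C^{n+1})^*=\{(z,w)\in(\mathbb C\setminus 0)^{n+1}\times(\mathbb C\setminus 0)^{n+1} : |z_j|=|w_j|,\ 0\le j\le n\}$, with global coordinates $(\bar\theta,\bar r,\bar\eta)\in\mathbb T^{n+1}\times\mathbb R_{>0}^{n+1}\times\mathbb T^{n+1}$ given by $z_j=r_je^{2\pi i\theta_j}$, $w_j=r_je^{2\pi i\eta_j}$. Equip $M$ with the structure $$\tilde\omega_1=2\pi\sum_i r_i\,dr_i\wedge d\theta_i,\quad \tilde\omega_2=\frac1{2\pi}\sum_i\frac1{r_i}\,dr_i\wedge d\eta_i,\quad \tilde\omega_D=\sum_i d\theta_i\wedge d\eta_i,$$ $$\tilde{\mathbf g}=\sum_i\Big(dr_i^2+4\pi^2r_i^2\,d\theta_i^2+\frac1{4\pi^2r_i^2}\,d\eta_i^2\Big),$$ and put $\mu_1=-\pi\sum_i r_i^2$, $\mu_2=-\frac1{2\pi}\log\prod_i r_i$. Let $v_1=(n,-1,\dots,-1),\dots,v_n=(-1,\dots,-1,n),v_{n+1}=(-1,\dots,-1)$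 and $u_1=e_1,\dots,u_n=e_n,u_{n+1}=(-1,\dots,-1)$ in $\mathbb Z^n$ be the vertices of the polytope $\Delta_n$ of $\mathbb P^n$ and of its dual $\Delta_n^*$. Let $f_{\Delta_n},f_{\Delta_n^*}:\mathbb T^{n+1}\to\mathbb T^n$ be the homomorphisms induced by $x\mapsto\sum_i x_iu_i$ and $x\mapsto\sum_i x_iv_i$, let $f^*_{\Delta_n},f^*_{\Delta_n^*}:\mathbb T^n\to\mathbb T^{n+1}$ be induced by the transposed matrices, and let $D_{\Delta_n}=\operatorname{Ker}f_{\Delta_n}\cap\operatorname{Im}f^*_{\Delta_n^*}$, $D_{\Delta_n^*}=\operatorname{Ker}f_{\Delta_n^*}\cap\operatorname{Im}f^*_{\Delta_n}$. For real $k_1,k_2$ let $$\tilde{\mathbb X}=\tilde{\mathbb X}^{n-1}_{k_1,k_2}=\{(\bar\theta,\bar r,\bar\eta)\in M : \bar\theta\in\operatorname{Im}f^*_{\Delta_n^*},\ \bar\eta\in\operatorname{Im}f^*_{\Delta_n},\ \mu_1=k_1,\ \mu_2=k_2\},$$ on which $D_{\Delta_n}\times D_{\Delta_n^*}$ acts by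 translation of $(\bar\theta,\bar\eta)$, and let $\mathbb X=\mathbb X^{n-1}_{k_1,k_2}=\tilde{\mathbb X}/(D_{\Delta_n}\times D_{\Delta_n^*})$. A weakly self-dual (WSD) structure of rank $m$ on a smooth manifold of dimension $3m+2c$ consists of smooth closed $2$-forms $\omega_1,\omega_2,\omega_D$ and a Riemannian metric such that the distribution $\omega_1^0+\omega_2^0$ is integrable (where $\omega_i^0$ is the kernel of $\omega_i$), and each cotangent space has an orthogonal basis $dx_i,dy^1_i,dy^2_i$ $(1\le i\le m)$, $dz_j,dw_j$ $(1\le j\le c)$, with the $dx_i,dy^1_i,dy^2_i$ of length one, such that at that point $$\omega_1=\sum_i dx_i\wedge dy^1_i,\quad \omega_2=\sum_i dx_i\wedge dy^2_i,\quad \omega_D=\sum_i dy^1_i\wedge dy^2_i+\sum_j dz_j\wedge dw_j .$$ **Theorem.** Assume $\frac{-k_1}{\pi}e^{\frac{4\pi}{n+1}k_2}>n+1$. Then: 1. $d\mu_1\wedge d\mu_2\ne0$ at every point of $M$ with $\mu_1=k_1$, $\mu_2=k_2$. 2. $\tilde{\mathbb X}$ is an embedded submanifold of $M$ of dimension $3(n-1)+2$,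 and the restrictions to it of $\tilde\omega_1,\tilde\omega_2,\tilde\omega_D,\tilde{\mathbf g}$ form a WSD structure of rank $n-1$. 3. The group $D_{\Delta_n}\times D_{\Delta_n^*}$ is finite, $\mathbb X$ is a non-empty compact smooth manifold of dimension $3(n-1)+2$ for which the projection $\tilde{\mathbb X}\to\mathbb X$ is a local diffeomorphism, and the structure of $\tilde{\mathbb X}$ is the pullback of a WSD structure $(\omega_1,\omega_2,\omega_D,\mathbf g)$ of rank $n-1$ on $\mathbb X$. This structure is degenerate, with $\dim(\omega_1^0\cap\omega_2^0)_p=2$ at every $p\in\mathbb X$. 4. The set $B=\{\bar r\in\mathbb R_{>0}^{n+1}:\mu_1=k_1,\ \mu_2=k_2\}$ is an embedded submanifold of dimension $n-1$, the projection $\mathbb X\to B$, $[\bar\theta,\bar r,\bar\eta]\mapsto\bar r$, is smooth, and $\sigma:B\to\mathbb X$, $\sigma(\bar r)=[0,\bar r,0]$, is a smooth section of it. -/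

import Mathlib

open scoped Manifold ContDiff

noncomputable section

namespace WSD

/-! ### Two-forms, distributions and weakly self-dual structures on manifolds -/

section General

/-- The wedge product `α ∧ β` of two covectors, a two-form on the vector space `V`. -/
def wedge {V : Type*} [AddCommGroup V] [Module ℝ V] [TopologicalSpace V]
    [IsTopologicalAddGroup V] [ContinuousConstSMul ℝ V]
    (α β : V →L[ℝ] ℝ) : V [⋀^Fin 2]→L[ℝ] ℝ :=
  ContinuousMultilinearMap.alternatization
    ((ContinuousMultilinearMap.mkPiAlgebra ℝ (Fin 2) ℝ).compContinuousLinearMap ![α, β])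

theorem wedge_apply {V : Type*} [AddCommGroup V] [Module ℝ V] [TopologicalSpace V]
    [IsTopologicalAddGroup V] [ContinuousConstSMul ℝ V] (α β : V →L[ℝ] ℝ) (v w : V) :
    wedge α β ![v, w] = α v * β w - α w * β v := by
  have h : (Finset.univ : Finset (Equiv.Perm (Fin 2))) = {1, Equiv.swap 0 1} := by decide
  simp only [wedge, ContinuousMultilinearMap.alternatization_apply_apply, h]
  rw [Finset.sum_pair (by decide)]
  simp [sub_eq_add_neg]

variable {E H E' H' : Type*} [NormedAddCommGroup E] [NormedSpace ℝ E] [TopologicalSpace H]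
  [NormedAddCommGroup E'] [NormedSpace ℝ E'] [TopologicalSpace H']
  (I : ModelWithCorners ℝ E H) (J : ModelWithCorners ℝ E' H')
  (X : Type*) [TopologicalSpace X] [ChartedSpace H X]
  {Y : Type*} [TopologicalSpace Y] [ChartedSpace H' Y]

/-- A (not necessarily smooth) differential two-form on the manifold `X`. -/
abbrev TwoForm : Type _ := ∀ x : X, TangentSpace I x [⋀^Fin 2]→L[ℝ] ℝ

variable {X}

/-- The pullback `f^* α` of a two-form along a map `f : X → Y`. -/
def TwoForm.pullback (f : X → Y) (α : TwoForm J Y) : TwoForm I X := fun x ↦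
  (α (f x)).compContinuousLinearMap (mfderiv I J f x)

variable {I} {J}

/-- The expression of a two-form in the chart at `x₀`, a two-form on (a subset of) the model
vector space. -/
def TwoForm.inChart (α : TwoForm I X) (x₀ : X) : E → E [⋀^Fin 2]→L[ℝ] ℝ := fun y ↦
  (α ((extChartAt I x₀).symm y)).compContinuousLinearMap
    (mfderivWithin 𝓘(ℝ, E) I (extChartAt I x₀).symm (Set.range I) y)

/-- A two-form is smooth if its expressions in charts are. -/
def TwoForm.IsSmooth (α : TwoForm I X) : Prop :=
  ∀ x₀ : X, ContDiffOn ℝ ∞ (TwoForm.inChart α x₀) (extChartAt I x₀).target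

/-- `dα = 0`: the exterior derivatives of the expressions in charts vanish. -/
def TwoForm.IsClosed (α : TwoForm I X) : Prop :=
  ∀ x₀ : X, ∀ y ∈ (extChartAt I x₀).target,
    extDerivWithin (TwoForm.inChart α x₀) (Set.range I) y = 0

/-- `α⁰` at `x`: the tangent vectors `v` with `v ⇀ α = 0`. -/
def TwoForm.ker (α : TwoForm I X) (x : X) : Submodule ℝ (TangentSpace I x) :=
  LinearMap.ker (AlternatingMap.curryLeft (α x).toAlternatingMap)

variable (I) in
/-- A distribution `D` is (completely) integrable if around each point there is a chart of the
smooth structure which sends `D` to a constant subspace `F` of the model vector space, so that the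
plaques of the chart parallel to `F` are integral manifolds of `D`. -/
def IsIntegrable (D : ∀ x : X, Submodule ℝ (TangentSpace I x)) : Prop :=
  ∀ x₀ : X, ∃ e ∈ IsManifold.maximalAtlas I ∞ X, x₀ ∈ e.source ∧
    ∃ F : Submodule ℝ E, ∀ x ∈ e.source, ∀ v : TangentSpace I x,
      v ∈ D x ↔ mfderiv I 𝓘(ℝ, E) (e.extend I) x v ∈ F

variable (I J) in
/-- Smooth embeddings: smooth maps which are topological embeddings and have injective
differentials. -/
structure IsSmoothEmbedding (f : X → Y) : Prop where
  contMDiff : ContMDiff I J ∞ f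
  isEmbedding : Topology.IsEmbedding f
  injective_mfderiv : ∀ x, Function.Injective (mfderiv I J f x)

/-- The labels of an adapted coframe
`dx_1, …, dx_m, dy¹_1, …, dy¹_m, dy²_1, …, dy²_m, dz_1, …, dz_c, dw_1, …, dw_c`. -/
inductive CoframeIndex (m c : ℕ) : Type
  | x (i : Fin m)
  | y₁ (i : Fin m)
  | y₂ (i : Fin m)
  | z (j : Fin c)
  | w (j : Fin c)

variable (I X) in
/-- A weakly self-dual structure of rank `m` on a manifold of dimension `3 m + 2 c`.
In `adapted`, `d` is the coframe and `b` is the basis of the tangent space dual to it; `d` is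
orthogonal for the metric on the cotangent space if and only if `b` is orthogonal, and then a
member of `d` has length one if and only if the corresponding member of `b` has. -/
structure WSDStructure [IsManifold I ∞ X] (m c : ℕ) where
  ω₁ : TwoForm I X
  ω₂ : TwoForm I X
  ωD : TwoForm I X
  metric : Bundle.ContMDiffRiemannianMetric I ∞ E (fun x : X ↦ TangentSpace I x)
  smooth₁ : TwoForm.IsSmooth ω₁
  smooth₂ : TwoForm.IsSmooth ω₂
  smoothD : TwoForm.IsSmooth ωD
  closed₁ : TwoForm.IsClosed ω₁
  closed₂ : TwoForm.IsClosed ω₂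
  closedD : TwoForm.IsClosed ωD
  integrable : IsIntegrable I (fun x ↦ TwoForm.ker ω₁ x ⊔ TwoForm.ker ω₂ x)
  adapted : ∀ p : X, ∃ (b : Module.Basis (CoframeIndex m c) ℝ (TangentSpace I p))
    (d : CoframeIndex m c → TangentSpace I p →L[ℝ] ℝ),
    (∀ k v, d k v = b.coord k v) ∧
    (∀ k l, k ≠ l → metric.inner p (b k) (b l) = 0) ∧
    (∀ i, metric.inner p (b (.x i)) (b (.x i)) = 1) ∧
    (∀ i, metric.inner p (b (.y₁ i)) (b (.y₁ i)) = 1) ∧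
    (∀ i, metric.inner p (b (.y₂ i)) (b (.y₂ i)) = 1) ∧
    ω₁ p = ∑ i, wedge (d (.x i)) (d (.y₁ i)) ∧
    ω₂ p = ∑ i, wedge (d (.x i)) (d (.y₂ i)) ∧
    ωD p = ∑ i, wedge (d (.y₁ i)) (d (.y₂ i)) + ∑ j, wedge (d (.z j)) (d (.w j))

end General

/-! ### Tori and the group morphisms given by the vertices of `Δ_n` and `Δ_n^*` -/

/-- The torus `𝕋^N = (ℝ/ℤ)^N`. -/
abbrev Torus (N : ℕ) : Type := Fin N → UnitAddCircle

/-- The chart of `𝕋^N` which sends a point to its unique lift in the open box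
`∏ i, (a i, a i + 1)`. -/
def torusChart {N : ℕ} (a : Fin N → ℝ) : OpenPartialHomeomorph (Torus N) (Fin N → ℝ) :=
  (OpenPartialHomeomorph.pi fun i ↦ AddCircle.openPartialHomeomorphCoe (1 : ℝ) (a i)).symm

/-- A base point for a chart around `x`: the chart around `x` is centred at a lift of `x`. -/
def torusBase {N : ℕ} (x : Torus N) : Fin N → ℝ := fun i ↦
  (AddCircle.equivIco (1 : ℝ) 0 (x i) : ℝ) - 1 / 2

theorem mem_torusChart_source {N : ℕ} (x : Torus N) : x ∈ (torusChart (torusBase x)).source := by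
  intro i _ h
  have h1 : x i = ((torusBase x i : ℝ) : UnitAddCircle) := h
  have h2 : x i = (((AddCircle.equivIco (1 : ℝ) 0 (x i) : ℝ)) : UnitAddCircle) :=
    ((AddCircle.equivIco (1 : ℝ) 0).symm_apply_apply (x i)).symm
  rw [h2] at h1
  have h3 : ((1 / 2 : ℝ) : UnitAddCircle) = 0 := by
    have := h1
    simp only [torusBase, AddCircle.coe_sub, ← h2] at this
    exact sub_eq_self.1 this.symm
  obtain ⟨k, hk⟩ := (AddCircle.coe_eq_zero_iff (1 : ℝ)).1 h3
  have h4 : (2 * k : ℝ) = 1 := by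
    simp only [zsmul_eq_mul, mul_one] at hk
    linarith
  have h5 : 2 * k = 1 := by exact_mod_cast h4
  omega

instance torusChartedSpace (N : ℕ) : ChartedSpace (Fin N → ℝ) (Torus N) where
  atlas := Set.range torusChart
  chartAt x := torusChart (torusBase x)
  mem_chart_source := mem_torusChart_source
  chart_mem_atlas x := ⟨torusBase x, rfl⟩

instance torusIsManifold (N : ℕ) : IsManifold 𝓘(ℝ, Fin N → ℝ) ∞ (Torus N) := by
  refine isManifold_of_contDiffOn _ _ _ ?_
  rintro _ _ ⟨a, rfl⟩ ⟨b, rfl⟩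
  simp only [modelWithCornersSelf_coe, modelWithCornersSelf_coe_symm, Function.comp_id,
    Function.id_comp, Set.range_id, Set.preimage_id, Set.inter_univ]
  intro y hy
  refine ContDiffAt.contDiffWithinAt ?_
  have key : ∀ z : Fin N → ℝ, ((torusChart a).symm ≫ₕ torusChart b) z =
      fun i ↦ (AddCircle.equivIco (1 : ℝ) (b i) ((z i : ℝ) : UnitAddCircle) : ℝ) := fun z ↦ rfl
  have hyb : ∀ i, (AddCircle.equivIco (1 : ℝ) (b i) ((y i : ℝ) : UnitAddCircle) : ℝ) ∈
      Set.Ioo (b i) (b i + 1) := fun i ↦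
    (AddCircle.openPartialHomeomorphCoe (1 : ℝ) (b i)).map_target (hy.2 i (Set.mem_univ i))
  set c : Fin N → ℝ := fun i ↦
    (AddCircle.equivIco (1 : ℝ) (b i) ((y i : ℝ) : UnitAddCircle) : ℝ) - y i with hc
  have hc0 : ∀ i, ((c i : ℝ) : UnitAddCircle) = 0 := by
    intro i
    rw [hc, AddCircle.coe_sub, sub_eq_zero]
    exact (AddCircle.equivIco (1 : ℝ) (b i)).symm_apply_apply _
  have hev : ∀ᶠ z in nhds y, ∀ i, z i + c i ∈ Set.Ioo (b i) (b i + 1) := by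
    refine Filter.eventually_all.2 fun i ↦ ?_
    have hcont : Continuous fun z : Fin N → ℝ ↦ z i + c i :=
      (continuous_apply i).add continuous_const
    refine hcont.continuousAt.eventually_mem (isOpen_Ioo.mem_nhds ?_)
    simpa [hc] using hyb i
  have hsm : ContDiffAt ℝ ∞ (fun z : Fin N → ℝ ↦ z + c) y := by fun_prop
  refine hsm.congr_of_eventuallyEq ?_
  filter_upwards [hev] with z hz
  rw [key]
  ext i
  have h1 : ((z i : ℝ) : UnitAddCircle) = ((z i + c i : ℝ) : UnitAddCircle) := by
    rw [AddCircle.coe_add, hc0, add_zero]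
  rw [h1]
  exact (AddCircle.openPartialHomeomorphCoe (1 : ℝ) (b i)).left_inv (hz i)

/-- The group morphism `𝕋^l → 𝕋^k` induced by an integral matrix. -/
def torusMap {k l : ℕ} (A : Matrix (Fin k) (Fin l) ℤ) : Torus l →+ Torus k where
  toFun x i := ∑ j, A i j • x j
  map_zero' := by ext i; simp
  map_add' x y := by ext i; simp [Finset.sum_add_distrib]

/-- The columns are the vertices `v_1 = (n, -1, …, -1), …, v_n = (-1, …, -1, n),
v_{n+1} = (-1, …, -1)` of `Δ_n`. -/
def vertexMatrix (n : ℕ) : Matrix (Fin n) (Fin (n + 1)) ℤ :=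
  Matrix.of fun i j ↦ if j = i.castSucc then (n : ℤ) else -1

/-- The columns are the vertices `u_1 = (1, 0, …, 0), …, u_n = (0, …, 0, 1),
u_{n+1} = (-1, …, -1)` of `Δ_n^*`. -/
def dualVertexMatrix (n : ℕ) : Matrix (Fin n) (Fin (n + 1)) ℤ :=
  Matrix.of fun i j ↦ if j = Fin.last n then -1 else if j = i.castSucc then 1 else 0

/-- `f_{Δ_n} : 𝕋^{n+1} → 𝕋^n`, induced by `x ↦ ∑ i, x_i u_i`. -/
def f (n : ℕ) : Torus (n + 1) →+ Torus n := torusMap (dualVertexMatrix n)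

/-- `f_{Δ_n^*} : 𝕋^{n+1} → 𝕋^n`, induced by `x ↦ ∑ i, x_i v_i`. -/
def fDual (n : ℕ) : Torus (n + 1) →+ Torus n := torusMap (vertexMatrix n)

/-- `f_{Δ_n}^* : 𝕋^n → 𝕋^{n+1}`, induced by the transpose of the matrix of `f_{Δ_n}`. -/
def fTr (n : ℕ) : Torus n →+ Torus (n + 1) := torusMap (dualVertexMatrix n).transpose

/-- `f_{Δ_n^*}^* : 𝕋^n → 𝕋^{n+1}`, induced by the transpose of the matrix of `f_{Δ_n^*}`. -/
def fDualTr (n : ℕ) : Torus n →+ Torus (n + 1) := torusMap (vertexMatrix n).transpose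

/-- `D_{Δ_n} = N_{Δ_n} ∩ Im f_{Δ_n^*}^*`, with `N_{Δ_n} = Ker f_{Δ_n}`. -/
def D (n : ℕ) : AddSubgroup (Torus (n + 1)) := (f n).ker ⊓ (fDualTr n).range

/-- `D_{Δ_n^*} = N_{Δ_n^*} ∩ Im f_{Δ_n}^*`, with `N_{Δ_n^*} = Ker f_{Δ_n^*}`. -/
def DDual (n : ℕ) : AddSubgroup (Torus (n + 1)) := (fDual n).ker ⊓ (fTr n).range

/-! ### The fibred product `(ℂ^{n+1})^* ×_μ (ℂ^{n+1})^*` and its self-dual structure -/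

/-- The values of the coordinates `r̄ = (r_0, …, r_n)`, all positive. -/
def Radii (n : ℕ) : TopologicalSpace.Opens (Fin (n + 1) → ℝ) where
  carrier := {r | ∀ i, 0 < r i}
  is_open' := by
    simp only [Set.ofPred_forall]
    exact isOpen_iInter_of_finite fun i ↦ isOpen_lt continuous_const (continuous_apply i)

/-- The fibred product `(ℂ^{n+1})^* ×_μ (ℂ^{n+1})^*` in its global coordinates `(θ̄, r̄, η̄)`;
the point with these coordinates is `toFibredProduct (θ̄, r̄, η̄)`. -/
abbrev FibredProduct (n : ℕ) : Type := Torus (n + 1) × Radii n × Torus (n + 1)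

/-- The moment map `μ(z) = -(π |z_0|², …, π |z_n|²)`. -/
def momentMap (n : ℕ) (z : Fin (n + 1) → ℂ) : Fin (n + 1) → ℝ := fun i ↦ -(Real.pi * ‖z i‖ ^ 2)

/-- The point `(z, w)` with `z_j = r_j e^{2πi θ_j}` and `w_j = r_j e^{2πi η_j}`. -/
def toFibredProduct (n : ℕ) (p : FibredProduct n) : (Fin (n + 1) → ℂ) × (Fin (n + 1) → ℂ) :=
  (fun j ↦ (p.2.1.1 j : ℂ) * (AddCircle.toCircle (p.1 j) : ℂ),
    fun j ↦ (p.2.1.1 j : ℂ) * (AddCircle.toCircle (p.2.2 j) : ℂ))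

theorem toFibredProduct_injective (n : ℕ) : Function.Injective (toFibredProduct n) := by
  have key : ∀ {a b : ℝ} {x y : UnitAddCircle}, 0 < a → 0 < b →
      (a : ℂ) * (AddCircle.toCircle x : ℂ) = (b : ℂ) * (AddCircle.toCircle y : ℂ) →
      a = b ∧ x = y := by
    intro a b x y ha hb h
    have h1 : a = b := by
      have := congrArg norm h
      simpa only [norm_mul, Circle.norm_coe, mul_one, Complex.norm_real, Real.norm_of_nonneg ha.le,
        Real.norm_of_nonneg hb.le] using this
    subst h1
    refine ⟨rfl, AddCircle.injective_toCircle one_ne_zero (Subtype.ext ?_)⟩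
    exact mul_left_cancel₀ (Complex.ofReal_ne_zero.2 ha.ne') h
  intro p q h
  have h1 : ∀ j, _ := fun j ↦ key (p.2.1.2 j) (q.2.1.2 j) (congrFun (congrArg Prod.fst h) j)
  have h2 : ∀ j, _ := fun j ↦ key (p.2.1.2 j) (q.2.1.2 j) (congrFun (congrArg Prod.snd h) j)
  exact Prod.ext (funext fun j ↦ (h1 j).2)
    (Prod.ext (Subtype.ext (funext fun j ↦ (h1 j).1)) (funext fun j ↦ (h2 j).2))

theorem range_toFibredProduct (n : ℕ) : Set.range (toFibredProduct n) =
    {q | (∀ j, q.1 j ≠ 0) ∧ (∀ j, q.2 j ≠ 0) ∧ momentMap n q.1 = momentMap n q.2} := by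
  have key : ∀ z : ℂ, z ≠ 0 → ∃ x : UnitAddCircle, z = (‖z‖ : ℂ) * (AddCircle.toCircle x : ℂ) := by
    intro z hz
    refine ⟨((Complex.arg z / (2 * Real.pi) : ℝ) : UnitAddCircle), ?_⟩
    rw [AddCircle.toCircle_apply_mk, Circle.coe_exp]
    have : (2 * Real.pi / 1 * (Complex.arg z / (2 * Real.pi)) : ℝ) = Complex.arg z := by
      field_simp
    rw [this, Complex.norm_mul_exp_arg_mul_I]
  ext q
  constructor
  · rintro ⟨p, rfl⟩
    have hp : ∀ j, 0 < p.2.1.1 j := p.2.1.2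
    refine ⟨fun j ↦ ?_, fun j ↦ ?_, ?_⟩
    · simp [toFibredProduct, (hp j).ne']
    · simp [toFibredProduct, (hp j).ne']
    · ext j
      simp only [momentMap, toFibredProduct, norm_mul, Circle.norm_coe]
  · rintro ⟨h1, h2, h3⟩
    have h4 : ∀ j, ‖q.1 j‖ = ‖q.2 j‖ := by
      intro j
      have := congrFun h3 j
      simp only [momentMap, neg_inj, mul_eq_mul_left_iff, Real.pi_ne_zero, or_false] at this
      exact (sq_eq_sq₀ (norm_nonneg _) (norm_nonneg _)).1 this
    choose x hx using fun j ↦ key (q.1 j) (h1 j)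
    choose y hy using fun j ↦ key (q.2 j) (h2 j)
    refine ⟨(x, ⟨fun j ↦ ‖q.1 j‖, fun j ↦ norm_pos_iff.2 (h1 j)⟩, y), ?_⟩
    refine Prod.ext (funext fun j ↦ (hx j).symm) (funext fun j ↦ ?_)
    change (‖q.1 j‖ : ℂ) * (AddCircle.toCircle (y j) : ℂ) = q.2 j
    rw [h4 j, ← hy j]

/-- The model of the manifold `FibredProduct n`. Its tangent space at each point is
`ℝ^{n+1} × ℝ^{n+1} × ℝ^{n+1}`, with the components of a vector being its components in the
coordinates `(θ̄, r̄, η̄)`. -/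
abbrev ambientModel (n : ℕ) :
    ModelWithCorners ℝ ((Fin (n + 1) → ℝ) × (Fin (n + 1) → ℝ) × (Fin (n + 1) → ℝ))
      (ModelProd (Fin (n + 1) → ℝ) (ModelProd (Fin (n + 1) → ℝ) (Fin (n + 1) → ℝ))) :=
  𝓘(ℝ, Fin (n + 1) → ℝ).prod (𝓘(ℝ, Fin (n + 1) → ℝ).prod 𝓘(ℝ, Fin (n + 1) → ℝ))

section Ambient

variable {n : ℕ}

/-- The coordinate one-form `dθ_i`. -/
def dθ (i : Fin (n + 1)) (p : FibredProduct n) : TangentSpace (ambientModel n) p →L[ℝ] ℝ :=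
  (ContinuousLinearMap.proj i).comp (ContinuousLinearMap.fst ℝ (Fin (n + 1) → ℝ)
    ((Fin (n + 1) → ℝ) × (Fin (n + 1) → ℝ)))

/-- The coordinate one-form `dr_i`. -/
def dr (i : Fin (n + 1)) (p : FibredProduct n) : TangentSpace (ambientModel n) p →L[ℝ] ℝ :=
  (ContinuousLinearMap.proj i).comp ((ContinuousLinearMap.fst ℝ (Fin (n + 1) → ℝ)
    (Fin (n + 1) → ℝ)).comp (ContinuousLinearMap.snd ℝ (Fin (n + 1) → ℝ)
    ((Fin (n + 1) → ℝ) × (Fin (n + 1) → ℝ))))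

/-- The coordinate one-form `dη_i`. -/
def dη (i : Fin (n + 1)) (p : FibredProduct n) : TangentSpace (ambientModel n) p →L[ℝ] ℝ :=
  (ContinuousLinearMap.proj i).comp ((ContinuousLinearMap.snd ℝ (Fin (n + 1) → ℝ)
    (Fin (n + 1) → ℝ)).comp (ContinuousLinearMap.snd ℝ (Fin (n + 1) → ℝ)
    ((Fin (n + 1) → ℝ) × (Fin (n + 1) → ℝ))))

/-- The coordinate `r_i`. -/
def r (i : Fin (n + 1)) (p : FibredProduct n) : ℝ := p.2.1.1 i

/-- `ω̃₁ = 2π ∑ r_i dr_i ∧ dθ_i`. -/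
def ambientω₁ : TwoForm (ambientModel n) (FibredProduct n) := fun p ↦
  (2 * Real.pi) • ∑ i, r i p • wedge (dr i p) (dθ i p)

/-- `ω̃₂ = (1 / 2π) ∑ (1 / r_i) dr_i ∧ dη_i`. -/
def ambientω₂ : TwoForm (ambientModel n) (FibredProduct n) := fun p ↦
  (1 / (2 * Real.pi)) • ∑ i, (1 / r i p) • wedge (dr i p) (dη i p)

/-- `ω̃_D = ∑ dθ_i ∧ dη_i`. -/
def ambientωD : TwoForm (ambientModel n) (FibredProduct n) := fun p ↦
  ∑ i, wedge (dθ i p) (dη i p)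

/-- `g̃ = ∑ (dr_i² + 4π² r_i² dθ_i² + (1 / 4π² r_i²) dη_i²)`. -/
def ambientMetric (p : FibredProduct n) (v w : TangentSpace (ambientModel n) p) : ℝ :=
  ∑ i, (dr i p v * dr i p w + 4 * Real.pi ^ 2 * r i p ^ 2 * (dθ i p v * dθ i p w) +
    1 / (4 * Real.pi ^ 2 * r i p ^ 2) * (dη i p v * dη i p w))

/-- `μ₁ = -π ∑ r_i²`. -/
def μ₁ (p : FibredProduct n) : ℝ := -(Real.pi * ∑ i, r i p ^ 2)

/-- `μ₂ = -(1 / 2π) log (∏ r_i)`. -/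
def μ₂ (p : FibredProduct n) : ℝ := -(1 / (2 * Real.pi) * Real.log (∏ i, r i p))

/-- The section `σ̃` of the torus action: the points with `θ̄ = η̄ = 0`. -/
def sigma (s : Radii n) : FibredProduct n := (0, s, 0)

end Ambient

/-! ### The manifolds `𝕏̃^{n-1}_{k₁,k₂}` and `𝕏^{n-1}_{k₁,k₂}` -/

section Construction

variable (n : ℕ) (k₁ k₂ : ℝ)

/-- `𝕏̃^{n-1}_{k₁,k₂}`: the points of `(Im f_{Δ_n^*}^* × Im f_{Δ_n}^*) σ̃` with
`μ₁ = k₁` and `μ₂ = k₂`. -/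
def XTilde : Set (FibredProduct n) :=
  {p | p.1 ∈ (fDualTr n).range ∧ p.2.2 ∈ (fTr n).range ∧ μ₁ p = k₁ ∧ μ₂ p = k₂}

/-- The action of `D_{Δ_n} × D_{Δ_n^*}` on `𝕏̃^{n-1}_{k₁,k₂}` by translation of `(θ̄, η̄)`. -/
instance : AddAction (D n × DDual n) (XTilde n k₁ k₂) where
  vadd g p := ⟨(g.1.1 + p.1.1, p.1.2.1, g.2.1 + p.1.2.2),
    add_mem g.1.2.2 p.2.1, add_mem g.2.2.2 p.2.2.1, p.2.2.2.1, p.2.2.2.2⟩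
  zero_vadd p := Subtype.ext (by
    change ((0 : Torus (n + 1)) + p.1.1, p.1.2.1, (0 : Torus (n + 1)) + p.1.2.2) = p.1
    simp)
  add_vadd g h p := Subtype.ext (by
    change ((g.1.1 + h.1.1) + p.1.1, p.1.2.1, (g.2.1 + h.2.1) + p.1.2.2) =
      (g.1.1 + (h.1.1 + p.1.1), p.1.2.1, g.2.1 + (h.2.1 + p.1.2.2))
    simp only [add_assoc])

/-- `𝕏^{n-1}_{k₁,k₂} = 𝕏̃^{n-1}_{k₁,k₂} / (D_{Δ_n} × D_{Δ_n^*})`. -/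
def XSpace : Type := AddAction.orbitRel.Quotient (D n × DDual n) (XTilde n k₁ k₂)

/-- The quotient topology. -/
instance : TopologicalSpace (XSpace n k₁ k₂) :=
  inferInstanceAs (TopologicalSpace (Quotient _))

variable {n k₁ k₂} in
/-- The projection `𝕏̃^{n-1}_{k₁,k₂} → 𝕏^{n-1}_{k₁,k₂}`. -/
def toX (p : XTilde n k₁ k₂) : XSpace n k₁ k₂ := Quotient.mk _ p

/-- The values of `r̄` on `𝕏̃^{n-1}_{k₁,k₂}`. -/
def RadialSpace : Set (Radii n) := {s | μ₁ (sigma s) = k₁ ∧ μ₂ (sigma s) = k₂}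

/-- The map `[θ̄, r̄, η̄] ↦ r̄`. -/
def radial : XSpace n k₁ k₂ → RadialSpace n k₁ k₂ :=
  Quotient.lift (fun p ↦ ⟨p.1.2.1, p.2.2.2.1, p.2.2.2.2⟩) (by
    rintro p q ⟨g, rfl⟩
    rfl)

/-- The section `σ` induced by `σ̃`, that is, `r̄ ↦ [0, r̄, 0]`. -/
def sectionMap (s : RadialSpace n k₁ k₂) : XSpace n k₁ k₂ :=
  toX ⟨sigma s.1, zero_mem _, zero_mem _, s.2.1, s.2.2⟩

end Construction

end WSD

end

/-!
The coordinates of `𝕏̃` split it into two tori and a space of radii. The images of `f_{Δ_n}^*` and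
`f_{Δ_n^*}^*` are both the subtorus `∑ θ_i = 0` of `𝕋^{n+1}` (`range_fDualTr`), so `𝕏̃` is
`𝕋^n × B × 𝕋^n`, where `B` is the level set of `(μ₁, μ₂)` in the space of radii. The maps `f_{Δ_n}`
and `f_{Δ_n^*}` send the subtorus onto `𝕋^n`, with finite kernels `D_{Δ_n}` and `D_{Δ_n^*}`, so the
quotient `𝕏` is again homeomorphic to `𝕋^n × B × 𝕋^n` (`quotientHomeo`), and the projection `𝕏̃ → 𝕏`
is, in the charts, an affine bijection.

The functions `μ₁` and `μ₂` are, up to constant factors, `∑ r_i²` and `log ∏ r_i`. Their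
differentials are proportional only where all the `r_i` are equal, that is, in the equality case of
the inequality between the arithmetic and the geometric mean of the `r_i²`. The bound on `k₁`
and `k₂` makes this inequality strict (`exists_ne_of_mem_RadialSpace`). Hence `B` is a submanifold
by the inverse function theorem (`exists_radialChart`). It is compact, because on it `∑ r_i²` is
bounded and `∏ r_i` is bounded below, and non-empty by the intermediate value theorem.

A manifold with local coordinates `(θ̄, r̄, η̄)` which are unique up to locally constant terms and
satisfy precisely the relations `∑ dθ_i = ∑ r_i dr_i = ∑ dr_i / r_i = ∑ dη_i = 0` is called here a
manifold with `DevelopingMaps`. The formulas for the forms and the metric of the fibred product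
define a weakly self-dual structure on it (`DevelopingMaps.toWSDStructure`):
* The forms are closed since each is a sum of terms `H(r_i) dr_i ∧ α` or `dθ_i ∧ dη_i`.
* The distribution `ω₁⁰ + ω₂⁰` is `dr̄ = 0`.
* In the orthonormal coframe `dr_i, 2π r_i dθ_i, dη_i / 2π r_i`, with `P = (r_i)` and
  `Q = (1 / r_i)`, the tangent space is `{P, Q}^⊥ × Q^⊥ × P^⊥`, and the three forms pair the factors
  by the inner product. An orthonormal basis of `{P, Q}^⊥` in each of the factors gives the
  covectors `dx_i, dy¹_i, dy²_i`. What remains is a line in `Q^⊥` and one in `P^⊥`, which give `dz`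
  and `dw`. As `⟪P, Q⟫ ≠ 0`, the lines are not orthogonal, and `ω_D` is
  non-degenerate on them (`exists_adapted_basis`).

Both `𝕏̃` and `𝕏` have such coordinates, and the inclusion of `𝕏̃` in the fibred product and the
projection `𝕏̃ → 𝕏` preserve them up to constants, hence preserve the forms and the metric.
-/

noncomputable section

namespace WSD

/-! ### Calculus of two-forms -/

section Wedge

variable {V W : Type*} [NormedAddCommGroup V] [NormedSpace ℝ V] [NormedAddCommGroup W]
  [NormedSpace ℝ W]

theorem wedge_apply_pair (α β : V →L[ℝ] ℝ) (v : Fin 2 → V) :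
    wedge α β v = α (v 0) * β (v 1) - α (v 1) * β (v 0) := by
  rw [← wedge_apply]
  congr 1
  ext i
  fin_cases i <;> rfl

theorem wedge_compContinuousLinearMap (α β : V →L[ℝ] ℝ) (L : W →L[ℝ] V) :
    (wedge α β).compContinuousLinearMap L = wedge (α.comp L) (β.comp L) := by
  ext v
  simp [wedge_apply_pair]

/-- The wedge product of covectors, as a bilinear map. -/
def wedgeₗ : (V →L[ℝ] ℝ) →ₗ[ℝ] (V →L[ℝ] ℝ) →ₗ[ℝ] V [⋀^Fin 2]→L[ℝ] ℝ :=
  LinearMap.mk₂ ℝ wedge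
    (fun a b c ↦ by ext v; simp [wedge_apply_pair]; ring)
    (fun a b c ↦ by ext v; simp [wedge_apply_pair]; ring)
    (fun a b c ↦ by ext v; simp [wedge_apply_pair]; ring)
    (fun a b c ↦ by ext v; simp [wedge_apply_pair]; ring)

theorem contDiffOn_wedge [FiniteDimensional ℝ V] {k : WithTop ℕ∞} {f g : W → V →L[ℝ] ℝ}
    {s : Set W} (hf : ContDiffOn ℝ k f s) (hg : ContDiffOn ℝ k g s) :
    ContDiffOn ℝ k (fun z ↦ wedge (f z) (g z)) s := by
  let T : ((V →L[ℝ] ℝ) →ₗ[ℝ] V [⋀^Fin 2]→L[ℝ] ℝ) ≃ₗ[ℝ]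
      ((V →L[ℝ] ℝ) →L[ℝ] V [⋀^Fin 2]→L[ℝ] ℝ) := LinearMap.toContinuousLinearMap
  let B : (V →L[ℝ] ℝ) →L[ℝ] (V →L[ℝ] ℝ) →L[ℝ] V [⋀^Fin 2]→L[ℝ] ℝ :=
    LinearMap.toContinuousLinearMap (F' := (V →L[ℝ] ℝ) →L[ℝ] V [⋀^Fin 2]→L[ℝ] ℝ)
      (T.toLinearMap ∘ₗ wedgeₗ)
  exact (B.contDiff.comp_contDiffOn hf).clm_apply hg

theorem extDeriv_sum {ι : Type*} {k : ℕ} (s : Finset ι) {η : ι → V → V [⋀^Fin k]→L[ℝ] ℝ} {x : V}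
    (h : ∀ i ∈ s, DifferentiableAt ℝ (η i) x) :
    extDeriv (fun y ↦ ∑ i ∈ s, η i y) x = ∑ i ∈ s, extDeriv (η i) x := by
  classical
  induction s using Finset.induction_on with
  | empty =>
    simp only [Finset.sum_empty]
    rw [extDeriv, fderiv_fun_const, Pi.zero_apply]
    exact map_zero (ContinuousAlternatingMap.alternatizeUncurryFinCLM ℝ V ℝ)
  | insert i s hi ih =>
    simp only [Finset.sum_insert hi]
    rw [extDeriv_fun_add (h i (Finset.mem_insert_self i s))
      (DifferentiableAt.fun_sum fun j hj ↦ h j (Finset.mem_insert_of_mem hj)),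
      ih fun j hj ↦ h j (Finset.mem_insert_of_mem hj)]

/-- `d (H(α) α ∧ β) = 0` for linear forms `α`, `β`, as `dH(α)` is a multiple of `α`. -/
theorem extDeriv_smul_wedge {H : ℝ → ℝ} (α β : V →L[ℝ] ℝ) {x : V}
    (hH : DifferentiableAt ℝ H (α x)) :
    extDeriv (fun y ↦ H (α y) • wedge α β) x = 0 := by
  have h1 : HasFDerivAt (fun y ↦ H (α y)) (deriv H (α x) • α) x :=
    hH.hasDerivAt.comp_hasFDerivAt x α.hasFDerivAt
  have h2 := h1.smul_const (wedge α β)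
  ext v
  rw [extDeriv_apply h2.differentiableAt]
  have h3 : ∀ w u, fderiv ℝ (fun y ↦ (H (α y) • wedge α β) w) x u =
      deriv H (α x) * α u * wedge α β w := by
    intro w u
    have h4 : HasFDerivAt (fun y ↦ H (α y) * wedge α β w)
        ((deriv H (α x) • α).smulRight (wedge α β w)) x := h1.mul_const' _
    have h5 : (fun y ↦ (H (α y) • wedge α β) w) = fun y ↦ H (α y) * wedge α β w := rfl
    rw [h5, h4.fderiv]
    simp
  simp only [h3, wedge_apply_pair, Fin.removeNth]
  refine (Fin.sum_univ_three _).trans ?_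
  have e1 : (1 : Fin 3).succAbove 0 = 0 := rfl
  have e2 : (1 : Fin 3).succAbove 1 = 2 := rfl
  have e3 : (2 : Fin 3).succAbove 0 = 0 := rfl
  have e4 : (2 : Fin 3).succAbove 1 = 1 := rfl
  have e5 : (0 : Fin 3).succAbove 0 = 1 := rfl
  have e6 : (0 : Fin 3).succAbove 1 = 2 := rfl
  simp only [e1, e2, e3, e4, e5, e6, Fin.val_zero, Fin.val_one, Fin.val_two]
  change _ = (0 : ℝ)
  ring

end Wedge

/-! ### Tori -/

section Torus

/-- The projection `ℝ^N → 𝕋^N`. -/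
def torusCoe {N : ℕ} (z : Fin N → ℝ) : Torus N := fun i ↦ (z i : UnitAddCircle)

theorem torusCoe_add {N : ℕ} (z w : Fin N → ℝ) : torusCoe (z + w) = torusCoe z + torusCoe w := rfl

theorem torusCoe_surjective {N : ℕ} : Function.Surjective (torusCoe : (Fin N → ℝ) → Torus N) :=
  fun x ↦ ⟨fun i ↦ (AddCircle.equivIco (1 : ℝ) 0 (x i) : ℝ),
    funext fun i ↦ (AddCircle.equivIco (1 : ℝ) 0).symm_apply_apply (x i)⟩

theorem torusChart_symm {N : ℕ} (a z : Fin N → ℝ) : (torusChart a).symm z = torusCoe z := rfl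

theorem torusCoe_torusChart {N : ℕ} (a : Fin N → ℝ) (x : Torus N) :
    torusCoe (torusChart a x) = x :=
  funext fun i ↦ (AddCircle.equivIco (1 : ℝ) (a i)).symm_apply_apply (x i)

/-- The charts of the torus are, up to locally constant terms, inverse to the projection
`ℝ^N → 𝕋^N`. -/
theorem eventually_torusChart_torusCoe {N : ℕ} (b y : Fin N → ℝ)
    (hy : torusCoe y ∈ (torusChart b).source) :
    ∀ᶠ z in nhds y, torusChart b (torusCoe z) = z + (torusChart b (torusCoe y) - y) := by
  set c : Fin N → ℝ := torusChart b (torusCoe y) - y with hc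
  have hyb : torusChart b (torusCoe y) ∈ (torusChart b).target := (torusChart b).map_source hy
  have hc0 : torusCoe c = 0 := by
    have h1 : torusCoe (y + c) = torusCoe y := by
      rw [hc, add_sub_cancel, torusCoe_torusChart]
    rw [torusCoe_add] at h1
    simpa using h1
  have hev : ∀ᶠ z in nhds y, z + c ∈ (torusChart b).target := by
    refine (continuous_add_const c).continuousAt.eventually_mem
      ((torusChart b).open_target.mem_nhds ?_)
    simpa [hc] using hyb
  filter_upwards [hev] with z hz
  have h1 : torusCoe z = (torusChart b).symm (z + c) := by
    rw [torusChart_symm, torusCoe_add, hc0, add_zero]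
  rw [h1, (torusChart b).right_inv hz]

/-- The linear map `ℝ^l → ℝ^k` given by an integral matrix. -/
def realMap {k l : ℕ} (A : Matrix (Fin k) (Fin l) ℤ) : (Fin l → ℝ) →L[ℝ] (Fin k → ℝ) :=
  LinearMap.toContinuousLinearMap (Matrix.mulVecLin (A.map (Int.cast : ℤ → ℝ)))

theorem realMap_apply {k l : ℕ} (A : Matrix (Fin k) (Fin l) ℤ) (x : Fin l → ℝ) (i : Fin k) :
    realMap A x i = ∑ j, (A i j : ℝ) * x j := rfl

theorem torusMap_apply {k l : ℕ} (A : Matrix (Fin k) (Fin l) ℤ) (x : Torus l) (i : Fin k) :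
    torusMap A x i = ∑ j, A i j • x j := rfl

theorem torusMap_torusCoe {k l : ℕ} (A : Matrix (Fin k) (Fin l) ℤ) (x : Fin l → ℝ) :
    torusMap A (torusCoe x) = torusCoe (realMap A x) := by
  ext i
  have h : ∀ s : Finset (Fin l), ((∑ j ∈ s, (A i j : ℝ) * x j : ℝ) : UnitAddCircle) =
      ∑ j ∈ s, A i j • (x j : UnitAddCircle) := by
    intro s
    rw [← QuotientAddGroup.mk'_apply, map_sum]
    refine Finset.sum_congr rfl fun j _ ↦ ?_
    rw [← zsmul_eq_mul, map_zsmul]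
    rfl
  exact (h Finset.univ).symm

theorem realMap_mul {k l m : ℕ} (A : Matrix (Fin k) (Fin l) ℤ) (B : Matrix (Fin l) (Fin m) ℤ)
    (x : Fin m → ℝ) : realMap (A * B) x = realMap A (realMap B x) := by
  simp only [realMap, LinearMap.coe_toContinuousLinearMap', Matrix.mulVecLin_apply,
    Matrix.mulVec_mulVec]
  congr 1
  exact Matrix.map_mul (f := Int.castRingHom ℝ)

theorem torusMap_mul {k l m : ℕ} (A : Matrix (Fin k) (Fin l) ℤ) (B : Matrix (Fin l) (Fin m) ℤ)
    (x : Torus m) : torusMap (A * B) x = torusMap A (torusMap B x) := by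
  obtain ⟨z, rfl⟩ := torusCoe_surjective x
  simp only [torusMap_torusCoe, realMap_mul]

theorem continuous_torusMap {k l : ℕ} (A : Matrix (Fin k) (Fin l) ℤ) :
    Continuous (torusMap A) := by
  refine continuous_pi fun i ↦ ?_
  simp only [torusMap_apply]
  exact continuous_finsetSum _ fun j _ ↦ (continuous_apply j).zsmul _

theorem torusMap_surjective {k l : ℕ} {A : Matrix (Fin k) (Fin l) ℤ}
    (h : Function.Surjective (realMap A)) : Function.Surjective (torusMap A) := by
  intro y
  obtain ⟨z, rfl⟩ := torusCoe_surjective y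
  obtain ⟨x, rfl⟩ := h z
  exact ⟨torusCoe x, torusMap_torusCoe A x⟩

end Torus

/-! ### The matrices of vertices -/

section Vertices

theorem realMap_dual_transpose_castSucc {n : ℕ} (x : Fin n → ℝ) (i : Fin n) :
    realMap (dualVertexMatrix n).transpose x i.castSucc = x i := by
  rw [realMap_apply]
  simp [dualVertexMatrix, Fin.castSucc_inj, (Fin.castSucc_lt_last _).ne]

theorem realMap_dual_transpose_last {n : ℕ} (x : Fin n → ℝ) :
    realMap (dualVertexMatrix n).transpose x (Fin.last n) = -∑ i, x i := by
  rw [realMap_apply]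
  simp [dualVertexMatrix]

theorem torusMap_dual_transpose_castSucc {n : ℕ} (x : Torus n) (i : Fin n) :
    torusMap (dualVertexMatrix n).transpose x i.castSucc = x i := by
  obtain ⟨z, rfl⟩ := torusCoe_surjective x
  rw [torusMap_torusCoe, torusCoe, realMap_dual_transpose_castSucc]
  rfl

theorem realMap_dual_transpose_injective (n : ℕ) :
    Function.Injective (realMap (dualVertexMatrix n).transpose) := fun x y h ↦ funext fun i ↦ by
  rw [← realMap_dual_transpose_castSucc x i, h, realMap_dual_transpose_castSucc]

theorem mem_range_realMap_dual_transpose {n : ℕ} (y : Fin (n + 1) → ℝ) :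
    (∃ x, realMap (dualVertexMatrix n).transpose x = y) ↔ ∑ i, y i = 0 := by
  constructor
  · rintro ⟨x, rfl⟩
    simp [Fin.sum_univ_castSucc, realMap_dual_transpose_castSucc, realMap_dual_transpose_last]
  · intro h
    refine ⟨fun i ↦ y i.castSucc, funext fun j ↦ ?_⟩
    rw [Fin.sum_univ_castSucc] at h
    induction j using Fin.lastCases with
    | last => rw [realMap_dual_transpose_last]; linarith
    | cast i => rw [realMap_dual_transpose_castSucc]

theorem mem_range_realMap_vertex_transpose {n : ℕ} (y : Fin (n + 1) → ℝ) :
    (∃ x, realMap (vertexMatrix n).transpose x = y) ↔ ∑ i, y i = 0 := by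
  have hn : (n : ℝ) + 1 ≠ 0 := by positivity
  have hc : ∀ x i, realMap (vertexMatrix n).transpose x (Fin.castSucc i) =
      (n + 1) * x i - ∑ j, x j := by
    intro x i
    have h : ∀ j, ((vertexMatrix n).transpose i.castSucc j : ℝ) * x j =
        (if j = i then (n + 1) * x i else 0) - x j := by
      intro j
      by_cases hj : i = j
      · subst hj; simp [vertexMatrix]; ring
      · simp [vertexMatrix, Fin.castSucc_inj, hj, Ne.symm hj]
    rw [realMap_apply, Finset.sum_congr rfl fun j _ ↦ h j]
    simp
  have hl : ∀ x, realMap (vertexMatrix n).transpose x (Fin.last n) = -∑ j, x j := by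
    intro x
    rw [realMap_apply]
    simp [vertexMatrix, (Fin.castSucc_lt_last _).ne']
  constructor
  · rintro ⟨x, rfl⟩
    simp only [Fin.sum_univ_castSucc, hc, hl, Finset.sum_sub_distrib, ← Finset.mul_sum]
    simp
    ring
  · intro h
    rw [Fin.sum_univ_castSucc] at h
    have hs : ∑ j : Fin n, (y j.castSucc - y (Fin.last n)) / (n + 1) = -y (Fin.last n) := by
      rw [← Finset.sum_div, Finset.sum_sub_distrib, eq_neg_of_add_eq_zero_left h]
      simp only [Finset.sum_const, Finset.card_univ, Fintype.card_fin, nsmul_eq_mul]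
      field_simp
      ring
    refine ⟨fun i ↦ (y i.castSucc - y (Fin.last n)) / (n + 1), funext fun j ↦ ?_⟩
    induction j using Fin.lastCases with
    | last => rw [hl, hs, neg_neg]
    | cast i => rw [hc, hs]; field_simp; ring

/-- Lifting along `ℝ^{n+1} → 𝕋^{n+1}`: if `A` maps onto the hyperplane `∑ y_i = 0` then the
morphism of tori maps onto the subtorus `∑ y_i = 0`. -/
theorem mem_range_torusMap_of_realMap {n : ℕ} {A : Matrix (Fin (n + 1)) (Fin n) ℤ}
    (hA : ∀ y : Fin (n + 1) → ℝ, (∃ x, realMap A x = y) ↔ ∑ i, y i = 0) (y : Torus (n + 1)) :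
    y ∈ (torusMap A).range ↔ ∑ i, y i = 0 := by
  have hs : ∀ z : Fin (n + 1) → ℝ,
      ((∑ i, z i : ℝ) : UnitAddCircle) = ∑ i, (torusCoe z : Torus (n + 1)) i := fun z ↦ by
    rw [← QuotientAddGroup.mk'_apply, map_sum]; rfl
  constructor
  · rintro ⟨x, rfl⟩
    obtain ⟨z, rfl⟩ := torusCoe_surjective x
    rw [torusMap_torusCoe, ← hs, (hA _).1 ⟨z, rfl⟩]
    rfl
  · intro h
    obtain ⟨z, rfl⟩ := torusCoe_surjective y
    rw [← hs] at h
    obtain ⟨k, hk⟩ := (AddCircle.coe_eq_zero_iff (1 : ℝ)).1 h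
    have hk' : (k : ℝ) = ∑ i, z i := by simpa using hk
    -- the lift is corrected by an integer so that its coordinates sum up to zero
    obtain ⟨x, hx⟩ := (hA (z - Pi.single 0 (k : ℝ))).2 (by simp [Finset.sum_sub_distrib, hk'])
    refine ⟨torusCoe x, ?_⟩
    rw [torusMap_torusCoe, hx]
    have h0 : (torusCoe (Pi.single 0 (k : ℝ)) : Torus (n + 1)) = 0 := by
      ext i
      by_cases hi : i = 0
      · subst hi
        simp only [torusCoe, Pi.single_eq_same, Pi.zero_apply]
        exact (AddCircle.coe_eq_zero_iff (1 : ℝ)).2 ⟨k, by simp⟩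
      · simp [torusCoe, Pi.single_eq_of_ne hi]
    have h1 : torusCoe (z - Pi.single 0 (k : ℝ)) + torusCoe (Pi.single 0 (k : ℝ)) = torusCoe z := by
      rw [← torusCoe_add, sub_add_cancel]
    rw [← h1, h0, add_zero]

theorem mem_range_fTr {n : ℕ} (y : Torus (n + 1)) : y ∈ (fTr n).range ↔ ∑ i, y i = 0 :=
  mem_range_torusMap_of_realMap mem_range_realMap_dual_transpose y

/-- The two subtori `Im f_{Δ_n^*}^*` and `Im f_{Δ_n}^*` coincide. -/
theorem range_fDualTr (n : ℕ) : (fDualTr n).range = (fTr n).range := by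
  ext y
  rw [mem_range_fTr]
  exact mem_range_torusMap_of_realMap mem_range_realMap_vertex_transpose y

/-- The matrix is the Gram matrix of the injective map `realMap (dualVertexMatrix n).transpose`. -/
theorem realMap_injective_f_fTr (n : ℕ) :
    Function.Injective (realMap (dualVertexMatrix n * (dualVertexMatrix n).transpose)) := by
  refine (injective_iff_map_eq_zero _).2 fun x hx ↦ ?_
  refine (injective_iff_map_eq_zero _).1 (realMap_dual_transpose_injective n) x ?_
  have h1 : ∑ i, x i * realMap (dualVertexMatrix n * (dualVertexMatrix n).transpose) x i = 0 := by
    simp [hx]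
  have h2 : ∑ i, x i * realMap (dualVertexMatrix n * (dualVertexMatrix n).transpose) x i =
      ∑ j, realMap (dualVertexMatrix n).transpose x j ^ 2 := by
    rw [realMap_mul]
    have : ∀ i, x i * realMap (dualVertexMatrix n)
        (realMap (dualVertexMatrix n).transpose x) i =
        ∑ j, (dualVertexMatrix n i j : ℝ) * x i * realMap (dualVertexMatrix n).transpose x j := by
      intro i
      rw [realMap_apply _ (realMap (dualVertexMatrix n).transpose x), Finset.mul_sum]
      exact Finset.sum_congr rfl fun j _ ↦ by ring
    rw [Finset.sum_congr rfl fun i _ ↦ this i, Finset.sum_comm]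
    refine Finset.sum_congr rfl fun j _ ↦ ?_
    rw [← Finset.sum_mul, sq, realMap_apply _ x]
    rfl
  rw [h2] at h1
  ext j
  have := (Finset.sum_eq_zero_iff_of_nonneg fun j _ ↦ sq_nonneg _).1 h1 j (Finset.mem_univ j)
  simpa using this

theorem realMap_fDual_fTr {n : ℕ} (x : Fin n → ℝ) :
    realMap (vertexMatrix n * (dualVertexMatrix n).transpose) x = ((n : ℝ) + 1) • x := by
  rw [realMap_mul]
  ext i
  rw [realMap_apply, Fin.sum_univ_castSucc, realMap_dual_transpose_last]
  have h : ∀ j : Fin n, (vertexMatrix n i j.castSucc : ℝ) *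
      realMap (dualVertexMatrix n).transpose x j.castSucc =
      (if j = i then (n + 1) * x i else 0) - x j := by
    intro j
    rw [realMap_dual_transpose_castSucc]
    by_cases hj : j = i
    · subst hj; simp [vertexMatrix]; ring
    · simp [vertexMatrix, Fin.castSucc_inj, hj]
  rw [Finset.sum_congr rfl fun j _ ↦ h j]
  simp [vertexMatrix, (Fin.castSucc_lt_last _).ne']

theorem realMap_injective_fDual_fTr (n : ℕ) :
    Function.Injective (realMap (vertexMatrix n * (dualVertexMatrix n).transpose)) := by
  intro x y h
  have hn : (n : ℝ) + 1 ≠ 0 := by positivity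
  rw [realMap_fDual_fTr, realMap_fDual_fTr] at h
  exact smul_right_injective _ hn h

/-- The kernel of `f_{Δ_n}` is the diagonal, which meets `∑ x_i = 0` in the points of order
dividing `n + 1`. -/
theorem nsmul_eq_zero_of_mem_D {n : ℕ} {x : Torus (n + 1)} (hx : x ∈ D n) (i : Fin (n + 1)) :
    (n + 1) • x i = 0 := by
  have h1 : ∑ i, x i = 0 := (mem_range_fTr x).1 (range_fDualTr n ▸ hx.2)
  have h2 : ∀ j : Fin n, x j.castSucc = x (Fin.last n) := by
    intro j
    have := congrFun (show f n x = 0 from hx.1) j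
    rw [f, torusMap_apply, Fin.sum_univ_castSucc] at this
    simpa [dualVertexMatrix, Fin.castSucc_inj, (Fin.castSucc_lt_last _).ne, ite_smul,
      add_neg_eq_zero] using this
  have h3 : ∀ j, x j = x (Fin.last n) := fun j ↦ by
    induction j using Fin.lastCases with
    | last => rfl
    | cast j => exact h2 j
  rw [Finset.sum_congr rfl fun j _ ↦ h3 j] at h1
  rw [h3 i]
  simpa using h1

/-- The composition of `f_{Δ_n^*}` and `f_{Δ_n}^*` is the multiplication by `n + 1`. -/
theorem nsmul_eq_zero_of_mem_DDual {n : ℕ} {x : Torus (n + 1)} (hx : x ∈ DDual n)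
    (i : Fin (n + 1)) : (n + 1) • x i = 0 := by
  obtain ⟨hx1, t, rfl⟩ := hx
  have h1 : torusMap (vertexMatrix n * (dualVertexMatrix n).transpose) t = 0 := by
    rw [torusMap_mul]; exact hx1
  have h2 : (n + 1) • t = 0 := by
    obtain ⟨z, rfl⟩ := torusCoe_surjective t
    rw [torusMap_torusCoe, realMap_fDual_fTr] at h1
    rw [← h1]
    ext j
    simp only [torusCoe, Pi.smul_apply, smul_eq_mul]
    rw [← AddCircle.coe_nsmul]
    congr 1
    simp
  rw [← Pi.smul_apply, ← map_nsmul, h2, map_zero, Pi.zero_apply]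

theorem finite_D_prod_DDual (n : ℕ) : Finite (D n × DDual n) := by
  have h : Set.Finite {x : Torus (n + 1) | ∀ i, (n + 1) • x i = 0} := by
    have := Set.Finite.pi' (fun _ : Fin (n + 1) ↦
      AddCircle.finite_torsion (1 : ℝ) (Nat.succ_pos n))
    exact this
  have h1 : Finite (D n) := h.subset fun x hx i ↦ nsmul_eq_zero_of_mem_D hx i
  have h2 : Finite (DDual n) := h.subset fun x hx i ↦ nsmul_eq_zero_of_mem_DDual hx i
  infer_instance

end Vertices

/-! ### Adapted frames -/

section Frames

instance (m c : ℕ) : Finite (CoframeIndex m c) :=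
  Finite.of_surjective
    (Sum.elim CoframeIndex.x (Sum.elim CoframeIndex.y₁ (Sum.elim CoframeIndex.y₂
      (Sum.elim CoframeIndex.z CoframeIndex.w))) :
      Fin m ⊕ Fin m ⊕ Fin m ⊕ Fin c ⊕ Fin c → CoframeIndex m c) (by
    rintro (i | i | i | i | i)
    exacts [⟨.inl i, rfl⟩, ⟨.inr (.inl i), rfl⟩, ⟨.inr (.inr (.inl i)), rfl⟩,
      ⟨.inr (.inr (.inr (.inl i))), rfl⟩, ⟨.inr (.inr (.inr (.inr i))), rfl⟩])

variable {K : Type*} [NormedAddCommGroup K] [InnerProductSpace ℝ K]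

local notation "⟪" x ", " y "⟫" => inner ℝ x y

/-- The component of `P` orthogonal to `Q`. -/
def orthComponent (P Q : K) : K := P - (⟪P, Q⟫ / ⟪Q, Q⟫) • Q

theorem inner_orthComponent_right {P Q : K} (hQ : Q ≠ 0) : ⟪Q, orthComponent P Q⟫ = 0 := by
  have : ⟪Q, Q⟫ ≠ 0 := inner_self_ne_zero.2 hQ
  rw [orthComponent, inner_sub_right, inner_smul_right, real_inner_comm Q P]
  field_simp
  ring

theorem inner_orthComponent_eq_zero {P Q x : K} (hP : ⟪P, x⟫ = 0) (hQ : ⟪Q, x⟫ = 0) :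
    ⟪orthComponent P Q, x⟫ = 0 := by
  rw [orthComponent, inner_sub_left, inner_smul_left, hP, hQ]
  simp

theorem inner_orthComponent_self_pos {P Q : K} (h : LinearIndependent ℝ ![P, Q]) :
    0 < ⟪orthComponent P Q, orthComponent P Q⟫ := by
  refine real_inner_self_pos.2 fun h0 ↦ ?_
  have := LinearIndependent.pair_iff.1 h 1 (-(⟪P, Q⟫ / ⟪Q, Q⟫)) (by
    rw [one_smul, neg_smul, ← sub_eq_add_neg]; exact h0)
  exact one_ne_zero this.1

/-- The orthogonal components of two vectors along each other are not orthogonal. This is the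
strict Cauchy-Schwarz inequality. -/
theorem inner_orthComponent_orthComponent_ne_zero {P Q : K} (h : LinearIndependent ℝ ![P, Q])
    (h0 : ⟪P, Q⟫ ≠ 0) : ⟪orthComponent P Q, orthComponent Q P⟫ ≠ 0 := by
  have hP : P ≠ 0 := h.ne_zero 0
  have hQ : Q ≠ 0 := h.ne_zero 1
  have hP' : ⟪P, P⟫ ≠ 0 := inner_self_ne_zero.2 hP
  have h1 := inner_orthComponent_self_pos h
  have h2 : ⟪orthComponent P Q, orthComponent P Q⟫ = ⟪P, orthComponent P Q⟫ := by
    nth_rw 1 [orthComponent]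
    rw [inner_sub_left, inner_smul_left, inner_orthComponent_right hQ, mul_zero, sub_zero]
  have h3 : ⟪orthComponent P Q, orthComponent Q P⟫ =
      -(⟪Q, P⟫ / ⟪P, P⟫) * ⟪P, orthComponent P Q⟫ := by
    nth_rw 2 [orthComponent]
    rw [inner_sub_right, inner_smul_right, real_inner_comm Q (orthComponent P Q),
      inner_orthComponent_right hQ, real_inner_comm P (orthComponent P Q)]
    ring
  rw [h3, ← h2]
  rw [real_inner_comm] at h0
  exact mul_ne_zero (neg_ne_zero.2 (div_ne_zero h0 hP')) h1.ne'

/-- An orthonormal basis of the orthogonal complement of two vectors. -/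
theorem exists_orthonormal_orthogonal [FiniteDimensional ℝ K] {m : ℕ} {P Q : K}
    (h : LinearIndependent ℝ ![P, Q]) (hK : Module.finrank ℝ K = m + 2) :
    ∃ e : Fin m → K, Orthonormal ℝ e ∧ (∀ k, ⟪P, e k⟫ = 0) ∧ (∀ k, ⟪Q, e k⟫ = 0) ∧
      ∀ x, ⟪P, x⟫ = 0 → ⟪Q, x⟫ = 0 → (∀ k, ⟪e k, x⟫ = 0) → x = 0 := by
  let S : Submodule ℝ K := Submodule.span ℝ (Set.range ![P, Q])
  have hS : Module.finrank ℝ S = 2 := by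
    simpa using finrank_span_eq_card h
  have hSo : Module.finrank ℝ Sᗮ = m := by
    have := Submodule.finrank_add_finrank_orthogonal S
    omega
  have hmem : ∀ x, x ∈ Sᗮ ↔ ⟪P, x⟫ = 0 ∧ ⟪Q, x⟫ = 0 := by
    intro x
    rw [Submodule.mem_orthogonal]
    constructor
    · intro hx
      exact ⟨hx P (Submodule.subset_span ⟨0, rfl⟩), hx Q (Submodule.subset_span ⟨1, rfl⟩)⟩
    · rintro ⟨h1, h2⟩ u hu
      induction hu using Submodule.span_induction with
      | mem y hy =>
        obtain ⟨i, rfl⟩ := hy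
        fin_cases i
        exacts [h1, h2]
      | zero => exact inner_zero_left x
      | add y z _ _ hy hz => rw [inner_add_left, hy, hz, add_zero]
      | smul a y _ hy => rw [inner_smul_left, hy, mul_zero]
  let b := (stdOrthonormalBasis ℝ Sᗮ).reindex (finCongr hSo)
  refine ⟨fun k ↦ b k, ?_, fun k ↦ ((hmem _).1 (b k).2).1, fun k ↦ ((hmem _).1 (b k).2).2, ?_⟩
  · exact b.orthonormal.comp_linearIsometry Sᗮ.subtypeₗᵢ
  · intro x h1 h2 h3
    have h4 : (⟨x, (hmem x).2 ⟨h1, h2⟩⟩ : Sᗮ) = 0 := by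
      rw [← b.sum_repr' ⟨x, (hmem x).2 ⟨h1, h2⟩⟩]
      refine Finset.sum_eq_zero fun i _ ↦ ?_
      rw [show ⟪b i, ⟨x, (hmem x).2 ⟨h1, h2⟩⟩⟫ = 0 from h3 i, zero_smul]
    exact congrArg Subtype.val h4

/-- An orthogonal expansion in the hyperplane `Q^⊥`. -/
theorem eq_sum_add_orthComponent {m : ℕ} {P Q : K} (hPQ : LinearIndependent ℝ ![P, Q])
    {e : Fin m → K} (he : Orthonormal ℝ e) (hP : ∀ k, ⟪P, e k⟫ = 0) (hQ : ∀ k, ⟪Q, e k⟫ = 0)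
    (htot : ∀ x, ⟪P, x⟫ = 0 → ⟪Q, x⟫ = 0 → (∀ k, ⟪e k, x⟫ = 0) → x = 0) {y : K}
    (hy : ⟪Q, y⟫ = 0) :
    y = ∑ k, ⟪e k, y⟫ • e k +
      (⟪orthComponent P Q, y⟫ / ⟪orthComponent P Q, orthComponent P Q⟫) • orthComponent P Q := by
  have hQ0 : Q ≠ 0 := hPQ.ne_zero 1
  set α := orthComponent P Q with hα
  have hα0 : ⟪α, α⟫ ≠ 0 := (inner_orthComponent_self_pos hPQ).ne'
  have hQα : ⟪Q, α⟫ = 0 := inner_orthComponent_right hQ0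
  rw [← sub_eq_zero]
  set δ := y - (∑ k, ⟪e k, y⟫ • e k + (⟪α, y⟫ / ⟪α, α⟫) • α) with hδ
  have h1 : ⟪Q, δ⟫ = 0 := by
    simp [hδ, inner_sub_right, inner_add_right, inner_sum, inner_smul_right, hy, hQ, hQα]
  have h2 : ⟪α, δ⟫ = 0 := by
    have : ∀ k, ⟪α, e k⟫ = 0 := fun k ↦ inner_orthComponent_eq_zero (hP k) (hQ k)
    simp [hδ, inner_sub_right, inner_add_right, inner_sum, inner_smul_right, this, hα0,
      -inner_self_eq_norm_sq_to_K]
  refine htot δ ?_ h1 fun k ↦ ?_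
  · have : P = α + (⟪P, Q⟫ / ⟪Q, Q⟫) • Q := by rw [hα, orthComponent, sub_add_cancel]
    rw [this, inner_add_left, h2, inner_smul_left, h1]
    simp
  · have h4 : ⟪e k, α⟫ = 0 := by
      rw [real_inner_comm]
      exact inner_orthComponent_eq_zero (hP k) (hQ k)
    rw [hδ, inner_sub_right, inner_add_right, inner_smul_right, h4, he.inner_right_fintype]
    simp

/-- A frame adapted to three maps `R`, `A`, `B` which identify a vector space with
`{P, Q}^⊥ × Q^⊥ × P^⊥`. The vectors `x_i`, `y¹_i`, `y²_i` correspond to an orthonormal basis of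
`{P, Q}^⊥` in each of the factors, and `z`, `w` span the remaining lines in `Q^⊥`
and `P^⊥`. -/
theorem exists_adapted_basis [FiniteDimensional ℝ K] {E : Type*} [AddCommGroup E] [Module ℝ E]
    {m : ℕ} {P Q : K} (hPQ : LinearIndependent ℝ ![P, Q]) (h0 : ⟪P, Q⟫ ≠ 0)
    (hK : Module.finrank ℝ K = m + 2) (R A B : E →ₗ[ℝ] K)
    (hinj : ∀ v, R v = 0 → A v = 0 → B v = 0 → v = 0)
    (hmem : ∀ v, ⟪P, R v⟫ = 0 ∧ ⟪Q, R v⟫ = 0 ∧ ⟪Q, A v⟫ = 0 ∧ ⟪P, B v⟫ = 0)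
    (hsurj : ∀ x y z, ⟪P, x⟫ = 0 → ⟪Q, x⟫ = 0 → ⟪Q, y⟫ = 0 → ⟪P, z⟫ = 0 →
      ∃ v, R v = x ∧ A v = y ∧ B v = z) :
    ∃ b : Module.Basis (CoframeIndex m 1) ℝ E,
      (∀ k l, k ≠ l →
        ⟪R (b k), R (b l)⟫ + ⟪A (b k), A (b l)⟫ + ⟪B (b k), B (b l)⟫ = 0) ∧
      (∀ i, ⟪R (b (.x i)), R (b (.x i))⟫ + ⟪A (b (.x i)), A (b (.x i))⟫ +
        ⟪B (b (.x i)), B (b (.x i))⟫ = 1) ∧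
      (∀ i, ⟪R (b (.y₁ i)), R (b (.y₁ i))⟫ + ⟪A (b (.y₁ i)), A (b (.y₁ i))⟫ +
        ⟪B (b (.y₁ i)), B (b (.y₁ i))⟫ = 1) ∧
      (∀ i, ⟪R (b (.y₂ i)), R (b (.y₂ i))⟫ + ⟪A (b (.y₂ i)), A (b (.y₂ i))⟫ +
        ⟪B (b (.y₂ i)), B (b (.y₂ i))⟫ = 1) ∧
      (∀ v w, ⟪R v, A w⟫ = ∑ i, b.coord (.x i) v * b.coord (.y₁ i) w) ∧
      (∀ v w, ⟪R v, B w⟫ = ∑ i, b.coord (.x i) v * b.coord (.y₂ i) w) ∧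
      (∀ v w, ⟪A v, B w⟫ = ∑ i, b.coord (.y₁ i) v * b.coord (.y₂ i) w +
        ∑ j, b.coord (.z j) v * b.coord (.w j) w) := by
  have hP0 : P ≠ 0 := hPQ.ne_zero 0
  have hQ0 : Q ≠ 0 := hPQ.ne_zero 1
  have hQP : LinearIndependent ℝ ![Q, P] := LinearIndependent.pair_symm_iff.1 hPQ
  obtain ⟨e, he, hPe, hQe, htot⟩ := exists_orthonormal_orthogonal hPQ hK
  have hee := orthonormal_iff_ite.1 he
  set α := orthComponent P Q with hα
  set β := orthComponent Q P with hβ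
  have hQα : ⟪Q, α⟫ = 0 := inner_orthComponent_right hQ0
  have hPβ : ⟪P, β⟫ = 0 := inner_orthComponent_right hP0
  have hαα : ⟪α, α⟫ ≠ 0 := (inner_orthComponent_self_pos hPQ).ne'
  have hββ : ⟪β, β⟫ ≠ 0 := (inner_orthComponent_self_pos hQP).ne'
  have hαβ : ⟪α, β⟫ ≠ 0 := inner_orthComponent_orthComponent_ne_zero hPQ h0
  have hαe : ∀ k, ⟪α, e k⟫ = 0 := fun k ↦ inner_orthComponent_eq_zero (hPe k) (hQe k)
  have hβe : ∀ k, ⟪β, e k⟫ = 0 := fun k ↦ inner_orthComponent_eq_zero (hQe k) (hPe k)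
  have heα : ∀ k, ⟪e k, α⟫ = 0 := fun k ↦ by rw [real_inner_comm]; exact hαe k
  have heβ : ∀ k, ⟪e k, β⟫ = 0 := fun k ↦ by rw [real_inner_comm]; exact hβe k
  have expR : ∀ v, R v = ∑ k, ⟪e k, R v⟫ • e k := by
    intro v
    have h1 := eq_sum_add_orthComponent hPQ he hPe hQe htot (hmem v).2.1
    rwa [inner_orthComponent_eq_zero (hmem v).1 (hmem v).2.1, zero_div, zero_smul,
      add_zero] at h1
  have expA : ∀ v, A v = ∑ k, ⟪e k, A v⟫ • e k + (⟪α, A v⟫ / ⟪α, α⟫) • α := fun v ↦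
    eq_sum_add_orthComponent hPQ he hPe hQe htot (hmem v).2.2.1
  have expB : ∀ v, B v = ∑ k, ⟪e k, B v⟫ • e k + (⟪β, B v⟫ / ⟪β, β⟫) • β := fun v ↦
    eq_sum_add_orthComponent hQP he hQe hPe (fun x h1 h2 ↦ htot x h2 h1) (hmem v).2.2.2
  choose bx bxR bxA bxB using fun k ↦ hsurj (e k) 0 0 (hPe k) (hQe k) (inner_zero_right _)
    (inner_zero_right _)
  choose b₁ b₁R b₁A b₁B using fun k ↦ hsurj 0 (e k) 0 (inner_zero_right _) (inner_zero_right _)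
    (hQe k) (inner_zero_right _)
  choose b₂ b₂R b₂A b₂B using fun k ↦ hsurj 0 0 (e k) (inner_zero_right _) (inner_zero_right _)
    (inner_zero_right _) (hPe k)
  obtain ⟨bz, bzR, bzA, bzB⟩ := hsurj 0 α 0 (inner_zero_right _) (inner_zero_right _) hQα
    (inner_zero_right _)
  -- the factor makes the coefficient of `dz ∧ dw` in `ω_D` equal to one
  obtain ⟨bw, bwR, bwA, bwB⟩ := hsurj 0 0 (⟪α, β⟫⁻¹ • β) (inner_zero_right _)
    (inner_zero_right _) (inner_zero_right _) (by rw [inner_smul_right, hPβ, mul_zero])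
  let bb : CoframeIndex m 1 → E
    | .x i => bx i
    | .y₁ i => b₁ i
    | .y₂ i => b₂ i
    | .z _ => bz
    | .w _ => bw
  let dd : CoframeIndex m 1 → Module.Dual ℝ E
    | .x i => (innerₗ K (e i)) ∘ₗ R
    | .y₁ i => (innerₗ K (e i)) ∘ₗ A
    | .y₂ i => (innerₗ K (e i)) ∘ₗ B
    | .z _ => ⟪α, α⟫⁻¹ • (innerₗ K α) ∘ₗ A
    | .w _ => (⟪α, β⟫ / ⟪β, β⟫) • (innerₗ K β) ∘ₗ B
  have hdual : Module.DualBases bb dd := by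
    refine ⟨?_, ?_, ?_, fun v ↦ Set.toFinite _⟩
    · rintro (i | i | i | i | i)
      · simp [bb, dd, bxR, hee, -inner_self_eq_norm_sq_to_K]
      · simp [bb, dd, b₁A, hee, -inner_self_eq_norm_sq_to_K]
      · simp [bb, dd, b₂B, hee, -inner_self_eq_norm_sq_to_K]
      · simp [bb, dd, bzA, hαα, -inner_self_eq_norm_sq_to_K]
      · simp [bb, dd, bwB, -inner_self_eq_norm_sq_to_K]
        field_simp
    · rintro (i | i | i | i | i) (j | j | j | j | j) hij
      all_goals try simp only [ne_eq, CoframeIndex.x.injEq, CoframeIndex.y₁.injEq,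
        CoframeIndex.y₂.injEq, CoframeIndex.z.injEq, CoframeIndex.w.injEq] at hij
      all_goals try exact absurd (Subsingleton.elim i j) hij
      all_goals simp [bb, dd, bxR, bxA, bxB, b₁R, b₁A, b₁B, b₂R, b₂A, b₂B, bzR, bzA, bzB, bwR,
        bwA, bwB, hee, heα, heβ, hαe, hβe]
      all_goals exact hij
    · intro v w hvw
      rw [← sub_eq_zero]
      have h1 : ∀ k, dd k (v - w) = 0 := fun k ↦ by rw [map_sub, hvw, sub_self]
      have hz : ⟪α, A (v - w)⟫ / ⟪α, α⟫ = 0 := by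
        rw [div_eq_inv_mul]; exact h1 (.z 0)
      have hw : ⟪β, B (v - w)⟫ / ⟪β, β⟫ = 0 := by
        have h2 : ⟪α, β⟫ / ⟪β, β⟫ * ⟪β, B (v - w)⟫ = 0 := h1 (.w 0)
        rw [(mul_eq_zero.1 h2).resolve_left (div_ne_zero hαβ hββ), zero_div]
      refine hinj _ ?_ ?_ ?_
      · rw [expR]
        exact Finset.sum_eq_zero fun k _ ↦ by
          rw [show ⟪e k, R (v - w)⟫ = 0 from h1 (.x k), zero_smul]
      · rw [expA, hz, zero_smul, add_zero]
        exact Finset.sum_eq_zero fun k _ ↦ by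
          rw [show ⟪e k, A (v - w)⟫ = 0 from h1 (.y₁ k), zero_smul]
      · rw [expB, hw, zero_smul, add_zero]
        exact Finset.sum_eq_zero fun k _ ↦ by
          rw [show ⟪e k, B (v - w)⟫ = 0 from h1 (.y₂ k), zero_smul]
  have hb : ∀ k, hdual.basis k = bb k := fun k ↦ by rw [hdual.coe_basis]
  have hd : ∀ k, hdual.basis.coord k = dd k := fun k ↦ by
    refine hdual.basis.ext fun l ↦ ?_
    rw [Module.Basis.coord_apply, Module.Basis.repr_self, hb]
    by_cases hkl : l = k
    · subst hkl; rw [Finsupp.single_eq_same, hdual.eval_same]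
    · rw [Finsupp.single_eq_of_ne' hkl, hdual.eval_of_ne (Ne.symm hkl)]
  refine ⟨hdual.basis, ?_, ?_, ?_, ?_, ?_, ?_, ?_⟩
  · intro k l
    rw [hb, hb]
    rcases k with (i | i | i | i | i) <;> rcases l with (j | j | j | j | j) <;> intro hij
    all_goals try simp only [ne_eq, CoframeIndex.x.injEq, CoframeIndex.y₁.injEq,
      CoframeIndex.y₂.injEq, CoframeIndex.z.injEq, CoframeIndex.w.injEq] at hij
    all_goals try exact absurd (Subsingleton.elim i j) hij
    all_goals simp [bb, bxR, bxA, bxB, b₁R, b₁A, b₁B, b₂R, b₂A, b₂B, bzR, bzA, bzB, bwR,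
      bwA, bwB, hee, heα, heβ, hαe, hβe, inner_smul_right, inner_smul_left]
    all_goals exact hij
  · intro i
    simp [hb, bb, bxR, bxA, bxB, he.1 i]
  · intro i
    simp [hb, bb, b₁R, b₁A, b₁B, he.1 i]
  · intro i
    simp [hb, bb, b₂R, b₂A, b₂B, he.1 i]
  · intro v w
    simp only [hd]
    conv_lhs => rw [expR v, sum_inner]
    exact Finset.sum_congr rfl fun k _ ↦ by rw [inner_smul_left]; rfl
  · intro v w
    simp only [hd]
    conv_lhs => rw [expR v, sum_inner]
    exact Finset.sum_congr rfl fun k _ ↦ by rw [inner_smul_left]; rfl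
  · intro v w
    simp only [hd]
    conv_lhs => rw [expA v, inner_add_left, sum_inner]
    congr 1
    · exact Finset.sum_congr rfl fun k _ ↦ by rw [inner_smul_left]; rfl
    · conv_lhs => rw [expB w, inner_smul_left, inner_add_right, inner_sum, inner_smul_right]
      simp only [inner_smul_right, hαe, mul_zero, Finset.sum_const_zero, zero_add]
      simp [dd]
      ring

theorem TwoForm.mem_ker_iff {E H X : Type*} [NormedAddCommGroup E] [NormedSpace ℝ E]
    [TopologicalSpace H] {I : ModelWithCorners ℝ E H} [TopologicalSpace X] [ChartedSpace H X]
    (α : TwoForm I X) {x : X} (v : TangentSpace I x) :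
    v ∈ TwoForm.ker α x ↔ ∀ w, α x ![v, w] = 0 := by
  rw [TwoForm.ker, LinearMap.mem_ker]
  constructor
  · intro h w
    exact DFunLike.congr_fun h ![w]
  · intro h
    ext w
    have hw : w = ![w 0] := by ext i; fin_cases i; rfl
    rw [hw]
    exact h (w 0)

/-- In a weakly self-dual structure with one pair `dz, dw`, the kernels of `ω₁` and `ω₂` meet in
the plane dual to `dz, dw`. -/
theorem finrank_ker_inf_ker {E H X : Type*} [NormedAddCommGroup E] [NormedSpace ℝ E]
    [TopologicalSpace H] {I : ModelWithCorners ℝ E H} [TopologicalSpace X] [ChartedSpace H X]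
    [IsManifold I ∞ X] {m : ℕ} (S : WSDStructure I X m 1) (p : X) :
    Module.finrank ℝ ↥(TwoForm.ker S.ω₁ p ⊓ TwoForm.ker S.ω₂ p) = 2 := by
  obtain ⟨b, d, hd, -, -, -, -, h₁, h₂, -⟩ := S.adapted p
  have hdb : ∀ k, d k (b k) = 1 := fun k ↦ by rw [hd]; simp
  have hdb' : ∀ k l, l ≠ k → d k (b l) = 0 := fun k l h ↦ by
    rw [hd, Module.Basis.coord_apply, Module.Basis.repr_self, Finsupp.single_eq_of_ne' h]
  have hsum : ∀ (a c : Fin m → CoframeIndex m 1) (v w : TangentSpace I p),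
      (∑ i, wedge (d (a i)) (d (c i))) ![v, w] =
        ∑ i, (d (a i) v * d (c i) w - d (a i) w * d (c i) v) := by
    intro a c v w
    rw [ContinuousAlternatingMap.sum_apply]
    exact Finset.sum_congr rfl fun i _ ↦ wedge_apply _ _ v w
  have hmem : ∀ v, v ∈ TwoForm.ker S.ω₁ p ⊓ TwoForm.ker S.ω₂ p ↔
      ∀ i, d (.x i) v = 0 ∧ d (.y₁ i) v = 0 ∧ d (.y₂ i) v = 0 := by
    intro v
    rw [Submodule.mem_inf, TwoForm.mem_ker_iff, TwoForm.mem_ker_iff, h₁, h₂]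
    simp only [hsum]
    constructor
    · rintro ⟨h1, h2⟩ i
      refine ⟨?_, ?_, ?_⟩
      · have := h1 (b (.y₁ i))
        rw [Finset.sum_eq_single i, hdb, hdb' (.x i) (.y₁ i) (by simp)] at this
        · simpa using this
        · intro j _ hj
          rw [hdb' (.x j) (.y₁ i) (by simp), hdb' (.y₁ j) (.y₁ i) (by simpa using hj.symm)]
          ring
        · simp
      · have := h1 (b (.x i))
        rw [Finset.sum_eq_single i, hdb, hdb' (.y₁ i) (.x i) (by simp)] at this
        · simpa using this
        · intro j _ hj
          rw [hdb' (.y₁ j) (.x i) (by simp), hdb' (.x j) (.x i) (by simpa using hj.symm)]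
          ring
        · simp
      · have := h2 (b (.x i))
        rw [Finset.sum_eq_single i, hdb, hdb' (.y₂ i) (.x i) (by simp)] at this
        · simpa using this
        · intro j _ hj
          rw [hdb' (.y₂ j) (.x i) (by simp), hdb' (.x j) (.x i) (by simpa using hj.symm)]
          ring
        · simp
    · intro h
      constructor
      · intro w
        simp [fun i ↦ (h i).1, fun i ↦ (h i).2.1]
      · intro w
        simp [fun i ↦ (h i).1, fun i ↦ (h i).2.2]
  -- the kernels meet in the span of the vectors dual to `dz` and `dw`
  let c : Fin 2 → CoframeIndex m 1 := ![.z 0, .w 0]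
  have hc : Function.Injective c := by
    intro i j h
    fin_cases i <;> fin_cases j <;> simp_all [c]
  have hspan : TwoForm.ker S.ω₁ p ⊓ TwoForm.ker S.ω₂ p = Submodule.span ℝ (Set.range (b ∘ c)) := by
    ext v
    rw [hmem]
    have hrange : Set.range (b ∘ c) = b '' (Set.range c) := Set.range_comp _ _
    rw [hrange, b.mem_span_image]
    constructor
    · intro h k hk
      rw [Finset.mem_coe, Finsupp.mem_support_iff, ← Module.Basis.coord_apply, ← hd] at hk
      rcases k with (i | i | i | i | i)
      · exact absurd (h i).1 hk
      · exact absurd (h i).2.1 hk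
      · exact absurd (h i).2.2 hk
      · exact ⟨0, by simp [c, Subsingleton.elim i 0]⟩
      · exact ⟨1, by simp [c, Subsingleton.elim i 0]⟩
    · intro h i
      have h3 : ∀ k, k ∉ Set.range c → d k v = 0 := by
        intro k hk
        rw [hd, Module.Basis.coord_apply]
        by_contra h0
        exact hk (h (Finsupp.mem_support_iff.2 h0))
      refine ⟨h3 _ ?_, h3 _ ?_, h3 _ ?_⟩ <;>
      · rintro ⟨j, hj⟩
        fin_cases j <;> simp [c] at hj
  rw [hspan, finrank_span_eq_card (b.linearIndependent.comp c hc), Fintype.card_fin]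

end Frames

/-! ### The level sets of `(μ₁, μ₂)` in the space of radii -/

section Radial

variable {n : ℕ} {k₁ k₂ : ℝ}

/-- The functions `∑ r_i²` and `log ∏ r_i`, which are `μ₁` and `μ₂` up to constant factors. -/
def radialMap (n : ℕ) (s : Fin (n + 1) → ℝ) : ℝ × ℝ := (∑ i, s i ^ 2, ∑ i, Real.log (s i))

/-- The derivative of `radialMap`. -/
def radialDeriv {n : ℕ} (s : Fin (n + 1) → ℝ) : (Fin (n + 1) → ℝ) →L[ℝ] ℝ × ℝ :=
  (∑ i, (2 * s i) • ContinuousLinearMap.proj (R := ℝ) (φ := fun _ : Fin (n + 1) ↦ ℝ) i).prod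
    (∑ i, (s i)⁻¹ • ContinuousLinearMap.proj (R := ℝ) (φ := fun _ : Fin (n + 1) ↦ ℝ) i)

theorem radialDeriv_apply (s v : Fin (n + 1) → ℝ) :
    radialDeriv s v = (∑ i, 2 * s i * v i, ∑ i, (s i)⁻¹ * v i) := by
  simp [radialDeriv]

theorem hasFDerivAt_radialMap (s : Radii n) :
    HasFDerivAt (radialMap n) (radialDeriv s.1) s.1 := by
  have hp : ∀ i, HasFDerivAt (fun r : Fin (n + 1) → ℝ ↦ r i)
      (ContinuousLinearMap.proj (R := ℝ) (φ := fun _ : Fin (n + 1) ↦ ℝ) i) s.1 := fun i ↦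
    (ContinuousLinearMap.proj (R := ℝ) (φ := fun _ : Fin (n + 1) ↦ ℝ) i).hasFDerivAt
  refine HasFDerivAt.prodMk ?_ ?_
  · refine HasFDerivAt.fun_sum fun i _ ↦ ?_
    simpa using (hp i).pow 2
  · exact HasFDerivAt.fun_sum fun i _ ↦ (hp i).log (s.2 i).ne'

theorem contDiffAt_radialMap (s : Radii n) : ContDiffAt ℝ ∞ (radialMap n) s.1 := by
  refine ContDiffAt.prodMk ?_ ?_
  · exact ContDiffAt.sum fun i _ ↦ (contDiffAt_apply ℝ ℝ i s.1).pow 2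
  · exact ContDiffAt.sum fun i _ ↦ (contDiffAt_apply ℝ ℝ i s.1).log (s.2 i).ne'

theorem μ₁_eq (p : FibredProduct n) : μ₁ p = -(Real.pi * (radialMap n p.2.1.1).1) := rfl

theorem μ₂_eq (p : FibredProduct n) :
    μ₂ p = -(1 / (2 * Real.pi) * (radialMap n p.2.1.1).2) := by
  simp only [μ₂, radialMap, r]
  rw [Real.log_prod fun i _ ↦ (p.2.1.2 i).ne']

theorem mem_RadialSpace_iff {s t : Radii n} (hs : s ∈ RadialSpace n k₁ k₂) :
    t ∈ RadialSpace n k₁ k₂ ↔ radialMap n t.1 = radialMap n s.1 := by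
  have h1 := hs.1
  have h2 := hs.2
  constructor
  · rintro ⟨h3, h4⟩
    rw [← h1, μ₁_eq, μ₁_eq, neg_inj, mul_right_inj' Real.pi_ne_zero] at h3
    rw [← h2, μ₂_eq, μ₂_eq, neg_inj, mul_right_inj' (by positivity)] at h4
    exact Prod.ext h3 h4
  · intro h
    refine ⟨?_, ?_⟩
    · rw [← h1, μ₁_eq, μ₁_eq]
      exact congrArg (fun x : ℝ × ℝ ↦ -(Real.pi * x.1)) h
    · rw [← h2, μ₂_eq, μ₂_eq]
      exact congrArg (fun x : ℝ × ℝ ↦ -(1 / (2 * Real.pi) * x.2)) h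

/-- The bound on `k₁` and `k₂` excludes the equality case of the inequality between the
arithmetic and the geometric mean of the `r_i²`. -/
theorem exists_ne_of_mem_RadialSpace
    (hk : (n : ℝ) + 1 < -k₁ / Real.pi * Real.exp (4 * Real.pi / ((n : ℝ) + 1) * k₂)) {s : Radii n}
    (hs : s ∈ RadialSpace n k₁ k₂) : ∃ i j, s.1 i ≠ s.1 j := by
  by_contra! h
  have hn : (n : ℝ) + 1 ≠ 0 := by positivity
  have hpos := s.2 0
  have hpi := Real.pi_pos
  have h1 : -(Real.pi * ((n + 1) * s.1 0 ^ 2)) = k₁ := by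
    rw [← hs.1, μ₁_eq, radialMap]
    simp only [sigma, fun i ↦ h i 0]
    simp
  have h2 : -(1 / (2 * Real.pi) * ((n + 1) * Real.log (s.1 0))) = k₂ := by
    rw [← hs.2, μ₂_eq, radialMap]
    simp only [sigma, fun i ↦ h i 0]
    simp
  have h3 : 4 * Real.pi / ((n : ℝ) + 1) * k₂ = -(2 * Real.log (s.1 0)) := by
    rw [← h2]; field_simp; ring
  have h4 : -k₁ / Real.pi = (n + 1) * s.1 0 ^ 2 := by
    rw [← h1]; field_simp
  have h5 : Real.exp (2 * Real.log (s.1 0)) = s.1 0 ^ 2 := by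
    rw [mul_comm, Real.exp_mul, Real.exp_log hpos]
    norm_cast
  rw [h3, h4, Real.exp_neg, h5, mul_inv_cancel_right₀ (by positivity)] at hk
  exact lt_irrefl _ hk

/-- The differentials of `∑ r_i²` and `log ∏ r_i` are proportional only where the `r_i` are all
equal. -/
theorem radialDeriv_surjective {s : Radii n} (h : ∃ i j, s.1 i ≠ s.1 j) :
    Function.Surjective (radialDeriv s.1) := by
  obtain ⟨i, j, hij⟩ := h
  have hi := s.2 i
  have hj := s.2 j
  have hne : i ≠ j := fun h ↦ hij (by rw [h])
  have hd : s.1 i ^ 2 - s.1 j ^ 2 ≠ 0 := by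
    have : s.1 i ^ 2 - s.1 j ^ 2 = (s.1 i - s.1 j) * (s.1 i + s.1 j) := by ring
    rw [this]
    exact mul_ne_zero (sub_ne_zero.2 hij) (by positivity)
  rintro ⟨a, b⟩
  -- Cramer's rule for the minor with columns `i` and `j`
  let x : ℝ := s.1 i * (a / 2 - b * s.1 j ^ 2) / (s.1 i ^ 2 - s.1 j ^ 2)
  let y : ℝ := s.1 j * (b * s.1 i ^ 2 - a / 2) / (s.1 i ^ 2 - s.1 j ^ 2)
  refine ⟨Pi.single i x + Pi.single j y, ?_⟩
  have hsum : ∀ c : Fin (n + 1) → ℝ,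
      ∑ l, c l * (Pi.single i x + Pi.single j y : Fin (n + 1) → ℝ) l = c i * x + c j * y := by
    intro c
    simp [mul_add, Finset.sum_add_distrib, Pi.single_apply]
  rw [radialDeriv_apply, hsum (fun l ↦ 2 * s.1 l), hsum (fun l ↦ (s.1 l)⁻¹)]
  refine Prod.ext ?_ ?_
  · simp only [x, y]
    field_simp
    ring
  · simp only [x, y]
    field_simp
    ring

/-- Charts of the level set `{μ₁ = k₁, μ₂ = k₂}` which are restrictions of linear maps and have
smooth inverses; the chart `chart s` is defined around `s`. -/
structure RadialAtlas (n : ℕ) (k₁ k₂ : ℝ) where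
  chart : RadialSpace n k₁ k₂ →
    OpenPartialHomeomorph (RadialSpace n k₁ k₂) (EuclideanSpace ℝ (Fin (n - 1)))
  proj : RadialSpace n k₁ k₂ → (Fin (n + 1) → ℝ) →L[ℝ] EuclideanSpace ℝ (Fin (n - 1))
  mem_source : ∀ s, s ∈ (chart s).source
  chart_apply : ∀ s, ∀ t ∈ (chart s).source, chart s t = proj s t.1.1
  contDiffOn : ∀ s, ContDiffOn ℝ ∞ (fun z ↦ ((chart s).symm z).1.1) (chart s).target

theorem isEmbedding_radii : Topology.IsEmbedding (fun t : RadialSpace n k₁ k₂ ↦ t.1.1) :=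
  Topology.IsEmbedding.subtypeVal.comp Topology.IsEmbedding.subtypeVal

/-- The level set is a submanifold: near `s`, the map `radialMap` and a linear projection `π` onto
the kernel of its differential at `s` are coordinates of the space of radii, and `π` is a chart of
the level set. -/
theorem exists_radialChart (hn : 1 ≤ n) (s : RadialSpace n k₁ k₂)
    (hs : ∃ i j, s.1.1 i ≠ s.1.1 j) :
    ∃ (β : OpenPartialHomeomorph (RadialSpace n k₁ k₂) (EuclideanSpace ℝ (Fin (n - 1))))
      (π : (Fin (n + 1) → ℝ) →L[ℝ] EuclideanSpace ℝ (Fin (n - 1))),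
      s ∈ β.source ∧ (∀ t ∈ β.source, β t = π t.1.1) ∧
      ContDiffOn ℝ ∞ (fun z ↦ (β.symm z).1.1) β.target := by
  classical
  have hsurj := radialDeriv_surjective hs
  have hker : Module.finrank ℝ (LinearMap.ker (radialDeriv s.1.1).toLinearMap) = n - 1 := by
    have h1 := LinearMap.finrank_range_add_finrank_ker (radialDeriv s.1.1).toLinearMap
    rw [LinearMap.range_eq_top.2 hsurj, finrank_top] at h1
    simp at h1
    omega
  obtain ⟨q, hq⟩ := LinearMap.exists_leftInverse_of_injective
    (LinearMap.ker (radialDeriv s.1.1).toLinearMap).subtype (Submodule.ker_subtype _)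
  let L : LinearMap.ker (radialDeriv s.1.1).toLinearMap ≃ₗ[ℝ] EuclideanSpace ℝ (Fin (n - 1)) :=
    LinearEquiv.ofFinrankEq _ _ (by rw [hker, finrank_euclideanSpace_fin])
  let π : (Fin (n + 1) → ℝ) →L[ℝ] EuclideanSpace ℝ (Fin (n - 1)) :=
    LinearMap.toContinuousLinearMap (L.toLinearMap ∘ₗ q)
  have hinj : Function.Injective ((radialDeriv s.1.1).prod π).toLinearMap := by
    refine (injective_iff_map_eq_zero _).2 fun v hv ↦ ?_
    have hv1 : radialDeriv s.1.1 v = 0 := congrArg Prod.fst hv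
    have hv2 : L (q v) = 0 := congrArg Prod.snd hv
    have hv3 : q v = ⟨v, hv1⟩ := LinearMap.congr_fun hq ⟨v, hv1⟩
    rw [hv3, LinearEquiv.map_eq_zero_iff] at hv2
    exact congrArg Subtype.val hv2
  let T : (Fin (n + 1) → ℝ) ≃L[ℝ] (ℝ × ℝ) × EuclideanSpace ℝ (Fin (n - 1)) :=
    (LinearEquiv.ofInjectiveOfFinrankEq ((radialDeriv s.1.1).prod π).toLinearMap hinj (by
      simp only [Module.finrank_prod, Module.finrank_self, Module.finrank_fin_fun,
        finrank_euclideanSpace_fin]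
      omega)).toContinuousLinearEquiv
  have hT : (T : (Fin (n + 1) → ℝ) →L[ℝ] (ℝ × ℝ) × EuclideanSpace ℝ (Fin (n - 1))) =
      (radialDeriv s.1.1).prod π := by
    ext v <;> rfl
  let Ψ : (Fin (n + 1) → ℝ) → (ℝ × ℝ) × EuclideanSpace ℝ (Fin (n - 1)) :=
    fun x ↦ (radialMap n x, π x)
  have hΨc : ∀ x : Radii n, ContDiffAt ℝ ∞ Ψ x.1 := fun x ↦
    (contDiffAt_radialMap x).prodMk π.contDiff.contDiffAt
  have hΨd : HasFDerivAt Ψ (T : (Fin (n + 1) → ℝ) →L[ℝ] _) s.1.1 := by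
    rw [hT]
    exact (hasFDerivAt_radialMap s.1).prodMk π.hasFDerivAt
  -- the local inverse is smooth where the derivative of `Ψ` is invertible
  let U : Set (Fin (n + 1) → ℝ) := (Radii n : Set (Fin (n + 1) → ℝ)) ∩ fderiv ℝ Ψ ⁻¹'
    Set.range ((↑) : ((Fin (n + 1) → ℝ) ≃L[ℝ] (ℝ × ℝ) × EuclideanSpace ℝ (Fin (n - 1))) → _)
  have hU : IsOpen U := by
    refine ContinuousOn.isOpen_inter_preimage (fun x hx ↦ ?_) (Radii n).2
      ContinuousLinearEquiv.isOpen
    exact ((hΨc ⟨x, hx⟩).fderiv_right (m := 0) (by norm_num)).continuousAt.continuousWithinAt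
  let e := ((hΨc s.1).toOpenPartialHomeomorph Ψ hΨd (by norm_num)).restrOpen U hU
  have heΨ : ∀ x, e x = Ψ x := fun x ↦ rfl
  have hes : s.1.1 ∈ e.source :=
    ⟨(hΨc s.1).mem_toOpenPartialHomeomorph_source hΨd (by norm_num), s.1.2, T, hΨd.fderiv.symm⟩
  have heU : ∀ x ∈ e.source, x ∈ U := fun x hx ↦ hx.2
  have hesymm : ∀ z ∈ e.target, ContDiffAt ℝ ∞ e.symm z := by
    intro z hz
    obtain ⟨hp, T', hT'⟩ := heU _ (e.map_target hz)
    have hd : HasFDerivAt e (T' : (Fin (n + 1) → ℝ) →L[ℝ] _) (e.symm z) := by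
      rw [hT']
      exact ((hΨc ⟨_, hp⟩).differentiableAt (by norm_num)).hasFDerivAt
    exact e.contDiffAt_symm hz hd (hΨc ⟨_, hp⟩)
  let c := radialMap n s.1.1
  have hmem : ∀ z, (c, z) ∈ e.target →
      ∃ h : e.symm (c, z) ∈ Radii n, (⟨_, h⟩ : Radii n) ∈ RadialSpace n k₁ k₂ := by
    intro z hz
    refine ⟨(heU _ (e.map_target hz)).1, (mem_RadialSpace_iff s.2).2 ?_⟩
    exact congrArg Prod.fst (e.right_inv hz)
  have hcoe : ∀ t : RadialSpace n k₁ k₂, t.1.1 ∈ e.source → e t.1.1 = (c, π t.1.1) := by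
    intro t _
    rw [heΨ]
    exact Prod.ext ((mem_RadialSpace_iff s.2).1 t.2) rfl
  -- outside of the target the value is irrelevant
  let inv : EuclideanSpace ℝ (Fin (n - 1)) → RadialSpace n k₁ k₂ := fun z ↦
    if h : (c, z) ∈ e.target then ⟨⟨_, (hmem z h).1⟩, (hmem z h).2⟩ else s
  have hinv : ∀ z, (c, z) ∈ e.target → (inv z).1.1 = e.symm (c, z) := by
    intro z hz
    simp only [inv, dif_pos hz]
  have hsm : ContDiffOn ℝ ∞ (fun z ↦ (inv z).1.1) {z | (c, z) ∈ e.target} := by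
    have h1 : ContDiffOn ℝ ∞ (fun z ↦ e.symm (c, z)) {z | (c, z) ∈ e.target} := fun z hz ↦
      ((hesymm _ hz).comp z (contDiffAt_const.prodMk contDiffAt_id)).contDiffWithinAt
    exact h1.congr fun z hz ↦ hinv z hz
  have hval := isEmbedding_radii (n := n) (k₁ := k₁) (k₂ := k₂)
  let β : OpenPartialHomeomorph (RadialSpace n k₁ k₂) (EuclideanSpace ℝ (Fin (n - 1))) :=
    { toFun := fun t ↦ π t.1.1
      invFun := inv
      source := {t | t.1.1 ∈ e.source}
      target := {z | (c, z) ∈ e.target}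
      map_source' := fun t ht ↦ by
        change (c, π t.1.1) ∈ e.target
        rw [← hcoe t ht]
        exact e.map_source ht
      map_target' := fun z hz ↦ by
        change (inv z).1.1 ∈ e.source
        rw [hinv z hz]
        exact e.map_target hz
      left_inv' := fun t ht ↦ by
        have h1 : (c, π t.1.1) ∈ e.target := by
          rw [← hcoe t ht]
          exact e.map_source ht
        refine Subtype.ext (Subtype.ext ?_)
        rw [hinv _ h1, ← hcoe t ht, e.left_inv ht]
      right_inv' := fun z hz ↦ by
        rw [hinv z hz]
        exact congrArg Prod.snd (e.right_inv hz)
      open_source := e.open_source.preimage hval.continuous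
      open_target := e.open_target.preimage (by fun_prop)
      continuousOn_toFun := (π.continuous.comp hval.continuous).continuousOn
      continuousOn_invFun := hval.isInducing.continuousOn_iff.2 hsm.continuousOn }
  exact ⟨β, π, hes, fun t _ ↦ rfl, hsm⟩

theorem nonempty_radialAtlas (hn : 1 ≤ n)
    (hk : (n : ℝ) + 1 < -k₁ / Real.pi * Real.exp (4 * Real.pi / ((n : ℝ) + 1) * k₂)) :
    Nonempty (RadialAtlas n k₁ k₂) := by
  choose β π h1 h2 h3 using fun s : RadialSpace n k₁ k₂ ↦
    exists_radialChart hn s (exists_ne_of_mem_RadialSpace hk s.2)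
  exact ⟨⟨β, π, h1, h2, h3⟩⟩

namespace RadialAtlas

variable (R : RadialAtlas n k₁ k₂)

/-- The inverse of the chart at `s`, with values in `ℝ^{n+1}`. -/
def param (s : RadialSpace n k₁ k₂) (z : EuclideanSpace ℝ (Fin (n - 1))) : Fin (n + 1) → ℝ :=
  ((R.chart s).symm z).1.1

theorem contDiffAt_param {s : RadialSpace n k₁ k₂} {z : EuclideanSpace ℝ (Fin (n - 1))}
    (hz : z ∈ (R.chart s).target) : ContDiffAt ℝ ∞ (R.param s) z :=
  (R.contDiffOn s).contDiffAt ((R.chart s).open_target.mem_nhds hz)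

theorem proj_param {s : RadialSpace n k₁ k₂} {z : EuclideanSpace ℝ (Fin (n - 1))}
    (hz : z ∈ (R.chart s).target) : R.proj s (R.param s z) = z := by
  rw [param, ← R.chart_apply s _ ((R.chart s).map_target hz), (R.chart s).right_inv hz]

theorem fderiv_param_injective {s : RadialSpace n k₁ k₂} {z : EuclideanSpace ℝ (Fin (n - 1))}
    (hz : z ∈ (R.chart s).target) : Function.Injective (fderiv ℝ (R.param s) z) := by
  have h1 : HasFDerivAt (R.param s) (fderiv ℝ (R.param s) z) z :=
    ((R.contDiffAt_param hz).differentiableAt (by norm_num)).hasFDerivAt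
  have h2 : HasFDerivAt (fun y ↦ R.proj s (R.param s y))
      ((R.proj s).comp (fderiv ℝ (R.param s) z)) z := (R.proj s).hasFDerivAt.comp z h1
  have h3 : HasFDerivAt (fun y ↦ R.proj s (R.param s y))
      (ContinuousLinearMap.id ℝ (EuclideanSpace ℝ (Fin (n - 1)))) z :=
    (hasFDerivAt_id z).congr_of_eventuallyEq
      (Filter.eventually_of_mem ((R.chart s).open_target.mem_nhds hz) fun y hy ↦ R.proj_param hy)
  have h4 := h2.unique h3
  intro v w hvw
  have h5 : ∀ u, R.proj s (fderiv ℝ (R.param s) z u) = u := fun u ↦ DFunLike.congr_fun h4 u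
  rw [← h5 v, hvw, h5]

/-- The tangent space of the level set, by a count of dimensions. -/
theorem range_fderiv_param (hn : 1 ≤ n) {s : RadialSpace n k₁ k₂}
    (hne : ∀ t : RadialSpace n k₁ k₂, ∃ i j, t.1.1 i ≠ t.1.1 j)
    {z : EuclideanSpace ℝ (Fin (n - 1))} (hz : z ∈ (R.chart s).target) (v : Fin (n + 1) → ℝ) :
    (∃ u, fderiv ℝ (R.param s) z u = v) ↔ radialDeriv (R.param s z) v = 0 := by
  let t := (R.chart s).symm z
  have h1 : HasFDerivAt (R.param s) (fderiv ℝ (R.param s) z) z :=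
    ((R.contDiffAt_param hz).differentiableAt (by norm_num)).hasFDerivAt
  have h2 : HasFDerivAt (fun y ↦ radialMap n (R.param s y))
      ((radialDeriv (R.param s z)).comp (fderiv ℝ (R.param s) z)) z :=
    HasFDerivAt.comp (g := radialMap n) z (hasFDerivAt_radialMap t.1) h1
  have h3 : HasFDerivAt (fun y ↦ radialMap n (R.param s y))
      (0 : EuclideanSpace ℝ (Fin (n - 1)) →L[ℝ] ℝ × ℝ) z := by
    refine (hasFDerivAt_const (radialMap n s.1.1) z).congr_of_eventuallyEq
      (Filter.Eventually.of_forall fun y ↦ ?_)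
    exact (mem_RadialSpace_iff s.2).1 ((R.chart s).symm y).2
  have h4 := h2.unique h3
  have hle : LinearMap.range (fderiv ℝ (R.param s) z).toLinearMap ≤
      LinearMap.ker (radialDeriv (R.param s z)).toLinearMap := by
    rintro _ ⟨u, rfl⟩
    exact DFunLike.congr_fun h4 u
  have heq : LinearMap.range (fderiv ℝ (R.param s) z).toLinearMap =
      LinearMap.ker (radialDeriv (R.param s z)).toLinearMap := by
    refine Submodule.eq_of_le_of_finrank_eq hle ?_
    have h5 := LinearMap.finrank_range_add_finrank_ker
      (radialDeriv (R.param s z)).toLinearMap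
    have h6 : LinearMap.range (radialDeriv (R.param s z)).toLinearMap = ⊤ :=
      LinearMap.range_eq_top.2 (radialDeriv_surjective (s := t.1) (hne t))
    rw [h6, finrank_top] at h5
    rw [LinearMap.finrank_range_of_inj (R.fderiv_param_injective hz), finrank_euclideanSpace_fin]
    simp at h5
    omega
  exact SetLike.ext_iff.1 heq v

/-- The transition functions are smooth. -/
theorem contDiffAt_transition {s t : RadialSpace n k₁ k₂} {z : EuclideanSpace ℝ (Fin (n - 1))}
    (hz : z ∈ (R.chart s).target) (hzt : (R.chart s).symm z ∈ (R.chart t).source) :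
    ContDiffAt ℝ ∞ (fun y ↦ R.chart t ((R.chart s).symm y)) z := by
  refine ((R.proj t).contDiff.contDiffAt.comp z (R.contDiffAt_param hz)).congr_of_eventuallyEq ?_
  have h1 := ((R.chart s).symm.continuousAt hz).preimage_mem_nhds
    ((R.chart t).open_source.mem_nhds hzt)
  filter_upwards [h1] with y hy
  exact R.chart_apply t _ hy

/-- The level set as a charted space. -/
@[reducible] def chartedSpace :
    ChartedSpace (EuclideanSpace ℝ (Fin (n - 1))) (RadialSpace n k₁ k₂) where
  atlas := Set.range R.chart
  chartAt := R.chart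
  mem_chart_source := R.mem_source
  chart_mem_atlas s := ⟨s, rfl⟩

theorem isManifold : letI := R.chartedSpace; IsManifold (𝓡 (n - 1)) ∞ (RadialSpace n k₁ k₂) := by
  let _ := R.chartedSpace
  refine isManifold_of_contDiffOn _ _ _ ?_
  rintro _ _ ⟨a, rfl⟩ ⟨b, rfl⟩
  simp only [modelWithCornersSelf_coe, modelWithCornersSelf_coe_symm, Function.comp_id,
    Function.id_comp, Set.range_id, Set.preimage_id, Set.inter_univ]
  exact fun y hy ↦ (R.contDiffAt_transition hy.1 hy.2).contDiffWithinAt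

end RadialAtlas

/-- The level set is closed in `ℝ^{n+1}`, as the product of the coordinates is bounded below, and
bounded, as the sum of their squares is. -/
theorem compactSpace_RadialSpace : CompactSpace (RadialSpace n k₁ k₂) := by
  rcases isEmpty_or_nonempty (RadialSpace n k₁ k₂) with h | ⟨⟨s, hs⟩⟩
  · infer_instance
  have hrange : Set.range (fun t : RadialSpace n k₁ k₂ ↦ t.1.1) =
      {x | (∀ i, 0 ≤ x i) ∧ ∑ i, x i ^ 2 = ∑ i, s.1 i ^ 2 ∧ ∏ i, x i = ∏ i, s.1 i} := by
    ext x
    constructor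
    · rintro ⟨t, rfl⟩
      have h := (mem_RadialSpace_iff hs).1 t.2
      refine ⟨fun i ↦ (t.1.2 i).le, congrArg Prod.fst h, ?_⟩
      have h2 : ∑ i, Real.log (t.1.1 i) = ∑ i, Real.log (s.1 i) := congrArg Prod.snd h
      rw [← Real.log_prod fun i _ ↦ (t.1.2 i).ne', ← Real.log_prod fun i _ ↦ (s.2 i).ne'] at h2
      exact Real.log_injOn_pos (Finset.prod_pos fun i _ ↦ t.1.2 i)
        (Finset.prod_pos fun i _ ↦ s.2 i) h2
    · rintro ⟨h1, h2, h3⟩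
      have h4 : ∏ i, x i ≠ 0 := by
        rw [h3]
        exact (Finset.prod_pos fun i _ ↦ s.2 i).ne'
      have h5 : ∀ i, 0 < x i := fun i ↦
        (h1 i).lt_of_ne (Finset.prod_ne_zero_iff.1 h4 i (Finset.mem_univ i)).symm
      refine ⟨⟨⟨x, h5⟩, (mem_RadialSpace_iff hs).2 (Prod.ext h2 ?_)⟩, rfl⟩
      change ∑ i, Real.log (x i) = ∑ i, Real.log (s.1 i)
      rw [← Real.log_prod fun i _ ↦ (h5 i).ne', ← Real.log_prod fun i _ ↦ (s.2 i).ne', h3]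
  have hclosed : IsClosed (Set.range (fun t : RadialSpace n k₁ k₂ ↦ t.1.1)) := by
    rw [hrange]
    refine IsClosed.inter ?_ (IsClosed.inter ?_ ?_)
    · have : {x : Fin (n + 1) → ℝ | ∀ i, 0 ≤ x i} = ⋂ i, {x | 0 ≤ x i} := by ext; simp
      change IsClosed {x : Fin (n + 1) → ℝ | ∀ i, 0 ≤ x i}
      rw [this]
      exact isClosed_iInter fun i ↦ isClosed_le continuous_const (continuous_apply i)
    · exact isClosed_eq (by fun_prop) continuous_const
    · exact isClosed_eq (by fun_prop) continuous_const
  have hbdd : Bornology.IsBounded (Set.range (fun t : RadialSpace n k₁ k₂ ↦ t.1.1)) := by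
    rw [hrange]
    refine (Metric.isBounded_closedBall (x := (0 : Fin (n + 1) → ℝ))
      (r := √(∑ i, s.1 i ^ 2))).subset ?_
    rintro x ⟨-, h2, -⟩
    rw [mem_closedBall_zero_iff, pi_norm_le_iff_of_nonneg (Real.sqrt_nonneg _)]
    intro i
    rw [Real.norm_eq_abs]
    refine Real.abs_le_sqrt ?_
    rw [← h2]
    exact Finset.single_le_sum (f := fun j ↦ x j ^ 2) (fun j _ ↦ sq_nonneg _) (Finset.mem_univ i)
  have hemb : Topology.IsClosedEmbedding (fun t : RadialSpace n k₁ k₂ ↦ t.1.1) :=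
    ⟨isEmbedding_radii, hclosed⟩
  have hcomp : IsCompact (Set.range (fun t : RadialSpace n k₁ k₂ ↦ t.1.1)) :=
    Metric.isCompact_of_isClosed_isBounded hclosed hbdd
  rw [← Set.image_univ] at hcomp
  exact ⟨hemb.isEmbedding.isInducing.isCompact_iff.2 hcomp⟩

/-- The level set meets the curve `(c e^{nt}, c e^{-t}, …, c e^{-t})`, along which the product of
the coordinates is constant and the sum of their squares tends to infinity. -/
theorem nonempty_RadialSpace (hn : 1 ≤ n)
    (hk : (n : ℝ) + 1 < -k₁ / Real.pi * Real.exp (4 * Real.pi / ((n : ℝ) + 1) * k₂)) :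
    Nonempty (RadialSpace n k₁ k₂) := by
  have hn0 : (n : ℝ) + 1 ≠ 0 := by positivity
  have hn1 : (1 : ℝ) ≤ n := by exact_mod_cast hn
  have hpi := Real.pi_pos
  -- the logarithm of the geometric mean of the radii
  let a : ℝ := -(2 * Real.pi * k₂ / (n + 1))
  let φ : ℝ → ℝ := fun t ↦ Real.exp (2 * (a + n * t)) + n * Real.exp (2 * (a - t))
  have hφ : Continuous φ := by fun_prop
  have hE : Real.exp (4 * Real.pi / ((n : ℝ) + 1) * k₂) * Real.exp (2 * a) = 1 := by
    rw [← Real.exp_add, Real.exp_eq_one_iff]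
    simp only [a]
    ring
  have h0 : φ 0 ≤ -k₁ / Real.pi := by
    have h1 : φ 0 = (n + 1) * Real.exp (2 * a) := by simp only [φ]; ring_nf
    rw [h1]
    have h2 := mul_le_mul_of_nonneg_right hk.le (Real.exp_pos (2 * a)).le
    rwa [mul_assoc (-k₁ / Real.pi), hE, mul_one] at h2
  have hK : 0 < -k₁ / Real.pi := lt_of_lt_of_le (by positivity) h0
  let T : ℝ := -k₁ / Real.pi / Real.exp (2 * a)
  have hT0 : 0 ≤ T := by positivity
  have hT : -k₁ / Real.pi ≤ φ T := by
    have h1 : T ≤ Real.exp (2 * n * T) := by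
      have h2 := Real.add_one_le_exp (2 * n * T)
      nlinarith
    have h3 : Real.exp (2 * (a + n * T)) = Real.exp (2 * a) * Real.exp (2 * n * T) := by
      rw [← Real.exp_add]; ring_nf
    have h4 : Real.exp (2 * a) * T = -k₁ / Real.pi := by
      simp only [T]; field_simp
    have h5 : Real.exp (2 * a) * T ≤ Real.exp (2 * a) * Real.exp (2 * n * T) :=
      mul_le_mul_of_nonneg_left h1 (Real.exp_pos _).le
    have h6 : 0 ≤ n * Real.exp (2 * (a - T)) := by positivity
    change _ ≤ Real.exp (2 * (a + n * T)) + n * Real.exp (2 * (a - T))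
    rw [h3]
    linarith
  obtain ⟨t, -, ht⟩ := intermediate_value_Icc hT0 hφ.continuousOn ⟨h0, hT⟩
  let x : Fin (n + 1) → ℝ := Fin.snoc (fun _ : Fin n ↦ Real.exp (a - t)) (Real.exp (a + n * t))
  have hx1 : ∀ i : Fin n, x i.castSucc = Real.exp (a - t) := fun i ↦ by simp [x]
  have hx2 : x (Fin.last n) = Real.exp (a + n * t) := by simp [x]
  have hx : ∀ i, 0 < x i := by
    intro i
    induction i using Fin.lastCases with
    | last => rw [hx2]; exact Real.exp_pos _
    | cast i => rw [hx1]; exact Real.exp_pos _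
  refine ⟨⟨⟨x, hx⟩, ?_, ?_⟩⟩
  · rw [μ₁_eq]
    change -(Real.pi * ∑ i, x i ^ 2) = k₁
    rw [Fin.sum_univ_castSucc]
    simp only [hx1, hx2, ← Real.exp_nat_mul]
    have h7 : (∑ _i : Fin n, Real.exp ((2 : ℕ) * (a - t))) +
        Real.exp ((2 : ℕ) * (a + n * t)) = φ t := by
      simp [φ, add_comm]
    rw [h7, ht]
    field_simp
  · rw [μ₂_eq]
    change -(1 / (2 * Real.pi) * ∑ i, Real.log (x i)) = k₂
    rw [Fin.sum_univ_castSucc]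
    simp only [hx1, hx2, Real.log_exp, Finset.sum_const, Finset.card_univ, Fintype.card_fin,
      nsmul_eq_mul, a]
    field_simp
    ring

end Radial

/-! ### Weakly self-dual structures from local coordinates `(θ̄, r̄, η̄)` -/

section Developing

/-- The vectors with components in the coordinates `(θ̄, r̄, η̄)`. -/
abbrev AmbientVec (n : ℕ) : Type := (Fin (n + 1) → ℝ) × (Fin (n + 1) → ℝ) × (Fin (n + 1) → ℝ)

/-- The `i`-th `θ`-component of a vector. -/
def compθ {n : ℕ} (i : Fin (n + 1)) : AmbientVec n →L[ℝ] ℝ :=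
  (ContinuousLinearMap.proj i).comp (ContinuousLinearMap.fst ℝ (Fin (n + 1) → ℝ)
    ((Fin (n + 1) → ℝ) × (Fin (n + 1) → ℝ)))

/-- The `i`-th `r`-component of a vector. -/
def compr {n : ℕ} (i : Fin (n + 1)) : AmbientVec n →L[ℝ] ℝ :=
  (ContinuousLinearMap.proj i).comp ((ContinuousLinearMap.fst ℝ (Fin (n + 1) → ℝ)
    (Fin (n + 1) → ℝ)).comp (ContinuousLinearMap.snd ℝ (Fin (n + 1) → ℝ)
    ((Fin (n + 1) → ℝ) × (Fin (n + 1) → ℝ))))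

/-- The `i`-th `η`-component of a vector. -/
def compη {n : ℕ} (i : Fin (n + 1)) : AmbientVec n →L[ℝ] ℝ :=
  (ContinuousLinearMap.proj i).comp ((ContinuousLinearMap.snd ℝ (Fin (n + 1) → ℝ)
    (Fin (n + 1) → ℝ)).comp (ContinuousLinearMap.snd ℝ (Fin (n + 1) → ℝ)
    ((Fin (n + 1) → ℝ) × (Fin (n + 1) → ℝ))))

variable (n : ℕ) (E : Type*) [NormedAddCommGroup E] [NormedSpace ℝ E]
  (X : Type*) [TopologicalSpace X] [ChartedSpace E X]

/-- Coordinates `(θ̄, r̄, η̄)` on the chart domains of a manifold, which satisfy the infinitesimal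
relations `∑ dθ_i = ∑ r_i dr_i = ∑ dr_i / r_i = ∑ dη_i = 0` and no others. They agree on overlaps
up to locally constant terms, and the coordinates `r̄` are globally defined. The distribution
`dr̄ = 0` is constant in the charts. -/
structure DevelopingMaps where
  /-- The global coordinates `r̄`. -/
  radius : X → Radii n
  /-- The coordinates on the domain of the chart at `x`, as functions on the image of the chart. -/
  toFun : X → E → AmbientVec n
  contDiffOn : ∀ x, ContDiffOn ℝ ∞ (toFun x) (chartAt E x).target
  toFun_radius : ∀ x, ∀ y ∈ (chartAt E x).source, (toFun x (chartAt E x y)).2.1 = (radius y).1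
  overlap : ∀ x, ∀ y ∈ (chartAt E x).source, ∃ c, ∀ᶠ y' in nhds y,
    toFun y (chartAt E y y') = toFun x (chartAt E x y') + c
  injective : ∀ x, Function.Injective (fderiv ℝ (toFun x) (chartAt E x x))
  mem_range : ∀ x v, (∃ u, fderiv ℝ (toFun x) (chartAt E x x) u = v) ↔
    ∑ i, v.1 i = 0 ∧ ∑ i, (radius x).1 i * v.2.1 i = 0 ∧ ∑ i, ((radius x).1 i)⁻¹ * v.2.1 i = 0 ∧
      ∑ i, v.2.2 i = 0
  /-- The subspace `dr̄ = 0`. -/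
  vertical : Submodule ℝ E
  mem_vertical : ∀ x, ∀ z ∈ (chartAt E x).target, ∀ u,
    u ∈ vertical ↔ (fderiv ℝ (toFun x) z u).2.1 = 0

namespace DevelopingMaps

variable {n E X} (G : DevelopingMaps n E X)

/-- The components `(dθ̄, dr̄, dη̄)` of a tangent vector. -/
def components (x : X) : TangentSpace 𝓘(ℝ, E) x →L[ℝ] AmbientVec n :=
  fderiv ℝ (G.toFun x) (chartAt E x x)

theorem hasFDerivAt_toFun {x : X} {z : E} (hz : z ∈ (chartAt E x).target) :
    HasFDerivAt (G.toFun x) (fderiv ℝ (G.toFun x) z) z :=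
  (((G.contDiffOn x).contDiffAt ((chartAt E x).open_target.mem_nhds hz)).differentiableAt
    (by norm_num)).hasFDerivAt

variable [IsManifold 𝓘(ℝ, E) ∞ X]

/-- The components at any point of a chart domain are the differential of the coordinates which
belong to that chart, as the coordinates of other charts differ by locally constant terms. -/
theorem components_eq {x y : X} (hy : y ∈ (chartAt E x).source) :
    G.components y = (fderiv ℝ (G.toFun x) (chartAt E x y)).comp
      (mfderiv 𝓘(ℝ, E) 𝓘(ℝ, E) (extChartAt 𝓘(ℝ, E) x) y) := by
  have : IsManifold 𝓘(ℝ, E) 1 X := IsManifold.of_le (n := ∞) (by norm_num)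
  obtain ⟨c, hc⟩ := G.overlap x y hy
  have key : ∀ x', y ∈ (chartAt E x').source → ∀ c', HasMFDerivAt 𝓘(ℝ, E) 𝓘(ℝ, AmbientVec n)
      (fun y' ↦ G.toFun x' (chartAt E x' y') + c') y
      ((fderiv ℝ (G.toFun x') (chartAt E x' y)).comp
        (mfderiv 𝓘(ℝ, E) 𝓘(ℝ, E) (extChartAt 𝓘(ℝ, E) x') y)) := by
    intro x' hx' c'
    have h1 := ((G.hasFDerivAt_toFun ((chartAt E x').map_source hx')).add_const c').hasMFDerivAt
    have h2 := (mdifferentiableAt_extChartAt (I := 𝓘(ℝ, E)) hx').hasMFDerivAt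
    exact HasMFDerivAt.comp y h1 h2
  have h1 := key y (mem_chart_source E y) 0
  have h2 := key x hy c
  have h3 := h2.congr_of_eventuallyEq (f₁ := fun y' ↦ G.toFun y (chartAt E y y') + 0) (by
    filter_upwards [hc] with y' hy'
    rw [hy', add_zero])
  rw [← hasMFDerivAt_unique h1 h3, mfderiv_extChartAt_self]
  rfl

theorem components_comp_symm {x : X} {z : E} (hz : z ∈ (chartAt E x).target) :
    (G.components ((extChartAt 𝓘(ℝ, E) x).symm z)).comp
      (mfderivWithin 𝓘(ℝ, E) 𝓘(ℝ, E) (extChartAt 𝓘(ℝ, E) x).symm (Set.range 𝓘(ℝ, E)) z) =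
      fderiv ℝ (G.toFun x) z := by
  have : IsManifold 𝓘(ℝ, E) 1 X := IsManifold.of_le (n := ∞) (by norm_num)
  have hz' : z ∈ (extChartAt 𝓘(ℝ, E) x).target := by simpa using hz
  have hy : (extChartAt 𝓘(ℝ, E) x).symm z ∈ (chartAt E x).source := by
    simpa using (extChartAt 𝓘(ℝ, E) x).map_target hz'
  have h3 : chartAt E x ((extChartAt 𝓘(ℝ, E) x).symm z) = z := by
    simpa using (chartAt E x).right_inv hz
  have h4 := mfderiv_extChartAt_comp_mfderivWithin_extChartAt_symm (I := 𝓘(ℝ, E)) hz'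
  refine ContinuousLinearMap.ext fun u ↦ ?_
  rw [G.components_eq hy, h3]
  exact congrArg (fderiv ℝ (G.toFun x) z) (DFunLike.congr_fun h4 u)

omit [IsManifold 𝓘(ℝ, E) ∞ X] in
theorem toFun_of_mem_target {x : X} {z : E} (hz : z ∈ (chartAt E x).target) :
    (G.toFun x z).2.1 = (G.radius ((extChartAt 𝓘(ℝ, E) x).symm z)).1 := by
  have h := G.toFun_radius x _ ((chartAt E x).map_target hz)
  rw [(chartAt E x).right_inv hz] at h
  simpa using h

/-- The form `∑ H(r_i) α_i ∧ β_i` on vectors with components in `(θ̄, r̄, η̄)`. -/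
def coordForm (H : ℝ → ℝ) (α β : Fin (n + 1) → AmbientVec n →L[ℝ] ℝ) :
    AmbientVec n → AmbientVec n [⋀^Fin 2]→L[ℝ] ℝ := fun v ↦
  ∑ i, H (v.2.1 i) • wedge (α i) (β i)

/-- The form `∑ H(r_i) α_i ∧ β_i` on a manifold with coordinates `(θ̄, r̄, η̄)`. As its coefficients
depend only on `r̄`, the coordinates `θ̄` and `η̄`, which are not globally defined, are replaced
by zero. -/
def form (H : ℝ → ℝ) (α β : Fin (n + 1) → AmbientVec n →L[ℝ] ℝ) : TwoForm 𝓘(ℝ, E) X := fun x ↦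
  (coordForm H α β (0, (G.radius x).1, 0)).compContinuousLinearMap (G.components x)

theorem inChart_form {H : ℝ → ℝ} {α β : Fin (n + 1) → AmbientVec n →L[ℝ] ℝ} {x : X} {z : E}
    (hz : z ∈ (chartAt E x).target) :
    TwoForm.inChart (G.form H α β) x z =
      (coordForm H α β (G.toFun x z)).compContinuousLinearMap (fderiv ℝ (G.toFun x) z) := by
  ext v
  have h1 : coordForm H α β (0, (G.radius ((extChartAt 𝓘(ℝ, E) x).symm z)).1, 0) =
      coordForm H α β (G.toFun x z) := by
    simp only [coordForm, G.toFun_of_mem_target hz]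
  have h2 : ∀ i, G.components ((extChartAt 𝓘(ℝ, E) x).symm z)
      (mfderivWithin 𝓘(ℝ, E) 𝓘(ℝ, E) (extChartAt 𝓘(ℝ, E) x).symm (Set.range 𝓘(ℝ, E)) z (v i)) =
      fderiv ℝ (G.toFun x) z (v i) := fun i ↦
    DFunLike.congr_fun (G.components_comp_symm hz) (v i)
  rw [← h1]
  exact congrArg (coordForm H α β (0, (G.radius ((extChartAt 𝓘(ℝ, E) x).symm z)).1, 0))
    (funext h2)

omit [IsManifold 𝓘(ℝ, E) ∞ X] in
theorem toFun_pos {x : X} {z : E} (hz : z ∈ (chartAt E x).target) (i : Fin (n + 1)) :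
    0 < (G.toFun x z).2.1 i := by
  rw [G.toFun_of_mem_target hz]
  exact (G.radius _).2 i

omit [IsManifold 𝓘(ℝ, E) ∞ X] in
theorem contDiffOn_fderiv (x : X) :
    ContDiffOn ℝ ∞ (fderiv ℝ (G.toFun x)) (chartAt E x).target :=
  (G.contDiffOn x).fderiv_of_isOpen (chartAt E x).open_target (by norm_num)

theorem isSmooth_form [FiniteDimensional ℝ E] {H : ℝ → ℝ} (hH : ContDiffOn ℝ ∞ H (Set.Ioi 0))
    (α β : Fin (n + 1) → AmbientVec n →L[ℝ] ℝ) : TwoForm.IsSmooth (G.form H α β) := by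
  intro x
  have htar : (extChartAt 𝓘(ℝ, E) x).target = (chartAt E x).target := by simp
  rw [htar]
  have h1 : ContDiffOn ℝ ∞ (fun z ↦ ∑ i, H ((G.toFun x z).2.1 i) •
      wedge ((α i).comp (fderiv ℝ (G.toFun x) z)) ((β i).comp (fderiv ℝ (G.toFun x) z)))
      (chartAt E x).target := by
    refine ContDiffOn.sum fun i _ ↦ ContDiffOn.fun_smul ?_ (contDiffOn_wedge ?_ ?_)
    · exact hH.comp ((compr i).contDiff.comp_contDiffOn (G.contDiffOn x))
        fun z hz ↦ G.toFun_pos hz i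
    · exact contDiffOn_const.clm_comp (G.contDiffOn_fderiv x)
    · exact contDiffOn_const.clm_comp (G.contDiffOn_fderiv x)
  refine h1.congr fun z hz ↦ ?_
  rw [G.inChart_form hz]
  ext v
  simp only [coordForm, ← wedge_compContinuousLinearMap]
  simp

/-- In a chart the form is the pullback along the coordinates of the form `coordForm H α β`. -/
theorem isClosed_form {H : ℝ → ℝ} {α β : Fin (n + 1) → AmbientVec n →L[ℝ] ℝ}
    (h : ∀ v : AmbientVec n, (∀ i, 0 < v.2.1 i) →
      DifferentiableAt ℝ (coordForm H α β) v ∧ extDeriv (coordForm H α β) v = 0) :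
    TwoForm.IsClosed (G.form H α β) := by
  intro x z hz
  have hz' : z ∈ (chartAt E x).target := by simpa using hz
  obtain ⟨h1, h2⟩ := h (G.toFun x z) fun i ↦ G.toFun_pos hz' i
  have h3 : TwoForm.inChart (G.form H α β) x =ᶠ[nhds z] fun z ↦
      (coordForm H α β (G.toFun x z)).compContinuousLinearMap (fderiv ℝ (G.toFun x) z) :=
    Filter.eventually_of_mem ((chartAt E x).open_target.mem_nhds hz') fun y hy ↦
      G.inChart_form hy
  rw [modelWithCornersSelf_coe, Set.range_id, extDerivWithin_univ, h3.extDeriv_eq,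
    extDeriv_pullback (r := ∞) h1
      ((G.contDiffOn x).contDiffAt ((chartAt E x).open_target.mem_nhds hz'))
      (by rw [minSmoothness_of_isRCLikeNormedField]; exact WithTop.coe_le_coe.2 le_top), h2]
  rfl

end DevelopingMaps

/-- The factors `H(r_i)` of `dr_i ∧ β_i` do not contribute to the exterior derivative. -/
theorem extDeriv_coordForm_compr {n : ℕ} {H : ℝ → ℝ} (hH : DifferentiableOn ℝ H (Set.Ioi 0))
    (β : Fin (n + 1) → AmbientVec n →L[ℝ] ℝ) (v : AmbientVec n) (hv : ∀ i, 0 < v.2.1 i) :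
    DifferentiableAt ℝ (DevelopingMaps.coordForm H compr β) v ∧
      extDeriv (DevelopingMaps.coordForm H compr β) v = 0 := by
  have h1 : ∀ i, DifferentiableAt ℝ H (compr i v) := fun i ↦
    hH.differentiableAt (isOpen_Ioi.mem_nhds (hv i))
  have h2 : ∀ i, DifferentiableAt ℝ (fun y ↦ H (compr i y) • wedge (compr i) (β i)) v := fun i ↦
    ((h1 i).comp v (compr i).differentiableAt).smul_const _
  refine ⟨DifferentiableAt.fun_sum fun i _ ↦ h2 i, ?_⟩
  exact (extDeriv_sum Finset.univ fun i _ ↦ h2 i).trans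
    (Finset.sum_eq_zero fun i _ ↦ extDeriv_smul_wedge _ _ (h1 i))

theorem extDeriv_coordForm_one {n : ℕ} (α β : Fin (n + 1) → AmbientVec n →L[ℝ] ℝ)
    (v : AmbientVec n) : DifferentiableAt ℝ (DevelopingMaps.coordForm (fun _ ↦ 1) α β) v ∧
      extDeriv (DevelopingMaps.coordForm (fun _ ↦ 1) α β) v = 0 := by
  have h2 : ∀ i, DifferentiableAt ℝ (fun _ ↦ (1 : ℝ) • wedge (α i) (β i)) v := fun i ↦
    differentiableAt_const _
  refine ⟨DifferentiableAt.fun_sum fun i _ ↦ h2 i, ?_⟩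
  exact (extDeriv_sum Finset.univ fun i _ ↦ h2 i).trans
    (Finset.sum_eq_zero fun i _ ↦
      extDeriv_smul_wedge (H := fun _ ↦ 1) (α i) (β i) (differentiableAt_const _))

/-- The unit ball of a positive definite bilinear form is bounded. -/
theorem isVonNBounded_of_posDef {E : Type*} [NormedAddCommGroup E] [NormedSpace ℝ E]
    [FiniteDimensional ℝ E] (B : E →L[ℝ] E →L[ℝ] ℝ) (hB : ∀ v, v ≠ 0 → 0 < B v v) :
    Bornology.IsVonNBounded ℝ {v | B v v < 1} := by
  rw [NormedSpace.isVonNBounded_iff]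
  rcases subsingleton_or_nontrivial E with h | h
  · exact (Bornology.IsBounded.all _)
  have hB' : Continuous fun v ↦ B v v := by fun_prop
  obtain ⟨u, hu, hmin⟩ := (isCompact_sphere (0 : E) 1).exists_isMinOn
    (NormedSpace.sphere_nonempty.2 zero_le_one) hB'.continuousOn
  have hu0 : u ≠ 0 := by
    rintro rfl
    simp at hu
  have hm := hB u hu0
  refine (Metric.isBounded_closedBall (x := (0 : E)) (r := √(1 / B u u))).subset fun v hv ↦ ?_
  rw [mem_closedBall_zero_iff]
  refine Real.le_sqrt_of_sq_le ?_
  by_cases hv0 : v = 0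
  · simp [hv0, hm.le]
  have hvn : ‖v‖ ≠ 0 := norm_ne_zero_iff.2 hv0
  have h1 : B u u ≤ B (‖v‖⁻¹ • v) (‖v‖⁻¹ • v) := hmin (by simp [norm_smul, hvn])
  simp only [map_smul, smul_apply, smul_eq_mul] at h1
  rw [le_div_iff₀ hm]
  have hv' : B v v < 1 := hv
  calc ‖v‖ ^ 2 * B u u ≤ ‖v‖ ^ 2 * (‖v‖⁻¹ * (‖v‖⁻¹ * B v v)) := by gcongr
    _ = B v v := by field_simp
    _ ≤ 1 := hv'.le

/-- The pullback along `L` of the metric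
`∑ (dr_i² + 4π² r_i² dθ_i² + (1 / 4π² r_i²) dη_i²)` at a point with coordinates `r̄ = s`. -/
def metricForm {n : ℕ} {E : Type*} [NormedAddCommGroup E] [NormedSpace ℝ E]
    (s : Fin (n + 1) → ℝ) (L : E →L[ℝ] AmbientVec n) : E →L[ℝ] E →L[ℝ] ℝ :=
  ∑ i, (((compr i).comp L).smulRight ((compr i).comp L) +
    ((compθ i).comp L).smulRight ((4 * Real.pi ^ 2 * s i ^ 2) • (compθ i).comp L) +
    ((compη i).comp L).smulRight ((1 / (4 * Real.pi ^ 2 * s i ^ 2)) • (compη i).comp L))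

theorem metricForm_apply {n : ℕ} {E : Type*} [NormedAddCommGroup E] [NormedSpace ℝ E]
    (s : Radii n) (L : E →L[ℝ] AmbientVec n) (v w : E) :
    metricForm s.1 L v w = ambientMetric (sigma s) (L v) (L w) := by
  simp only [metricForm, ambientMetric, sum_apply]
  refine Finset.sum_congr rfl fun i _ ↦ ?_
  change compr i (L v) * compr i (L w) +
    compθ i (L v) * (4 * Real.pi ^ 2 * s.1 i ^ 2 * compθ i (L w)) +
    compη i (L v) * (1 / (4 * Real.pi ^ 2 * s.1 i ^ 2) * compη i (L w)) =
    compr i (L v) * compr i (L w) + 4 * Real.pi ^ 2 * s.1 i ^ 2 * (compθ i (L v) * compθ i (L w)) +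
    1 / (4 * Real.pi ^ 2 * s.1 i ^ 2) * (compη i (L v) * compη i (L w))
  ring

theorem metricForm_pos {n : ℕ} {E : Type*} [NormedAddCommGroup E] [NormedSpace ℝ E]
    (s : Radii n) {L : E →L[ℝ] AmbientVec n} (hL : Function.Injective L) {v : E} (hv : v ≠ 0) :
    0 < metricForm s.1 L v v := by
  have hpi := Real.pi_pos
  have hs := s.2
  rw [metricForm_apply]
  have h0 : ∀ i, 0 ≤ dr i (sigma s) (L v) * dr i (sigma s) (L v) + 4 * Real.pi ^ 2 *
      r i (sigma s) ^ 2 * (dθ i (sigma s) (L v) * dθ i (sigma s) (L v)) +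
      1 / (4 * Real.pi ^ 2 * r i (sigma s) ^ 2) *
        (dη i (sigma s) (L v) * dη i (sigma s) (L v)) := by
    intro i
    have h1 := mul_self_nonneg (dr i (sigma s) (L v))
    have h2 := mul_self_nonneg (dθ i (sigma s) (L v))
    have h3 := mul_self_nonneg (dη i (sigma s) (L v))
    positivity
  refine (Finset.sum_nonneg fun i _ ↦ h0 i).lt_of_ne fun h ↦ hv (hL ?_)
  have h4 := (Finset.sum_eq_zero_iff_of_nonneg fun i _ ↦ h0 i).1 h.symm
  have h5 : ∀ i, (L v).2.1 i = 0 ∧ (L v).1 i = 0 ∧ (L v).2.2 i = 0 := by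
    intro i
    have h6 := h4 i (Finset.mem_univ i)
    have hr : 0 < r i (sigma s) := hs i
    have c1 : 0 < 4 * Real.pi ^ 2 * r i (sigma s) ^ 2 := by positivity
    have c2 : 0 < 1 / (4 * Real.pi ^ 2 * r i (sigma s) ^ 2) := by positivity
    have h1 := mul_self_nonneg (dr i (sigma s) (L v))
    have h2 := mul_nonneg c1.le (mul_self_nonneg (dθ i (sigma s) (L v)))
    have h3 := mul_nonneg c2.le (mul_self_nonneg (dη i (sigma s) (L v)))
    refine ⟨mul_self_eq_zero.1 (show dr i (sigma s) (L v) * dr i (sigma s) (L v) = 0 by linarith),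
      mul_self_eq_zero.1 (show dθ i (sigma s) (L v) * dθ i (sigma s) (L v) = 0 from
        (mul_eq_zero.1 (le_antisymm (by linarith) h2)).resolve_left c1.ne'),
      mul_self_eq_zero.1 (show dη i (sigma s) (L v) * dη i (sigma s) (L v) = 0 from
        (mul_eq_zero.1 (le_antisymm (by linarith) h3)).resolve_left c2.ne')⟩
  rw [map_zero]
  exact Prod.ext (funext fun i ↦ (h5 i).2.1)
    (Prod.ext (funext fun i ↦ (h5 i).1) (funext fun i ↦ (h5 i).2.2))

theorem contDiffOn_metricForm {n : ℕ} {E : Type*} [NormedAddCommGroup E] [NormedSpace ℝ E]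
    {u : Set E} {s : E → Fin (n + 1) → ℝ} {L : E → E →L[ℝ] AmbientVec n}
    (hs : ContDiffOn ℝ ∞ s u) (hpos : ∀ z ∈ u, ∀ i, 0 < s z i) (hL : ContDiffOn ℝ ∞ L u) :
    ContDiffOn ℝ ∞ (fun z ↦ metricForm (s z) (L z)) u := by
  have h1 : ∀ α : AmbientVec n →L[ℝ] ℝ, ContDiffOn ℝ ∞ (fun z ↦ α.comp (L z)) u := fun α ↦
    contDiffOn_const.clm_comp hL
  have hsi : ∀ i, ContDiffOn ℝ ∞ (fun z ↦ 4 * Real.pi ^ 2 * s z i ^ 2) u := fun i ↦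
    contDiffOn_const.mul ((contDiffOn_pi.1 hs i).pow 2)
  refine ContDiffOn.sum fun i _ ↦ (((h1 _).smulRight (h1 _)).add
    ((h1 _).smulRight ((hsi i).fun_smul (h1 _)))).add
    ((h1 _).smulRight ((contDiffOn_const.fun_div (hsi i) fun z hz ↦ ?_).fun_smul (h1 _)))
  have h1 := Real.pi_pos
  have h2 := hpos z hz i
  positivity

namespace DevelopingMaps

variable {n E X} (G : DevelopingMaps n E X)

theorem components_injective (x : X) : Function.Injective (G.components x) := G.injective x

variable [IsManifold 𝓘(ℝ, E) ∞ X]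

/-- The smoothness of the metric, which in the trivializations of the tangent bundle given by the
charts is the pullback of the standard metric along the coordinates. -/
theorem contMDiff_metric : ContMDiff 𝓘(ℝ, E) (𝓘(ℝ, E).prod 𝓘(ℝ, E →L[ℝ] E →L[ℝ] ℝ)) ∞
    (fun x ↦ Bundle.TotalSpace.mk' (E →L[ℝ] E →L[ℝ] ℝ)
      (E := fun x : X ↦ TangentSpace 𝓘(ℝ, E) x →L[ℝ] TangentSpace 𝓘(ℝ, E) x →L[ℝ] ℝ) x
      (metricForm (E := E) (G.radius x).1 (G.components x))) := by
  have : IsManifold 𝓘(ℝ, E) 1 X := IsManifold.of_le (n := ∞) (by norm_num)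
  intro x
  rw [contMDiffAt_hom_bundle]
  refine ⟨contMDiffAt_id, ?_⟩
  have h1 : ContDiffOn ℝ ∞ (fun z ↦ metricForm (G.toFun x z).2.1 (fderiv ℝ (G.toFun x) z))
      (chartAt E x).target :=
    contDiffOn_metricForm (G.contDiffOn x).snd.fst (fun z hz i ↦ G.toFun_pos hz i)
      (G.contDiffOn_fderiv x)
  have h2 : ContMDiffAt 𝓘(ℝ, E) 𝓘(ℝ, E →L[ℝ] E →L[ℝ] ℝ) ∞
      (fun y ↦ metricForm (G.toFun x (extChartAt 𝓘(ℝ, E) x y)).2.1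
        (fderiv ℝ (G.toFun x) (extChartAt 𝓘(ℝ, E) x y))) x := by
    refine ContMDiffAt.comp x (g := fun z ↦ metricForm (G.toFun x z).2.1
      (fderiv ℝ (G.toFun x) z)) (I' := 𝓘(ℝ, E)) ?_ contMDiffAt_extChartAt
    refine (h1.contDiffAt ((chartAt E x).open_target.mem_nhds ?_)).contMDiffAt
    simp
  refine h2.congr_of_eventuallyEq ?_
  filter_upwards [(chartAt E x).open_source.mem_nhds (mem_chart_source E x)] with y hy
  have hz : chartAt E x y ∈ (chartAt E x).target := (chartAt E x).map_source hy
  have hsymm : (extChartAt 𝓘(ℝ, E) x).symm (extChartAt 𝓘(ℝ, E) x y) = y :=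
    (extChartAt 𝓘(ℝ, E) x).left_inv (by simpa using hy)
  have h3 : ∀ v : E, G.components y ((trivializationAt E (TangentSpace 𝓘(ℝ, E)) x).symm y v) =
      fderiv ℝ (G.toFun x) (extChartAt 𝓘(ℝ, E) x y) v := by
    intro v
    have h4 := DFunLike.congr_fun (G.components_comp_symm (x := x)
      (z := extChartAt 𝓘(ℝ, E) x y) (by simpa using hz)) v
    refine Eq.trans ?_ h4
    have h5 := DFunLike.congr_fun (TangentBundle.symmL_trivializationAt (I := 𝓘(ℝ, E)) hy) v
    rw [Bundle.Trivialization.symmL_apply _ (by simpa using hy)] at h5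
    have h6 := congrArg (G.components y) h5
    rw [hsymm]
    exact h6
  have h7 : (G.toFun x (extChartAt 𝓘(ℝ, E) x y)).2.1 = (G.radius y).1 := by
    simpa using G.toFun_radius x y hy
  ext v w
  refine (inCoordinates_apply_eq₂ (F₃ := ℝ) (E₃ := Bundle.Trivial X ℝ) (by simpa using hy)
    (by simpa using hy) (by simp)).trans ?_
  have h8 : ∀ a : ℝ, Bundle.Trivialization.linearMapAt ℝ
      (trivializationAt ℝ (Bundle.Trivial X ℝ) x) y a = a := fun a ↦ by simp
  refine (h8 _).trans ?_
  rw [h7]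
  refine (metricForm_apply (E := E) (G.radius y) (G.components y) _ _).trans
    (Eq.trans ?_ (metricForm_apply (G.radius y) _ v w).symm)
  exact congrArg₂ (ambientMetric (sigma (G.radius y))) (h3 v) (h3 w)

end DevelopingMaps

end Developing

section Structure

local notation "⟪" x ", " y "⟫" => inner ℝ x y

theorem linearIndependent_radii_inv {n : ℕ} {s : Radii n} (h : ∃ i j, s.1 i ≠ s.1 j) :
    LinearIndependent ℝ
      ![(WithLp.toLp 2 s.1 : EuclideanSpace ℝ (Fin (n + 1))), WithLp.toLp 2 fun i ↦ (s.1 i)⁻¹] := by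
  rw [LinearIndependent.pair_iff]
  intro a b hab
  obtain ⟨i, j, hij⟩ := h
  have hi := s.2 i
  have hj := s.2 j
  have h1 : ∀ l, a * s.1 l ^ 2 + b = 0 := by
    intro l
    have h2 : a * s.1 l + b * (s.1 l)⁻¹ = 0 :=
      congrArg (fun x : EuclideanSpace ℝ (Fin (n + 1)) ↦ x l) hab
    have h3 := (s.2 l).ne'
    have h4 : a * s.1 l ^ 2 + b = (a * s.1 l + b * (s.1 l)⁻¹) * s.1 l := by field_simp
    rw [h4, h2, zero_mul]
  have h5 : a * ((s.1 i - s.1 j) * (s.1 i + s.1 j)) = 0 := by linarith [h1 i, h1 j]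
  have h6 : a = 0 := (mul_eq_zero.1 h5).resolve_right
    (mul_ne_zero (sub_ne_zero.2 hij) (by positivity))
  exact ⟨h6, by simpa [h6] using h1 i⟩

/-- The adapted frame at a point of `{∑ dθ_i = ∑ r_i dr_i = ∑ dr_i / r_i = ∑ dη_i = 0}`. In the
orthonormal coframe `dr_i, 2π r_i dθ_i, dη_i / 2π r_i` the relations say that the components are
orthogonal to `(1/r_i)` and `(r_i)`, to `(1/r_i)`, and to `(r_i)`. -/
theorem exists_adapted_basis_coordinates {n : ℕ} (hn : 1 ≤ n) {E : Type*} [AddCommGroup E]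
    [Module ℝ E] {s : Radii n} (hs : ∃ i j, s.1 i ≠ s.1 j) (L : E →ₗ[ℝ] AmbientVec n)
    (hinj : Function.Injective L) (hrange : ∀ v, (∃ u, L u = v) ↔
      ∑ i, v.1 i = 0 ∧ ∑ i, s.1 i * v.2.1 i = 0 ∧ ∑ i, (s.1 i)⁻¹ * v.2.1 i = 0 ∧
        ∑ i, v.2.2 i = 0) :
    ∃ b : Module.Basis (CoframeIndex (n - 1) 1) ℝ E,
      (∀ k l, k ≠ l → ambientMetric (sigma s) (L (b k)) (L (b l)) = 0) ∧
      (∀ i, ambientMetric (sigma s) (L (b (.x i))) (L (b (.x i))) = 1) ∧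
      (∀ i, ambientMetric (sigma s) (L (b (.y₁ i))) (L (b (.y₁ i))) = 1) ∧
      (∀ i, ambientMetric (sigma s) (L (b (.y₂ i))) (L (b (.y₂ i))) = 1) ∧
      (∀ v w, ∑ i, 2 * Real.pi * s.1 i * ((L v).2.1 i * (L w).1 i) =
        ∑ i, b.coord (.x i) v * b.coord (.y₁ i) w) ∧
      (∀ v w, ∑ i, 1 / (2 * Real.pi) * (1 / s.1 i) * ((L v).2.1 i * (L w).2.2 i) =
        ∑ i, b.coord (.x i) v * b.coord (.y₂ i) w) ∧
      (∀ v w, ∑ i, (L v).1 i * (L w).2.2 i = ∑ i, b.coord (.y₁ i) v * b.coord (.y₂ i) w +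
        ∑ j, b.coord (.z j) v * b.coord (.w j) w) := by
  have hpi := Real.pi_pos
  have hr : ∀ i, s.1 i ≠ 0 := fun i ↦ (s.2 i).ne'
  let K := EuclideanSpace ℝ (Fin (n + 1))
  let T : (Fin (n + 1) → ℝ) →ₗ[ℝ] K := (WithLp.linearEquiv 2 ℝ (Fin (n + 1) → ℝ)).symm.toLinearMap
  have hT : ∀ x i, T x i = x i := fun x i ↦ rfl
  have hTinj : ∀ x, T x = 0 → x = 0 := fun x hx ↦
    (WithLp.linearEquiv 2 ℝ (Fin (n + 1) → ℝ)).symm.map_eq_zero_iff.1 hx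
  have hinner : ∀ x y : K, ⟪x, y⟫ = ∑ i, x i * y i := by
    intro x y
    rw [PiLp.inner_apply]
    exact Finset.sum_congr rfl fun i _ ↦ by simp [mul_comm]
  let P : K := WithLp.toLp 2 s.1
  let Q : K := WithLp.toLp 2 fun i ↦ (s.1 i)⁻¹
  have hP : ∀ i, P i = s.1 i := fun i ↦ rfl
  have hQ : ∀ i, Q i = (s.1 i)⁻¹ := fun i ↦ rfl
  have hPQ0 : ⟪P, Q⟫ ≠ 0 := by
    rw [hinner]
    simp only [hP, hQ, mul_inv_cancel₀ (hr _)]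
    simp
    positivity
  let R : E →ₗ[ℝ] K := T ∘ₗ LinearMap.pi fun i ↦ (compr i).toLinearMap ∘ₗ L
  let A : E →ₗ[ℝ] K := T ∘ₗ LinearMap.pi fun i ↦
    (2 * Real.pi * s.1 i) • (compθ i).toLinearMap ∘ₗ L
  let B : E →ₗ[ℝ] K := T ∘ₗ LinearMap.pi fun i ↦
    (2 * Real.pi * s.1 i)⁻¹ • (compη i).toLinearMap ∘ₗ L
  have hR : ∀ v i, R v i = (L v).2.1 i := fun v i ↦ rfl
  have hA : ∀ v i, A v i = 2 * Real.pi * s.1 i * (L v).1 i := fun v i ↦ rfl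
  have hB : ∀ v i, B v i = (2 * Real.pi * s.1 i)⁻¹ * (L v).2.2 i := fun v i ↦ rfl
  have hmetric : ∀ v w, ⟪R v, R w⟫ + ⟪A v, A w⟫ + ⟪B v, B w⟫ =
      ambientMetric (sigma s) (L v) (L w) := by
    intro v w
    simp only [hinner, ← Finset.sum_add_distrib, hR, hA, hB]
    refine Finset.sum_congr rfl fun i _ ↦ ?_
    have := hr i
    change _ = (L v).2.1 i * (L w).2.1 i + 4 * Real.pi ^ 2 * s.1 i ^ 2 * ((L v).1 i * (L w).1 i) +
      1 / (4 * Real.pi ^ 2 * s.1 i ^ 2) * ((L v).2.2 i * (L w).2.2 i)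
    field_simp
    ring
  have hinj' : ∀ v, R v = 0 → A v = 0 → B v = 0 → v = 0 := by
    intro v hRv hAv hBv
    refine hinj ?_
    rw [map_zero]
    refine Prod.ext (funext fun i ↦ ?_) (Prod.ext (funext fun i ↦ ?_) (funext fun i ↦ ?_))
    · have h := hA v i
      rw [hAv] at h
      exact (mul_eq_zero.1 h.symm).resolve_left (mul_ne_zero (by positivity) (hr i))
    · have h := hR v i
      rw [hRv] at h
      exact h.symm
    · have h := hB v i
      rw [hBv] at h
      exact (mul_eq_zero.1 h.symm).resolve_left (inv_ne_zero (mul_ne_zero (by positivity) (hr i)))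
  have hmem : ∀ v, ⟪P, R v⟫ = 0 ∧ ⟪Q, R v⟫ = 0 ∧ ⟪Q, A v⟫ = 0 ∧ ⟪P, B v⟫ = 0 := by
    intro v
    obtain ⟨e1, e2, e3, e4⟩ := (hrange (L v)).1 ⟨v, rfl⟩
    simp only [hinner, hP, hQ, hR, hA, hB]
    refine ⟨e2, e3, ?_, ?_⟩
    · have : ∀ i, (s.1 i)⁻¹ * (2 * Real.pi * s.1 i * (L v).1 i) = 2 * Real.pi * (L v).1 i := by
        intro i
        have := hr i
        field_simp
      rw [Finset.sum_congr rfl fun i _ ↦ this i, ← Finset.mul_sum, e1, mul_zero]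
    · have : ∀ i, s.1 i * ((2 * Real.pi * s.1 i)⁻¹ * (L v).2.2 i) =
          (2 * Real.pi)⁻¹ * (L v).2.2 i := by
        intro i
        have := hr i
        field_simp
      rw [Finset.sum_congr rfl fun i _ ↦ this i, ← Finset.mul_sum, e4, mul_zero]
  have hsurj : ∀ x y z, ⟪P, x⟫ = 0 → ⟪Q, x⟫ = 0 → ⟪Q, y⟫ = 0 → ⟪P, z⟫ = 0 →
      ∃ v, R v = x ∧ A v = y ∧ B v = z := by
    intro x y z hPx hQx hQy hPz
    rw [hinner] at hPx hQx hQy hPz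
    obtain ⟨u, hu⟩ := (hrange (fun i ↦ (2 * Real.pi * s.1 i)⁻¹ * y i, fun i ↦ x i,
      fun i ↦ 2 * Real.pi * s.1 i * z i)).2 (by
        refine ⟨?_, hPx, hQx, ?_⟩
        · have : ∀ i, (2 * Real.pi * s.1 i)⁻¹ * y i = (2 * Real.pi)⁻¹ * (Q i * y i) := by
            intro i
            rw [hQ, mul_inv, mul_assoc]
          rw [Finset.sum_congr rfl fun i _ ↦ this i, ← Finset.mul_sum, hQy, mul_zero]
        · have : ∀ i, 2 * Real.pi * s.1 i * z i = 2 * Real.pi * (P i * z i) := by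
            intro i
            rw [hP, mul_assoc (2 * Real.pi)]
          rw [Finset.sum_congr rfl fun i _ ↦ this i, ← Finset.mul_sum, hPz, mul_zero])
    refine ⟨u, ?_, ?_, ?_⟩
    · ext i
      rw [hR, hu]
    · ext i
      have := hr i
      rw [hA, hu]
      field_simp
    · ext i
      have := hr i
      rw [hB, hu]
      field_simp
  obtain ⟨b, h1, h2, h3, h4, h5, h6, h7⟩ := exists_adapted_basis (m := n - 1) (P := P) (Q := Q)
    (linearIndependent_radii_inv hs) hPQ0 (by simp [K]; omega) R A B hinj' hmem hsurj
  refine ⟨b, fun k l h ↦ ?_, fun i ↦ ?_, fun i ↦ ?_, fun i ↦ ?_, fun v w ↦ ?_, fun v w ↦ ?_,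
    fun v w ↦ ?_⟩
  · rw [← hmetric]; exact h1 k l h
  · rw [← hmetric]; exact h2 i
  · rw [← hmetric]; exact h3 i
  · rw [← hmetric]; exact h4 i
  · rw [← h5, hinner]
    exact Finset.sum_congr rfl fun i _ ↦ by rw [hR, hA]; ring
  · rw [← h6, hinner]
    refine Finset.sum_congr rfl fun i _ ↦ ?_
    rw [hR, hB]
    field_simp
  · rw [← h7, hinner]
    refine Finset.sum_congr rfl fun i _ ↦ ?_
    have := hr i
    rw [hA, hB]
    field_simp

namespace DevelopingMaps

variable {n : ℕ} {E : Type*} [NormedAddCommGroup E] [NormedSpace ℝ E]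
  {X : Type*} [TopologicalSpace X] [ChartedSpace E X] (G : DevelopingMaps n E X)

/-- The form `2π ∑ r_i dr_i ∧ dθ_i`. -/
def ω₁ : TwoForm 𝓘(ℝ, E) X := G.form (fun t ↦ 2 * Real.pi * t) compr compθ

/-- The form `(1 / 2π) ∑ (1 / r_i) dr_i ∧ dη_i`. -/
def ω₂ : TwoForm 𝓘(ℝ, E) X := G.form (fun t ↦ 1 / (2 * Real.pi) * (1 / t)) compr compη

/-- The form `∑ dθ_i ∧ dη_i`. -/
def ωD : TwoForm 𝓘(ℝ, E) X := G.form (fun _ ↦ 1) compθ compη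

theorem form_apply (H : ℝ → ℝ) (α β : Fin (n + 1) → AmbientVec n →L[ℝ] ℝ) (x : X)
    (v : Fin 2 → TangentSpace 𝓘(ℝ, E) x) :
    G.form H α β x v = ∑ i, H ((G.radius x).1 i) *
      (α i (G.components x (v 0)) * β i (G.components x (v 1)) -
        α i (G.components x (v 1)) * β i (G.components x (v 0))) := by
  have h1 : G.form H α β x v = (∑ i, H ((G.radius x).1 i) • wedge (α i) (β i))
      (fun j ↦ G.components x (v j)) := rfl
  rw [h1, ContinuousAlternatingMap.sum_apply]
  refine Finset.sum_congr rfl fun i _ ↦ ?_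
  rw [ContinuousAlternatingMap.smul_apply, wedge_apply_pair, smul_eq_mul]

theorem ω₁_apply (x : X) : G.ω₁ x =
    (ambientω₁ (sigma (G.radius x))).compContinuousLinearMap (G.components x) := by
  ext v
  have h1 : (ambientω₁ (sigma (G.radius x))).compContinuousLinearMap (G.components x) v =
      ((2 * Real.pi) • ∑ i, (G.radius x).1 i • wedge (compr i) (compθ i))
        (fun j ↦ G.components x (v j)) := rfl
  rw [h1, ω₁, form_apply, ContinuousAlternatingMap.smul_apply,
    ContinuousAlternatingMap.sum_apply, smul_eq_mul, Finset.mul_sum]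
  refine Finset.sum_congr rfl fun i _ ↦ ?_
  rw [ContinuousAlternatingMap.smul_apply, wedge_apply_pair, smul_eq_mul]
  ring

theorem ω₂_apply (x : X) : G.ω₂ x =
    (ambientω₂ (sigma (G.radius x))).compContinuousLinearMap (G.components x) := by
  ext v
  have h1 : (ambientω₂ (sigma (G.radius x))).compContinuousLinearMap (G.components x) v =
      ((1 / (2 * Real.pi)) • ∑ i, (1 / (G.radius x).1 i) • wedge (compr i) (compη i))
        (fun j ↦ G.components x (v j)) := rfl
  rw [h1, ω₂, form_apply, ContinuousAlternatingMap.smul_apply,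
    ContinuousAlternatingMap.sum_apply, smul_eq_mul, Finset.mul_sum]
  refine Finset.sum_congr rfl fun i _ ↦ ?_
  rw [ContinuousAlternatingMap.smul_apply, wedge_apply_pair, smul_eq_mul]
  ring

theorem ωD_apply (x : X) : G.ωD x =
    (ambientωD (sigma (G.radius x))).compContinuousLinearMap (G.components x) := by
  ext v
  have h1 : (ambientωD (sigma (G.radius x))).compContinuousLinearMap (G.components x) v =
      (∑ i, wedge (compθ i) (compη i)) (fun j ↦ G.components x (v j)) := rfl
  rw [h1, ωD, form_apply, ContinuousAlternatingMap.sum_apply]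
  refine Finset.sum_congr rfl fun i _ ↦ ?_
  rw [wedge_apply_pair, one_mul]

/-- The distribution `ω₁⁰ + ω₂⁰` is given by `dr̄ = 0`. -/
theorem mem_ker_sup_ker (x : X) (v : TangentSpace 𝓘(ℝ, E) x) :
    v ∈ TwoForm.ker G.ω₁ x ⊔ TwoForm.ker G.ω₂ x ↔ (G.components x v).2.1 = 0 := by
  have hr : ∀ i, (G.radius x).1 i ≠ 0 := fun i ↦ ((G.radius x).2 i).ne'
  have hpi := Real.pi_pos
  have hrel : ∀ u, _ := fun u ↦ (G.mem_range x (G.components x u)).1 ⟨u, rfl⟩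
  have hω₁ : ∀ u w, G.ω₁ x ![u, w] = ∑ i, 2 * Real.pi * (G.radius x).1 i *
      ((G.components x u).2.1 i * (G.components x w).1 i -
        (G.components x w).2.1 i * (G.components x u).1 i) := fun u w ↦ G.form_apply _ _ _ x _
  have hω₂ : ∀ u w, G.ω₂ x ![u, w] = ∑ i, 1 / (2 * Real.pi) * (1 / (G.radius x).1 i) *
      ((G.components x u).2.1 i * (G.components x w).2.2 i -
        (G.components x w).2.1 i * (G.components x u).2.2 i) := fun u w ↦ G.form_apply _ _ _ x _
  have hzero : ∀ (u : TangentSpace 𝓘(ℝ, E) x) (c : ℝ), c ≠ 0 →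
      ∑ i, c * (G.components x u).2.1 i ^ 2 = 0 → (G.components x u).2.1 = 0 := by
    intro u c hc h
    rw [← Finset.mul_sum] at h
    have h1 := (mul_eq_zero.1 h).resolve_left hc
    ext i
    have h2 := (Finset.sum_eq_zero_iff_of_nonneg fun i _ ↦ sq_nonneg _).1 h1 i (Finset.mem_univ i)
    exact pow_eq_zero_iff two_ne_zero |>.1 h2
  constructor
  · intro h
    obtain ⟨a, ha, b, hb, rfl⟩ := Submodule.mem_sup.1 h
    rw [TwoForm.mem_ker_iff] at ha hb
    have h1 : (G.components x a).2.1 = 0 := by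
      -- the test vector has `dθ_i = dr_i(a) / r_i`
      obtain ⟨w, hw⟩ : ∃ w : TangentSpace 𝓘(ℝ, E) x, _ :=
        (G.mem_range x (fun i ↦ ((G.radius x).1 i)⁻¹ * (G.components x a).2.1 i,
        0, 0)).2 ⟨(hrel a).2.2.1, by simp, by simp, by simp⟩
      have hw' : G.components x w = _ := hw
      refine hzero a (2 * Real.pi) (by positivity) ?_
      rw [← ha w, hω₁, hw']
      refine Finset.sum_congr rfl fun i _ ↦ ?_
      have := hr i
      simp only [Pi.zero_apply]
      field_simp
      ring
    have h2 : (G.components x b).2.1 = 0 := by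
      -- the test vector has `dη_i = r_i dr_i(b)`
      obtain ⟨w, hw⟩ : ∃ w : TangentSpace 𝓘(ℝ, E) x, _ :=
        (G.mem_range x (0, 0,
        fun i ↦ (G.radius x).1 i * (G.components x b).2.1 i)).2
        ⟨by simp, by simp, by simp, (hrel b).2.1⟩
      have hw' : G.components x w = _ := hw
      refine hzero b (1 / (2 * Real.pi)) (by positivity) ?_
      rw [← hb w, hω₂, hw']
      refine Finset.sum_congr rfl fun i _ ↦ ?_
      have := hr i
      simp only [Pi.zero_apply]
      field_simp
      ring
    rw [map_add, Prod.snd_add, Prod.fst_add, h1, h2, add_zero]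
  · intro h
    obtain ⟨e1, -, -, e4⟩ := hrel v
    obtain ⟨a, ha⟩ : ∃ a : TangentSpace 𝓘(ℝ, E) x, _ :=
      (G.mem_range x ((G.components x v).1, 0, 0)).2 ⟨e1, by simp, by simp, by simp⟩
    obtain ⟨b, hb⟩ : ∃ b : TangentSpace 𝓘(ℝ, E) x, _ :=
      (G.mem_range x (0, 0, (G.components x v).2.2)).2
      ⟨by simp, by simp, by simp, e4⟩
    have ha' : G.components x a = _ := ha
    have hb' : G.components x b = _ := hb
    have hab : b + a = v := by
      refine G.injective x ?_
      refine ((G.components x).map_add b a).trans ?_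
      rw [ha', hb']
      exact Prod.ext (zero_add _) (Prod.ext ((zero_add _).trans h.symm) (add_zero _))
    refine Submodule.mem_sup.2 ⟨b, ?_, a, ?_, hab⟩
    · refine (TwoForm.mem_ker_iff _ _).2 fun w ↦ ?_
      rw [hω₁, hb']
      simp
    · refine (TwoForm.mem_ker_iff _ _).2 fun w ↦ ?_
      rw [hω₂, ha']
      simp

variable [IsManifold 𝓘(ℝ, E) ∞ X]

theorem isIntegrable : IsIntegrable 𝓘(ℝ, E)
    (fun x ↦ TwoForm.ker G.ω₁ x ⊔ TwoForm.ker G.ω₂ x) := by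
  intro x
  refine ⟨chartAt E x, IsManifold.chart_mem_maximalAtlas x, mem_chart_source E x, G.vertical,
    fun y hy v ↦ ?_⟩
  rw [G.mem_ker_sup_ker, G.components_eq hy]
  exact (G.mem_vertical x _ ((chartAt E x).map_source hy) _).symm

variable [FiniteDimensional ℝ E]

/-- The metric `∑ (dr_i² + 4π² r_i² dθ_i² + (1 / 4π² r_i²) dη_i²)`. -/
def metric : Bundle.ContMDiffRiemannianMetric 𝓘(ℝ, E) ∞ E
    (fun x : X ↦ TangentSpace 𝓘(ℝ, E) x) where
  inner x := metricForm (E := E) (G.radius x).1 (G.components x)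
  symm x v w := by
    refine (metricForm_apply (E := E) (G.radius x) (G.components x) v w).trans
      (Eq.trans ?_ (metricForm_apply (E := E) (G.radius x) (G.components x) w v).symm)
    refine Finset.sum_congr rfl fun i _ ↦ ?_
    ring
  pos x v hv := metricForm_pos (E := E) (G.radius x) (G.components_injective x) hv
  isVonNBounded x := isVonNBounded_of_posDef (E := E)
    (metricForm (E := E) (G.radius x).1 (G.components x))
    fun _ hv ↦ metricForm_pos (E := E) (G.radius x) (G.components_injective x) hv
  contMDiff := G.contMDiff_metric

theorem metric_inner (x : X) (v w : TangentSpace 𝓘(ℝ, E) x) : G.metric.inner x v w =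
    ambientMetric (sigma (G.radius x)) (G.components x v) (G.components x w) :=
  metricForm_apply (E := E) (G.radius x) (G.components x) v w

/-- The weakly self-dual structure of a manifold with coordinates `(θ̄, r̄, η̄)`. -/
def toWSDStructure (hn : 1 ≤ n) (hne : ∀ x, ∃ i j, (G.radius x).1 i ≠ (G.radius x).1 j) :
    WSDStructure 𝓘(ℝ, E) X (n - 1) 1 where
  ω₁ := G.ω₁
  ω₂ := G.ω₂
  ωD := G.ωD
  metric := G.metric
  smooth₁ := G.isSmooth_form (contDiff_const.mul contDiff_id).contDiffOn _ _
  smooth₂ := G.isSmooth_form (contDiffOn_const.mul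
    (contDiffOn_const.div contDiffOn_id fun _ ht ↦ (Set.mem_Ioi.1 ht).ne')) _ _
  smoothD := G.isSmooth_form contDiffOn_const _ _
  closed₁ := G.isClosed_form
    (extDeriv_coordForm_compr (differentiable_const _ |>.mul differentiable_id).differentiableOn _)
  closed₂ := G.isClosed_form (extDeriv_coordForm_compr
    ((differentiableOn_const _).mul
      ((differentiableOn_const _).div differentiableOn_id fun _ ht ↦ (Set.mem_Ioi.1 ht).ne')) _)
  closedD := G.isClosed_form fun v _ ↦ extDeriv_coordForm_one _ _ v
  integrable := G.isIntegrable
  adapted p := by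
    obtain ⟨b, h1, h2, h3, h4, h5, h6, h7⟩ := exists_adapted_basis_coordinates (E := E) hn (hne p)
      (G.components p).toLinearMap (G.components_injective p) (G.mem_range p)
    let d : CoframeIndex (n - 1) 1 → E →L[ℝ] ℝ := fun k ↦
      ⟨b.coord k, LinearMap.continuous_of_finiteDimensional (E := E) _⟩
    have hwedge : ∀ (k l : CoframeIndex (n - 1) 1) (v : Fin 2 → E), wedge (d k) (d l) v =
        d k (v 0) * d l (v 1) - d k (v 1) * d l (v 0) :=
      fun k l v ↦ wedge_apply_pair _ _ _
    refine ⟨b, d, fun k v ↦ rfl,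
      fun k l h ↦ (G.metric_inner p _ _).trans (h1 k l h),
      fun i ↦ (G.metric_inner p _ _).trans (h2 i), fun i ↦ (G.metric_inner p _ _).trans (h3 i),
      fun i ↦ (G.metric_inner p _ _).trans (h4 i), ?_, ?_, ?_⟩
    · refine ContinuousAlternatingMap.ext fun v ↦ (G.form_apply _ _ _ p v).trans ?_
      refine Eq.trans ?_ (ContinuousAlternatingMap.sum_apply (M := E) _ _).symm
      refine Eq.trans ?_ (Finset.sum_congr rfl fun i _ ↦ (hwedge _ _ v).symm)
      refine Eq.trans ?_ (Finset.sum_sub_distrib _ _).symm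
      refine Eq.trans ?_ (congrArg₂ (· - ·) (h5 (v 0) (v 1)) (h5 (v 1) (v 0)))
      refine Eq.trans ?_ (Finset.sum_sub_distrib _ _)
      exact Finset.sum_congr rfl fun i _ ↦ mul_sub _ _ _
    · refine ContinuousAlternatingMap.ext fun v ↦ (G.form_apply _ _ _ p v).trans ?_
      refine Eq.trans ?_ (ContinuousAlternatingMap.sum_apply (M := E) _ _).symm
      refine Eq.trans ?_ (Finset.sum_congr rfl fun i _ ↦ (hwedge _ _ v).symm)
      refine Eq.trans ?_ (Finset.sum_sub_distrib _ _).symm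
      refine Eq.trans ?_ (congrArg₂ (· - ·) (h6 (v 0) (v 1)) (h6 (v 1) (v 0)))
      refine Eq.trans ?_ (Finset.sum_sub_distrib _ _)
      exact Finset.sum_congr rfl fun i _ ↦ mul_sub _ _ _
    · refine ContinuousAlternatingMap.ext fun v ↦ (G.form_apply _ _ _ p v).trans ?_
      refine Eq.trans ?_ (ContinuousAlternatingMap.add_apply (M := E) _ _ v).symm
      refine Eq.trans ?_ (congrArg₂ (· + ·)
        (ContinuousAlternatingMap.sum_apply (M := E) _ v).symm
        (ContinuousAlternatingMap.sum_apply (M := E) _ v).symm)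
      refine Eq.trans ?_ (congrArg₂ (· + ·)
        (Finset.sum_congr rfl fun i _ ↦ (hwedge _ _ v).symm)
        (Finset.sum_congr rfl fun i _ ↦ (hwedge _ _ v).symm))
      refine Eq.trans ?_ (congrArg₂ (· + ·) (Finset.sum_sub_distrib _ _).symm
        (Finset.sum_sub_distrib _ _).symm)
      refine Eq.trans ?_ (add_sub_add_comm _ _ _ _)
      refine Eq.trans ?_ (congrArg₂ (· - ·) (h7 (v 0) (v 1)) (h7 (v 1) (v 0)))
      refine Eq.trans ?_ (Finset.sum_sub_distrib _ _)
      exact Finset.sum_congr rfl fun i _ ↦ one_mul _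

end DevelopingMaps

end Structure

/-! ### Manifolds homeomorphic to the product of two tori and the space of radii -/

section Product

/-- The coordinates on the product of two tori and the space of radii. -/
abbrev FlatVec (n : ℕ) : Type := (Fin n → ℝ) × EuclideanSpace ℝ (Fin (n - 1)) × (Fin n → ℝ)

theorem nonempty_flatEquiv {n : ℕ} (hn : 1 ≤ n) :
    Nonempty (FlatVec n ≃L[ℝ] EuclideanSpace ℝ (Fin (3 * (n - 1) + 2))) := by
  refine ⟨ContinuousLinearEquiv.ofFinrankEq ?_⟩
  rw [Module.finrank_prod, Module.finrank_prod, Module.finrank_fin_fun, finrank_euclideanSpace_fin,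
    finrank_euclideanSpace_fin]
  omega

variable {n : ℕ} {k₁ k₂ : ℝ} {E : Type*} [NormedAddCommGroup E] [NormedSpace ℝ E]
  {X : Type*} [TopologicalSpace X]
  (R : RadialAtlas n k₁ k₂) (Λ : FlatVec n ≃L[ℝ] E)
  (Φ : X ≃ₜ Torus n × RadialSpace n k₁ k₂ × Torus n)

/-- The product chart around `x`. -/
def productChart (x : X) : OpenPartialHomeomorph X E :=
  (Φ.transOpenPartialHomeomorph ((torusChart (torusBase (Φ x).1)).prod
    ((R.chart (Φ x).2.1).prod (torusChart (torusBase (Φ x).2.2))))).transHomeomorph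
      Λ.toHomeomorph

theorem productChart_apply (x y : X) : productChart R Λ Φ x y =
    Λ (torusChart (torusBase (Φ x).1) (Φ y).1, R.chart (Φ x).2.1 (Φ y).2.1,
      torusChart (torusBase (Φ x).2.2) (Φ y).2.2) := rfl

theorem productChart_symm_apply (x : X) (z : E) : (productChart R Λ Φ x).symm z =
    Φ.symm (torusCoe (Λ.symm z).1, (R.chart (Φ x).2.1).symm (Λ.symm z).2.1,
      torusCoe (Λ.symm z).2.2) := rfl

theorem mem_productChart_source {x y : X} : y ∈ (productChart R Λ Φ x).source ↔
    (Φ y).1 ∈ (torusChart (torusBase (Φ x).1)).source ∧ (Φ y).2.1 ∈ (R.chart (Φ x).2.1).source ∧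
      (Φ y).2.2 ∈ (torusChart (torusBase (Φ x).2.2)).source := Iff.rfl

theorem mem_productChart_target {x : X} {z : E} : z ∈ (productChart R Λ Φ x).target ↔
    (Λ.symm z).1 ∈ (torusChart (torusBase (Φ x).1)).target ∧
      (Λ.symm z).2.1 ∈ (R.chart (Φ x).2.1).target ∧
      (Λ.symm z).2.2 ∈ (torusChart (torusBase (Φ x).2.2)).target := Iff.rfl

theorem mem_productChart_source_self (x : X) : x ∈ (productChart R Λ Φ x).source :=
  (mem_productChart_source R Λ Φ).2
    ⟨mem_torusChart_source _, R.mem_source _, mem_torusChart_source _⟩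

/-- A space with a homeomorphism to the product, as a charted space. -/
@[reducible] def productChartedSpace : ChartedSpace E X where
  atlas := Set.range (productChart R Λ Φ)
  chartAt := productChart R Λ Φ
  mem_chart_source := mem_productChart_source_self R Λ Φ
  chart_mem_atlas x := ⟨x, rfl⟩

/-- In the charts of tori, the morphism given by an integral matrix differs from the linear map by
locally constant terms. -/
theorem eventually_torusChart_torusMap {k l : ℕ} (A : Matrix (Fin k) (Fin l) ℤ) {a : Fin l → ℝ}
    {b : Fin k → ℝ} {x : Torus l} (hx : x ∈ (torusChart a).source)
    (hAx : torusMap A x ∈ (torusChart b).source) :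
    ∃ c, ∀ᶠ y in nhds x, torusChart b (torusMap A y) = realMap A (torusChart a y) + c := by
  have h1 : ∀ y, torusMap A y = torusCoe (realMap A (torusChart a y)) := fun y ↦ by
    rw [← torusMap_torusCoe, torusCoe_torusChart]
  have h2 := eventually_torusChart_torusCoe b (realMap A (torusChart a x)) (by rwa [← h1])
  refine ⟨torusChart b (torusCoe (realMap A (torusChart a x))) - realMap A (torusChart a x), ?_⟩
  have h3 : ContinuousAt (fun y ↦ realMap A (torusChart a y)) x :=
    (realMap A).continuous.continuousAt.comp ((torusChart a).continuousAt hx)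
  filter_upwards [h3.eventually h2] with y hy
  rw [h1, hy]

theorem realMap_one {k : ℕ} (z : Fin k → ℝ) : realMap (1 : Matrix (Fin k) (Fin k) ℤ) z = z := by
  ext i
  simp [realMap_apply, Matrix.one_apply]

theorem torusMap_one {k : ℕ} (x : Torus k) : torusMap (1 : Matrix (Fin k) (Fin k) ℤ) x = x := by
  obtain ⟨z, rfl⟩ := torusCoe_surjective x
  rw [torusMap_torusCoe, realMap_one]

theorem eventually_torusChart {k : ℕ} {a b : Fin k → ℝ} {x : Torus k}
    (ha : x ∈ (torusChart a).source) (hb : x ∈ (torusChart b).source) :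
    ∃ c, ∀ᶠ y in nhds x, torusChart b y = torusChart a y + c := by
  obtain ⟨c, hc⟩ := eventually_torusChart_torusMap 1 ha ((torusMap_one x).symm ▸ hb)
  exact ⟨c, hc.mono fun y hy ↦ by rwa [torusMap_one, realMap_one] at hy⟩

/-- The transition functions are translations in the factors which come from the tori. -/
theorem isManifold_productChartedSpace : letI := productChartedSpace R Λ Φ;
    IsManifold 𝓘(ℝ, E) ∞ X := by
  let _ := productChartedSpace R Λ Φ
  refine isManifold_of_contDiffOn _ _ _ ?_
  rintro _ _ ⟨x, rfl⟩ ⟨x', rfl⟩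
  simp only [modelWithCornersSelf_coe, modelWithCornersSelf_coe_symm, Function.comp_id,
    Function.id_comp, Set.range_id, Set.preimage_id, Set.inter_univ]
  rintro z ⟨hz, hz'⟩
  refine ContDiffAt.contDiffWithinAt ?_
  set y := (productChart R Λ Φ x).symm z with hy
  have hys : y ∈ (productChart R Λ Φ x).source := (productChart R Λ Φ x).map_target hz
  obtain ⟨a1, a2, a3⟩ := (mem_productChart_source R Λ Φ).1 hys
  obtain ⟨b1, b2, b3⟩ := (mem_productChart_source R Λ Φ).1 hz'
  obtain ⟨c, hc⟩ := eventually_torusChart a1 b1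
  obtain ⟨d, hd⟩ := eventually_torusChart a3 b3
  have hcont := (productChart R Λ Φ x).symm.continuousAt hz
  have hc' := (Φ.continuous.fst.continuousAt.comp hcont).eventually hc
  have hd' := (Φ.continuous.snd.snd.continuousAt.comp hcont).eventually hd
  have hΦ : (Φ y).2.1 = (R.chart (Φ x).2.1).symm (Λ.symm z).2.1 := by
    rw [hy, productChart_symm_apply, Homeomorph.apply_symm_apply]
  have h1 : ContDiffAt ℝ ∞ (fun w ↦ R.chart (Φ x').2.1 ((R.chart (Φ x).2.1).symm (Λ.symm w).2.1))
      z := by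
    refine ContDiffAt.comp (g := fun w ↦ R.chart (Φ x').2.1 ((R.chart (Φ x).2.1).symm w))
      (f := fun w ↦ (Λ.symm w).2.1) z (R.contDiffAt_transition hz.2.1 ?_) ?_
    · rw [← hΦ]
      exact b2
    · exact (Λ.symm.contDiff.snd.fst).contDiffAt
  have h2 : ContDiffAt ℝ ∞ (fun w ↦ Λ ((Λ.symm w).1 + c,
      R.chart (Φ x').2.1 ((R.chart (Φ x).2.1).symm (Λ.symm w).2.1), (Λ.symm w).2.2 + d)) z :=
    Λ.contDiff.contDiffAt.comp z
      ((Λ.symm.contDiff.fst.add contDiff_const).contDiffAt.prodMk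
        (h1.prodMk (Λ.symm.contDiff.snd.snd.add contDiff_const).contDiffAt))
  refine h2.congr_of_eventuallyEq ?_
  filter_upwards [hc', hd', (productChart R Λ Φ x).open_target.mem_nhds hz] with w e1 e2 hw
  change productChart R Λ Φ x' ((productChart R Λ Φ x).symm w) = _
  have e3 : (torusChart (torusBase (Φ x).1)) (Φ ((productChart R Λ Φ x).symm w)).1 =
      (Λ.symm w).1 := by
    rw [productChart_symm_apply, Homeomorph.apply_symm_apply]
    exact (torusChart (torusBase (Φ x).1)).right_inv hw.1
  have e4 : (torusChart (torusBase (Φ x).2.2)) (Φ ((productChart R Λ Φ x).symm w)).2.2 =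
      (Λ.symm w).2.2 := by
    rw [productChart_symm_apply, Homeomorph.apply_symm_apply]
    exact (torusChart (torusBase (Φ x).2.2)).right_inv hw.2.2
  rw [productChart_apply]
  refine congrArg Λ (Prod.ext ?_ (Prod.ext ?_ ?_))
  · exact (e1.trans (congrArg (· + c) e3))
  · refine congrArg (R.chart (Φ x').2.1) ?_
    rw [productChart_symm_apply, Homeomorph.apply_symm_apply]
  · exact (e2.trans (congrArg (· + d) e4))

/-- The coordinates `(θ̄, r̄, η̄)` on a manifold charted by the product, when `θ̄` and `η̄` depend
linearly on the coordinates of the two tori. -/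
def productCoord (P Q : (Fin n → ℝ) →L[ℝ] (Fin (n + 1) → ℝ)) (x : X) (z : E) : AmbientVec n :=
  (P (Λ.symm z).1, R.param (Φ x).2.1 (Λ.symm z).2.1, Q (Λ.symm z).2.2)

variable (P Q : (Fin n → ℝ) →L[ℝ] (Fin (n + 1) → ℝ))

theorem contDiffAt_productCoord {x : X} {z : E} (hz : z ∈ (productChart R Λ Φ x).target) :
    ContDiffAt ℝ ∞ (productCoord R Λ Φ P Q x) z := by
  have h1 : ContDiffAt ℝ ∞ (fun w ↦ R.param (Φ x).2.1 (Λ.symm w).2.1) z :=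
    ContDiffAt.comp (f := fun w ↦ (Λ.symm w).2.1) z (R.contDiffAt_param hz.2.1)
      (Λ.symm.contDiff.snd.fst).contDiffAt
  exact (P.contDiff.comp Λ.symm.contDiff.fst).contDiffAt.prodMk
    (h1.prodMk (Q.contDiff.comp Λ.symm.contDiff.snd.snd).contDiffAt)

theorem fderiv_productCoord {x : X} {z : E} (hz : z ∈ (productChart R Λ Φ x).target) (u : E) :
    fderiv ℝ (productCoord R Λ Φ P Q x) z u =
      (P (Λ.symm u).1, fderiv ℝ (R.param (Φ x).2.1) (Λ.symm z).2.1 (Λ.symm u).2.1,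
        Q (Λ.symm u).2.2) := by
  have h0 : HasFDerivAt Λ.symm (Λ.symm : E →L[ℝ] FlatVec n) z := Λ.symm.hasFDerivAt
  have h1 : HasFDerivAt (fun w ↦ R.param (Φ x).2.1 (Λ.symm w).2.1) _ z :=
    HasFDerivAt.comp (f := fun w ↦ (Λ.symm w).2.1) z
      (((R.contDiffAt_param hz.2.1).differentiableAt (by norm_num)).hasFDerivAt) h0.snd.fst
  have h2 : HasFDerivAt (productCoord R Λ Φ P Q x) _ z :=
    (HasFDerivAt.comp (f := fun w ↦ (Λ.symm w).1) z P.hasFDerivAt h0.fst).prodMk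
      (h1.prodMk (HasFDerivAt.comp (f := fun w ↦ (Λ.symm w).2.2) z Q.hasFDerivAt h0.snd.snd))
  rw [h2.fderiv]
  rfl

variable [ChartedSpace E X] (hX : ∀ x, chartAt E x = productChart R Λ Φ x)
  (hn : 1 ≤ n) (hne : ∀ t : RadialSpace n k₁ k₂, ∃ i j, t.1.1 i ≠ t.1.1 j)
  (hP : Function.Injective P) (hP' : ∀ y, (∃ x, P x = y) ↔ ∑ i, y i = 0)
  (hQ : Function.Injective Q) (hQ' : ∀ y, (∃ x, Q x = y) ↔ ∑ i, y i = 0)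

/-- The coordinates `productCoord`, with `P` and `Q` injective with image `∑ x_i = 0`. -/
def productDevelopingMaps : DevelopingMaps n E X where
  radius x := (Φ x).2.1.1
  toFun := productCoord R Λ Φ P Q
  contDiffOn x := by
    rw [hX]
    exact fun z hz ↦ (contDiffAt_productCoord R Λ Φ P Q hz).contDiffWithinAt
  toFun_radius x y hy := by
    rw [hX] at hy ⊢
    rw [productChart_apply, productCoord, ContinuousLinearEquiv.symm_apply_apply]
    change ((R.chart (Φ x).2.1).symm (R.chart (Φ x).2.1 (Φ y).2.1)).1.1 = _
    rw [(R.chart (Φ x).2.1).left_inv ((mem_productChart_source R Λ Φ).1 hy).2.1]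
  overlap x y hy := by
    rw [hX] at hy ⊢
    rw [hX]
    obtain ⟨a1, a2, a3⟩ := (mem_productChart_source R Λ Φ).1 hy
    obtain ⟨c, hc⟩ := eventually_torusChart a1 (mem_torusChart_source (Φ y).1)
    obtain ⟨d, hd⟩ := eventually_torusChart a3 (mem_torusChart_source (Φ y).2.2)
    refine ⟨(P c, 0, Q d), ?_⟩
    filter_upwards [Φ.continuous.fst.continuousAt.eventually hc,
      Φ.continuous.snd.snd.continuousAt.eventually hd,
      (productChart R Λ Φ x).open_source.mem_nhds hy,
      (productChart R Λ Φ y).open_source.mem_nhds (mem_productChart_source_self R Λ Φ y)]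
      with w e1 e2 hw hw'
    simp only [productCoord, productChart_apply, ContinuousLinearEquiv.symm_apply_apply, e1, e2,
      map_add, RadialAtlas.param]
    rw [(R.chart (Φ x).2.1).left_inv ((mem_productChart_source R Λ Φ).1 hw).2.1,
      (R.chart (Φ y).2.1).left_inv ((mem_productChart_source R Λ Φ).1 hw').2.1]
    simp
  injective x := by
    have hx : chartAt E x x ∈ (productChart R Λ Φ x).target := by
      rw [hX]
      exact (productChart R Λ Φ x).map_source (mem_productChart_source_self R Λ Φ x)
    intro u v huv
    rw [fderiv_productCoord R Λ Φ P Q hx, fderiv_productCoord R Λ Φ P Q hx] at huv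
    have e := Prod.ext_iff.1 huv
    have e' := Prod.ext_iff.1 e.2
    exact Λ.symm.injective (Prod.ext (hP e.1)
      (Prod.ext (R.fderiv_param_injective hx.2.1 e'.1) (hQ e'.2)))
  mem_range x v := by
    have hx : chartAt E x x ∈ (productChart R Λ Φ x).target := by
      rw [hX]
      exact (productChart R Λ Φ x).map_source (mem_productChart_source_self R Λ Φ x)
    have hparam : R.param (Φ x).2.1 (Λ.symm (chartAt E x x)).2.1 = (Φ x).2.1.1.1 := by
      rw [hX, productChart_apply, ContinuousLinearEquiv.symm_apply_apply]
      change ((R.chart (Φ x).2.1).symm (R.chart (Φ x).2.1 (Φ x).2.1)).1.1 = _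
      rw [(R.chart (Φ x).2.1).left_inv (R.mem_source _)]
    have hr := R.range_fderiv_param hn hne ((mem_productChart_target R Λ Φ).1 hx).2.1 v.2.1
    have hrad : radialDeriv (Φ x).2.1.1.1 v.2.1 = 0 ↔
        ∑ i, (Φ x).2.1.1.1 i * v.2.1 i = 0 ∧ ∑ i, ((Φ x).2.1.1.1 i)⁻¹ * v.2.1 i = 0 := by
      rw [radialDeriv_apply, Prod.ext_iff]
      simp [mul_assoc, ← Finset.mul_sum]
    rw [hparam, hrad] at hr
    simp only [fderiv_productCoord R Λ Φ P Q hx]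
    rw [← and_assoc (a := ∑ i, (Φ x).2.1.1.1 i * v.2.1 i = 0), ← hr, ← hP', ← hQ']
    constructor
    · rintro ⟨u, rfl⟩
      exact ⟨⟨_, rfl⟩, ⟨_, rfl⟩, ⟨_, rfl⟩⟩
    · rintro ⟨⟨a, ha⟩, ⟨b, hb⟩, ⟨c, hc⟩⟩
      refine ⟨Λ (a, b, c), ?_⟩
      rw [ContinuousLinearEquiv.symm_apply_apply]
      exact Prod.ext ha (Prod.ext hb hc)
  vertical := LinearMap.ker ((LinearMap.fst ℝ _ _ ∘ₗ LinearMap.snd ℝ _ _) ∘ₗ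
    (Λ.symm : E →L[ℝ] FlatVec n).toLinearMap)
  mem_vertical x z hz u := by
    rw [hX] at hz
    rw [fderiv_productCoord R Λ Φ P Q hz, LinearMap.mem_ker]
    change (Λ.symm u).2.1 = 0 ↔ fderiv ℝ (R.param (Φ x).2.1) (Λ.symm z).2.1 (Λ.symm u).2.1 = 0
    exact (map_eq_zero_iff _ (R.fderiv_param_injective hz.2.1)).symm

end Product

/-! ### Differentials of maps between the manifolds -/

section Maps

theorem contMDiff_torusCoe {N : ℕ} : ContMDiff 𝓘(ℝ, Fin N → ℝ) 𝓘(ℝ, Fin N → ℝ) ∞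
    (torusCoe : (Fin N → ℝ) → Torus N) := by
  intro z
  refine contMDiffAt_iff.2 ⟨?_, ?_⟩
  · exact (continuous_pi fun i ↦ (AddCircle.continuous_mk' 1).comp (continuous_apply i)).continuousAt
  · have h := eventually_torusChart_torusCoe (torusBase (torusCoe z)) z (mem_torusChart_source _)
    exact ((contDiffAt_id.add contDiffAt_const).congr_of_eventuallyEq h).contDiffWithinAt

theorem hasMFDerivAt_torusCoe {N : ℕ} (z : Fin N → ℝ) :
    HasMFDerivAt 𝓘(ℝ, Fin N → ℝ) 𝓘(ℝ, Fin N → ℝ) (torusCoe : (Fin N → ℝ) → Torus N) z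
      (ContinuousLinearMap.id ℝ (Fin N → ℝ)) := by
  refine ⟨contMDiff_torusCoe.continuous.continuousAt, ?_⟩
  have h := eventually_torusChart_torusCoe (torusBase (torusCoe z)) z (mem_torusChart_source _)
  exact (((hasFDerivAt_id z).add_const _).congr_of_eventuallyEq h).hasFDerivWithinAt

variable {E H : Type*} [NormedAddCommGroup E] [NormedSpace ℝ E] [TopologicalSpace H]
  {I : ModelWithCorners ℝ E H} {X : Type*} [TopologicalSpace X] [ChartedSpace H X]

/-- A map to an open subset of a vector space has the same derivative as a map to the space. -/
theorem hasMFDerivAt_opens {F : Type*} [NormedAddCommGroup F] [NormedSpace ℝ F]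
    {U : TopologicalSpace.Opens F} {g : X → U} {x : X} {g' : TangentSpace I x →L[ℝ] F} :
    HasMFDerivAt I 𝓘(ℝ, F) g x g' ↔ HasMFDerivAt I 𝓘(ℝ, F) (fun y ↦ (g y : F)) x g' :=
  and_congr (Topology.IsInducing.subtypeVal.continuousAt_iff) Iff.rfl

variable {E' : Type*} [NormedAddCommGroup E'] [NormedSpace ℝ E']
  {Y : Type*} [TopologicalSpace Y] [ChartedSpace E' Y] [IsManifold 𝓘(ℝ, E') ∞ Y]

theorem contMDiffAt_of_chart {g : Y → X} {G : E' → X}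
    {x y : Y} (hy : y ∈ (chartAt E' x).source) (hG : ContMDiffAt 𝓘(ℝ, E') I ∞ G (chartAt E' x y))
    (h : ∀ᶠ y' in nhds y, g y' = G (chartAt E' x y')) : ContMDiffAt 𝓘(ℝ, E') I ∞ g y :=
  (ContMDiffAt.comp (g := G) y hG (contMDiffAt_extChartAt' (I := 𝓘(ℝ, E')) hy)).congr_of_eventuallyEq
    h

/-- The tangent space at `x` is identified with the model space by the chart at `x`, so a function
of this chart has the derivative of that function. -/
theorem hasMFDerivAt_of_chart {g : Y → X}
    {G : E' → X} {x : Y} {g' : E' →L[ℝ] TangentSpace I (G (chartAt E' x x))}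
    (hG : HasMFDerivAt 𝓘(ℝ, E') I G (chartAt E' x x) g')
    (h : ∀ᶠ y' in nhds x, g y' = G (chartAt E' x y')) : HasMFDerivAt 𝓘(ℝ, E') I g x g' := by
  have : IsManifold 𝓘(ℝ, E') 1 Y := IsManifold.of_le (n := ∞) (by norm_num)
  have h1 := (mdifferentiableAt_extChartAt (I := 𝓘(ℝ, E')) (mem_chart_source E' x)).hasMFDerivAt
  have h2 := HasMFDerivAt.comp x hG h1
  rw [mfderiv_extChartAt_self] at h2
  exact h2.congr_of_eventuallyEq h

end Maps

namespace DevelopingMaps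

variable {n : ℕ} {E : Type*} [NormedAddCommGroup E] [NormedSpace ℝ E]
  {X : Type*} [TopologicalSpace X] [ChartedSpace E X] (G : DevelopingMaps n E X)
  [IsManifold 𝓘(ℝ, E) ∞ X] {ι : X → FibredProduct n} (hι : Continuous ι)
  (h : ∀ x, ∀ y ∈ (chartAt E x).source, (ι y).1 = torusCoe (G.toFun x (chartAt E x y)).1 ∧
    (ι y).2.1 = G.radius y ∧ (ι y).2.2 = torusCoe (G.toFun x (chartAt E x y)).2.2)

include h in
/-- A map to the fibred product which has the coordinates `(θ̄, r̄, η̄)`. -/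
theorem hasMFDerivAt_of_coord (x : X) :
    HasMFDerivAt 𝓘(ℝ, E) (ambientModel n) ι x (G.components x) := by
  have h0 : HasFDerivAt (G.toFun x) (G.components x) (chartAt E x x) :=
    G.hasFDerivAt_toFun ((chartAt E x).map_source (mem_chart_source E x))
  have hev := (chartAt E x).open_source.mem_nhds (mem_chart_source E x)
  have h1 : HasMFDerivAt 𝓘(ℝ, E) 𝓘(ℝ, Fin (n + 1) → ℝ) (fun y ↦ (ι y).1) x _ :=
    hasMFDerivAt_of_chart (I := 𝓘(ℝ, Fin (n + 1) → ℝ))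
      (HasMFDerivAt.comp (g := torusCoe) (f := fun z ↦ (G.toFun x z).1)
      (chartAt E x x) (hasMFDerivAt_torusCoe _) h0.fst.hasMFDerivAt)
      (by filter_upwards [hev] with y hy using (h x y hy).1)
  have h2 : HasMFDerivAt 𝓘(ℝ, E) 𝓘(ℝ, Fin (n + 1) → ℝ) (fun y ↦ (ι y).2.1) x _ :=
    hasMFDerivAt_opens.2 (hasMFDerivAt_of_chart (G := fun z ↦ (G.toFun x z).2.1)
      h0.snd.fst.hasMFDerivAt (by
        filter_upwards [hev] with y hy
        rw [(h x y hy).2.1, G.toFun_radius x y hy]))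
  have h3 : HasMFDerivAt 𝓘(ℝ, E) 𝓘(ℝ, Fin (n + 1) → ℝ) (fun y ↦ (ι y).2.2) x _ :=
    hasMFDerivAt_of_chart (I := 𝓘(ℝ, Fin (n + 1) → ℝ))
      (HasMFDerivAt.comp (g := torusCoe) (f := fun z ↦ (G.toFun x z).2.2)
      (chartAt E x x) (hasMFDerivAt_torusCoe _) h0.snd.snd.hasMFDerivAt)
      (by filter_upwards [hev] with y hy using (h x y hy).2.2)
  exact h1.prodMk (h2.prodMk h3)

include h in
theorem contMDiff_of_coord : ContMDiff 𝓘(ℝ, E) (ambientModel n) ∞ ι := by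
  intro x
  have h0 : ContDiffAt ℝ ∞ (G.toFun x) (chartAt E x x) :=
    (G.contDiffOn x).contDiffAt ((chartAt E x).open_target.mem_nhds
      ((chartAt E x).map_source (mem_chart_source E x)))
  have hev := (chartAt E x).open_source.mem_nhds (mem_chart_source E x)
  have h1 : ContMDiffAt 𝓘(ℝ, E) 𝓘(ℝ, Fin (n + 1) → ℝ) ∞ (fun y ↦ (ι y).1) x :=
    contMDiffAt_of_chart (I := 𝓘(ℝ, Fin (n + 1) → ℝ)) (mem_chart_source E x)
      (G := fun z ↦ torusCoe (G.toFun x z).1)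
      (ContMDiffAt.comp (chartAt E x x) (contMDiff_torusCoe _) h0.fst.contMDiffAt)
      (by filter_upwards [hev] with y hy using (h x y hy).1)
  have h2 : ContMDiffAt 𝓘(ℝ, E) 𝓘(ℝ, Fin (n + 1) → ℝ) ∞ (fun y ↦ (ι y).2.1) x :=
    (ContMDiffAt.subtypeVal_comp_iff _ _ _).1 (contMDiffAt_of_chart (mem_chart_source E x)
      (G := fun z ↦ (G.toFun x z).2.1) h0.snd.fst.contMDiffAt (by
        filter_upwards [hev] with y hy
        rw [Function.comp_apply, (h x y hy).2.1, G.toFun_radius x y hy]))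
  have h3 : ContMDiffAt 𝓘(ℝ, E) 𝓘(ℝ, Fin (n + 1) → ℝ) ∞ (fun y ↦ (ι y).2.2) x :=
    contMDiffAt_of_chart (I := 𝓘(ℝ, Fin (n + 1) → ℝ)) (mem_chart_source E x)
      (G := fun z ↦ torusCoe (G.toFun x z).2.2)
      (ContMDiffAt.comp (chartAt E x x) (contMDiff_torusCoe _) h0.snd.snd.contMDiffAt)
      (by filter_upwards [hev] with y hy using (h x y hy).2.2)
  exact h1.prodMk (h2.prodMk h3)

variable {E' : Type*} [NormedAddCommGroup E'] [NormedSpace ℝ E']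
  {X' : Type*} [TopologicalSpace X'] [ChartedSpace E' X'] (G' : DevelopingMaps n E' X')
  [IsManifold 𝓘(ℝ, E') ∞ X']

/-- A map which preserves the coordinates `(θ̄, r̄, η̄)` up to locally constant terms preserves the
components of tangent vectors. -/
theorem components_comp_mfderiv {g : X → X'} {x : X}
    (hg : MDifferentiableAt 𝓘(ℝ, E) 𝓘(ℝ, E') g x) {c : AmbientVec n}
    (h : ∀ᶠ y in nhds x, G'.toFun (g x) (chartAt E' (g x) (g y)) =
      G.toFun x (chartAt E x y) + c) :
    (G'.components (g x)).comp (mfderiv 𝓘(ℝ, E) 𝓘(ℝ, E') g x) = G.components x := by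
  have h0 : HasFDerivAt (G.toFun x) (G.components x) (chartAt E x x) :=
    G.hasFDerivAt_toFun ((chartAt E x).map_source (mem_chart_source E x))
  have h0' : HasFDerivAt (G'.toFun (g x)) (G'.components (g x)) (chartAt E' (g x) (g x)) :=
    G'.hasFDerivAt_toFun ((chartAt E' (g x)).map_source (mem_chart_source E' (g x)))
  have h1 : HasMFDerivAt 𝓘(ℝ, E') 𝓘(ℝ, AmbientVec n)
      (fun y ↦ G'.toFun (g x) (chartAt E' (g x) y)) (g x) (G'.components (g x)) :=
    hasMFDerivAt_of_chart (I := 𝓘(ℝ, AmbientVec n)) (G := G'.toFun (g x))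
      h0'.hasMFDerivAt (Filter.Eventually.of_forall fun y ↦ rfl)
  have h2 : HasMFDerivAt 𝓘(ℝ, E) 𝓘(ℝ, AmbientVec n)
      (fun y ↦ G'.toFun (g x) (chartAt E' (g x) (g y))) x (G.components x) :=
    hasMFDerivAt_of_chart (h0.add_const c).hasMFDerivAt h
  exact hasMFDerivAt_unique (HasMFDerivAt.comp x h1 hg.hasMFDerivAt) h2

omit [IsManifold 𝓘(ℝ, E) ∞ X] [IsManifold 𝓘(ℝ, E') ∞ X'] in
variable {G G'} in
theorem form_eq_pullback {g : X → X'} (hr : ∀ x, G'.radius (g x) = G.radius x)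
    (h : ∀ x, (G'.components (g x)).comp (mfderiv 𝓘(ℝ, E) 𝓘(ℝ, E') g x) = G.components x)
    (H : ℝ → ℝ) (α β : Fin (n + 1) → AmbientVec n →L[ℝ] ℝ) :
    G.form H α β = TwoForm.pullback 𝓘(ℝ, E) 𝓘(ℝ, E') g (G'.form H α β) := by
  funext x
  rw [form, ← h, ← hr]
  rfl

variable {G G'} in
theorem metric_eq_pullback [FiniteDimensional ℝ E] [FiniteDimensional ℝ E'] {g : X → X'}
    (hr : ∀ x, G'.radius (g x) = G.radius x)
    (h : ∀ x, (G'.components (g x)).comp (mfderiv 𝓘(ℝ, E) 𝓘(ℝ, E') g x) = G.components x)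
    (x : X) (v w : TangentSpace 𝓘(ℝ, E) x) :
    G.metric.inner x v w = G'.metric.inner (g x) (mfderiv 𝓘(ℝ, E) 𝓘(ℝ, E') g x v)
      (mfderiv 𝓘(ℝ, E) 𝓘(ℝ, E') g x w) := by
  refine (G.metric_inner x v w).trans (Eq.trans ?_ (G'.metric_inner (g x) _ _).symm)
  rw [← h, ← hr]
  rfl

end DevelopingMaps

/-! ### Maps between products of tori and the space of radii -/

section ProductMaps

theorem RadialAtlas.chart_mem_target {n : ℕ} {k₁ k₂ : ℝ} (R : RadialAtlas n k₁ k₂)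
    (s : RadialSpace n k₁ k₂) : R.chart s s ∈ (R.chart s).target :=
  (R.chart s).map_source (R.mem_source s)

variable {n : ℕ} {k₁ k₂ : ℝ} {E : Type*} [NormedAddCommGroup E] [NormedSpace ℝ E]
  {X X' : Type*} [TopologicalSpace X] [TopologicalSpace X']
  (R : RadialAtlas n k₁ k₂) (Λ : FlatVec n ≃L[ℝ] E)
  (Φ : X ≃ₜ Torus n × RadialSpace n k₁ k₂ × Torus n)
  (Φ' : X' ≃ₜ Torus n × RadialSpace n k₁ k₂ × Torus n)

section Covering

variable {g : X → X'} {A B : Matrix (Fin n) (Fin n) ℤ}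
  (hg : ∀ x, Φ' (g x) = (torusMap A (Φ x).1, (Φ x).2.1, torusMap B (Φ x).2.2))

include hg in
/-- The map `g` in charts. -/
theorem eventually_productChart (x : X) : ∃ c d, ∀ᶠ y in nhds x,
    productChart R Λ Φ' (g x) (g y) = Λ (realMap A (Λ.symm (productChart R Λ Φ x y)).1 + c,
      (Λ.symm (productChart R Λ Φ x y)).2.1,
      realMap B (Λ.symm (productChart R Λ Φ x y)).2.2 + d) := by
  obtain ⟨c, hc⟩ := eventually_torusChart_torusMap A (mem_torusChart_source (Φ x).1)
    (mem_torusChart_source (torusMap A (Φ x).1))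
  obtain ⟨d, hd⟩ := eventually_torusChart_torusMap B (mem_torusChart_source (Φ x).2.2)
    (mem_torusChart_source (torusMap B (Φ x).2.2))
  refine ⟨c, d, ?_⟩
  filter_upwards [Φ.continuous.fst.continuousAt.eventually hc,
    Φ.continuous.snd.snd.continuousAt.eventually hd] with y e1 e2
  simp only [productChart_apply, ContinuousLinearEquiv.symm_apply_apply, hg, e1, e2]

variable [ChartedSpace E X] (hX : ∀ x, chartAt E x = productChart R Λ Φ x)
  [ChartedSpace E X'] (hX' : ∀ x, chartAt E x = productChart R Λ Φ' x)
  [IsManifold 𝓘(ℝ, E) ∞ X] [IsManifold 𝓘(ℝ, E) ∞ X']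
  (A' B' : (Fin n → ℝ) ≃L[ℝ] (Fin n → ℝ)) (hA : ∀ z, A' z = realMap A z)
  (hB : ∀ z, B' z = realMap B z)

include hg hX hX' hA hB

/-- In charts, `g` is an affine bijection. -/
theorem isLocalDiffeomorph_of_torusMap : IsLocalDiffeomorph 𝓘(ℝ, E) 𝓘(ℝ, E) ∞ g := by
  intro x
  obtain ⟨c, d, h⟩ := eventually_productChart R Λ Φ Φ' hg x
  let α : E ≃ₜ E := (Λ.symm.toHomeomorph.trans
    ((A'.toHomeomorph.trans (Homeomorph.addRight c)).prodCongr ((Homeomorph.refl _).prodCongr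
      (B'.toHomeomorph.trans (Homeomorph.addRight d))))).trans Λ.toHomeomorph
  have hα : ∀ z, α z = Λ (A' (Λ.symm z).1 + c, (Λ.symm z).2.1, B' (Λ.symm z).2.2 + d) :=
    fun z ↦ rfl
  have hα' : ∀ z, α.symm z = Λ (A'.symm ((Λ.symm z).1 + -c), (Λ.symm z).2.1,
    B'.symm ((Λ.symm z).2.2 + -d)) := fun z ↦ rfl
  have hs : ContDiff ℝ ∞ α := by
    rw [funext hα]
    exact Λ.contDiff.comp (((A'.contDiff.comp Λ.symm.contDiff.fst).add contDiff_const).prodMk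
      (Λ.symm.contDiff.snd.fst.prodMk
        ((B'.contDiff.comp Λ.symm.contDiff.snd.snd).add contDiff_const)))
  have hs' : ContDiff ℝ ∞ α.symm := by
    rw [funext hα']
    exact Λ.contDiff.comp
      ((A'.symm.contDiff.comp (Λ.symm.contDiff.fst.add contDiff_const)).prodMk
      (Λ.symm.contDiff.snd.fst.prodMk
        (B'.symm.contDiff.comp (Λ.symm.contDiff.snd.snd.add contDiff_const))))
  have hcont : Continuous g := by
    have h1 : Continuous fun y ↦ Φ' (g y) := by
      simp only [hg]
      exact ((continuous_torusMap A).comp Φ.continuous.fst).prodMk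
        (Φ.continuous.snd.fst.prodMk ((continuous_torusMap B).comp Φ.continuous.snd.snd))
    exact (Φ'.comp_continuous_iff).1 h1
  have h1 : ∀ᶠ y in nhds x, chartAt E (g x) (g y) = α (chartAt E x y) := by
    filter_upwards [h] with y hy
    rw [hX, hX', hy, hα, hA, hB]
  have h2 : ∀ᶠ y in nhds x, g y ∈ (chartAt E (g x)).source :=
    hcont.continuousAt.eventually ((chartAt E (g x)).open_source.mem_nhds (mem_chart_source E _))
  obtain ⟨s, hsub, hso, hxs⟩ := eventually_nhds_iff.1 (h1.and h2)
  let Ψ : OpenPartialHomeomorph X X' := (((chartAt E x).transHomeomorph α).trans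
    (chartAt E (g x)).symm).restrOpen s hso
  have hΨ : ∀ y ∈ s, g y = Ψ y := by
    intro y hy
    change g y = (chartAt E (g x)).symm (α (chartAt E x y))
    rw [← (hsub y hy).1, (chartAt E (g x)).left_inv (hsub y hy).2]
  have hsrc : ∀ y ∈ Ψ.source, y ∈ (chartAt E x).source ∧
      α (chartAt E x y) ∈ (chartAt E (g x)).target ∧ y ∈ s := fun y hy ↦ ⟨hy.1.1, hy.1.2, hy.2⟩
  refine ⟨⟨Ψ.toPartialEquiv, Ψ.open_source, Ψ.open_target, ?_, ?_⟩, ?_, fun y hy ↦ hΨ y hy.2⟩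
  · exact (contMDiffOn_chart_symm (I := 𝓘(ℝ, E)) (x := g x)).comp
      (hs.contMDiff.contMDiffOn (s := Set.univ) |>.comp
        ((contMDiffOn_chart (I := 𝓘(ℝ, E)) (x := x)).mono fun y hy ↦ (hsrc y hy).1)
        fun y _ ↦ Set.mem_univ _) fun y hy ↦ (hsrc y hy).2.1
  · have htgt : ∀ y ∈ Ψ.target, y ∈ (chartAt E (g x)).source ∧
        α.symm (chartAt E (g x) y) ∈ (chartAt E x).target := fun y hy ↦ ⟨hy.1.1, hy.1.2⟩
    exact (contMDiffOn_chart_symm (I := 𝓘(ℝ, E)) (x := x)).comp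
      (hs'.contMDiff.contMDiffOn (s := Set.univ) |>.comp
        ((contMDiffOn_chart (I := 𝓘(ℝ, E)) (x := g x)).mono fun y hy ↦ (htgt y hy).1)
        fun y _ ↦ Set.mem_univ _) fun y hy ↦ (htgt y hy).2
  · refine ⟨⟨mem_chart_source E x, ?_⟩, hxs⟩
    change α (chartAt E x x) ∈ (chartAt E (g x)).target
    rw [← (hsub x hxs).1]
    exact mem_chart_target E (g x)

/-- `g` preserves the components of tangent vectors, when the coordinates on `X'` are chosen
accordingly. -/
theorem productDevelopingMaps_components_comp_mfderiv
    {P Q P' Q' : (Fin n → ℝ) →L[ℝ] (Fin (n + 1) → ℝ)}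
    (G : DevelopingMaps n E X) (hG : G.toFun = productCoord R Λ Φ P Q)
    (G' : DevelopingMaps n E X') (hG' : G'.toFun = productCoord R Λ Φ' P' Q')
    (hP : ∀ z, P' (A' z) = P z) (hQ : ∀ z, Q' (B' z) = Q z) (x : X) :
    (G'.components (g x)).comp (mfderiv 𝓘(ℝ, E) 𝓘(ℝ, E) g x) = G.components x := by
  obtain ⟨c, d, h⟩ := eventually_productChart R Λ Φ Φ' hg x
  refine G.components_comp_mfderiv G' (((isLocalDiffeomorph_of_torusMap R Λ Φ Φ' hg hX hX' A' B'
    hA hB) x).mdifferentiableAt (by norm_num)) (c := (P' c, 0, Q' d)) ?_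
  filter_upwards [h] with y hy
  rw [hX, hX', hy, hG, hG', ← hA, ← hB]
  simp only [productCoord, ContinuousLinearEquiv.symm_apply_apply, map_add, hP, hQ, hg]
  simp

end Covering

variable [ChartedSpace E X] (hX : ∀ x, chartAt E x = productChart R Λ Φ x)
  [IsManifold 𝓘(ℝ, E) ∞ X]
  [ChartedSpace (EuclideanSpace ℝ (Fin (n - 1))) (RadialSpace n k₁ k₂)]
  (hR : ∀ s, chartAt (EuclideanSpace ℝ (Fin (n - 1))) s = R.chart s)
  [IsManifold (𝓡 (n - 1)) ∞ (RadialSpace n k₁ k₂)]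

include hR

theorem RadialAtlas.isSmoothEmbedding : IsSmoothEmbedding (𝓡 (n - 1)) 𝓘(ℝ, Fin (n + 1) → ℝ)
    (Subtype.val : RadialSpace n k₁ k₂ → Radii n) := by
  have hev : ∀ s : RadialSpace n k₁ k₂, ∀ᶠ t in nhds s,
      t.1.1 = R.param s (chartAt (EuclideanSpace ℝ (Fin (n - 1))) s t) := by
    intro s
    filter_upwards [(R.chart s).open_source.mem_nhds (R.mem_source s)] with t ht
    rw [hR, RadialAtlas.param, (R.chart s).left_inv ht]
  refine ⟨fun s ↦ ?_, Topology.IsEmbedding.subtypeVal, fun s ↦ ?_⟩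
  · refine (ContMDiffAt.subtypeVal_comp_iff _ _ _).1 (contMDiffAt_of_chart
      (mem_chart_source (EuclideanSpace ℝ (Fin (n - 1))) s) (G := R.param s) ?_ (hev s))
    rw [hR]
    exact (R.contDiffAt_param (R.chart_mem_target s)).contMDiffAt
  · have h1 : HasFDerivAt (R.param s) (fderiv ℝ (R.param s) (R.chart s s))
        (chartAt (EuclideanSpace ℝ (Fin (n - 1))) s s) := by
      rw [hR]
      exact ((R.contDiffAt_param (R.chart_mem_target s)).differentiableAt (by norm_num)).hasFDerivAt
    have h2 : HasMFDerivAt (𝓡 (n - 1)) 𝓘(ℝ, Fin (n + 1) → ℝ)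
        (Subtype.val : RadialSpace n k₁ k₂ → Radii n) s
        (fderiv ℝ (R.param s) (R.chart s s)) := by
      refine hasMFDerivAt_opens.2 ?_
      exact hasMFDerivAt_of_chart (I := 𝓘(ℝ, Fin (n + 1) → ℝ)) h1.hasMFDerivAt (hev s)
    rw [h2.mfderiv]
    exact R.fderiv_param_injective (R.chart_mem_target s)

include hX

theorem contMDiff_radial_of_product :
    ContMDiff 𝓘(ℝ, E) (𝓡 (n - 1)) ∞ (fun x ↦ (Φ x).2.1) := by
  intro x
  refine contMDiffAt_of_chart (mem_chart_source E x)
    (G := fun z ↦ (chartAt (EuclideanSpace ℝ (Fin (n - 1))) (Φ x).2.1).symm (Λ.symm z).2.1) ?_ ?_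
  · refine ContMDiffAt.comp (g := (chartAt (EuclideanSpace ℝ (Fin (n - 1))) (Φ x).2.1).symm)
      (f := fun z ↦ (Λ.symm z).2.1) _ ?_ Λ.symm.contDiff.snd.fst.contMDiff.contMDiffAt
    refine (contMDiffOn_chart_symm (I := 𝓡 (n - 1)) (x := (Φ x).2.1)).contMDiffAt
      ((chartAt _ (Φ x).2.1).open_target.mem_nhds ?_)
    rw [hX, productChart_apply, ContinuousLinearEquiv.symm_apply_apply, hR]
    exact R.chart_mem_target _
  · filter_upwards [(productChart R Λ Φ x).open_source.mem_nhds
      (mem_productChart_source_self R Λ Φ x)] with y hy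
    rw [hX, hR, productChart_apply, ContinuousLinearEquiv.symm_apply_apply]
    exact ((R.chart (Φ x).2.1).left_inv ((mem_productChart_source R Λ Φ).1 hy).2.1).symm

theorem contMDiff_section_of_product (a b : Torus n) :
    ContMDiff (𝓡 (n - 1)) 𝓘(ℝ, E) ∞ (fun s ↦ Φ.symm (a, s, b)) := by
  intro s
  set x := Φ.symm (a, s, b) with hx
  have hΦ : Φ x = (a, s, b) := Φ.apply_symm_apply _
  refine contMDiffAt_of_chart (mem_chart_source (EuclideanSpace ℝ (Fin (n - 1))) s)
    (G := fun z ↦ (chartAt E x).symm (Λ (torusChart (torusBase a) a, z, torusChart (torusBase b) b)))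
    ?_ ?_
  · refine ContMDiffAt.comp (g := (chartAt E x).symm)
      (f := fun z ↦ Λ (torusChart (torusBase a) a, z, torusChart (torusBase b) b)) _ ?_
      (Λ.contDiff.comp
        (contDiff_const.prodMk (contDiff_id.prodMk contDiff_const))).contMDiff.contMDiffAt
    refine (contMDiffOn_chart_symm (I := 𝓘(ℝ, E)) (x := x)).contMDiffAt
      ((chartAt _ x).open_target.mem_nhds ?_)
    rw [hR]
    have h := mem_chart_target E x
    rw [hX, productChart_apply, hΦ] at h
    rwa [hX]
  · filter_upwards [(R.chart s).open_source.mem_nhds (R.mem_source s)] with t ht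
    rw [hX, hR, productChart_symm_apply, ContinuousLinearEquiv.symm_apply_apply, hΦ]
    simp only [torusCoe_torusChart]
    rw [(R.chart s).left_inv ht]

end ProductMaps

/-! ### The homeomorphisms of `𝕏̃` and `𝕏` with the product -/

section Homeomorphisms

variable (n : ℕ) (k₁ k₂ : ℝ)

/-- The homeomorphism of `𝕏̃` with the product which parametrizes the two subtori
`Im f_{Δ_n^*}^* = Im f_{Δ_n}^*` by `f_{Δ_n}^*`. -/
def tildeHomeo : XTilde n k₁ k₂ ≃ₜ Torus n × RadialSpace n k₁ k₂ × Torus n where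
  toFun p := (fun i ↦ p.1.1 i.castSucc, ⟨p.1.2.1, p.2.2.2.1, p.2.2.2.2⟩,
    fun i ↦ p.1.2.2 i.castSucc)
  invFun q := ⟨(fTr n q.1, q.2.1.1, fTr n q.2.2), range_fDualTr n ▸ ⟨q.1, rfl⟩, ⟨q.2.2, rfl⟩,
    q.2.1.2.1, q.2.1.2.2⟩
  left_inv p := by
    have h : ∀ θ ∈ (fTr n).range, fTr n (fun i ↦ θ i.castSucc) = θ := by
      rintro _ ⟨x, rfl⟩
      exact congrArg (fTr n) (funext fun i ↦ torusMap_dual_transpose_castSucc x i)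
    exact Subtype.ext (Prod.ext (h _ (range_fDualTr n ▸ p.2.1)) (Prod.ext rfl (h _ p.2.2.1)))
  right_inv q := by
    refine Prod.ext ?_ (Prod.ext rfl ?_)
    · exact funext fun i ↦ torusMap_dual_transpose_castSucc q.1 i
    · exact funext fun i ↦ torusMap_dual_transpose_castSucc q.2.2 i
  continuous_toFun := by
    refine (continuous_pi fun i ↦ ?_).prodMk (Continuous.prodMk ?_ (continuous_pi fun i ↦ ?_))
    · exact (continuous_apply _).comp continuous_subtype_val.fst
    · exact continuous_subtype_val.snd.fst.subtype_mk _
    · exact (continuous_apply _).comp continuous_subtype_val.snd.snd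
  continuous_invFun := by
    refine Continuous.subtype_mk ?_ _
    exact ((continuous_torusMap _).comp continuous_fst).prodMk
      ((continuous_subtype_val.comp continuous_snd.fst).prodMk
        ((continuous_torusMap _).comp continuous_snd.snd))

variable {n k₁ k₂} in
theorem tildeHomeo_fst (p : XTilde n k₁ k₂) : fTr n (tildeHomeo n k₁ k₂ p).1 = p.1.1 :=
  congrArg (fun q : XTilde n k₁ k₂ ↦ q.1.1) ((tildeHomeo n k₁ k₂).symm_apply_apply p)

variable {n k₁ k₂} in
theorem tildeHomeo_snd_snd (p : XTilde n k₁ k₂) : fTr n (tildeHomeo n k₁ k₂ p).2.2 = p.1.2.2 :=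
  congrArg (fun q : XTilde n k₁ k₂ ↦ q.1.2.2) ((tildeHomeo n k₁ k₂).symm_apply_apply p)

theorem compactSpace_XTilde : CompactSpace (XTilde n k₁ k₂) := by
  have := compactSpace_RadialSpace (n := n) (k₁ := k₁) (k₂ := k₂)
  have : Fact ((0 : ℝ) < 1) := ⟨one_pos⟩
  exact (tildeHomeo n k₁ k₂).symm.compactSpace

/-- The map `[θ̄, r̄, η̄] ↦ (f_{Δ_n}(θ̄), r̄, f_{Δ_n^*}(η̄))`. -/
def quotientMap : XSpace n k₁ k₂ → Torus n × RadialSpace n k₁ k₂ × Torus n :=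
  Quotient.lift (fun p ↦ (f n p.1.1, ⟨p.1.2.1, p.2.2.2.1, p.2.2.2.2⟩, fDual n p.1.2.2)) (by
    rintro p q ⟨g, rfl⟩
    refine Prod.ext ?_ (Prod.ext rfl ?_)
    · change f n (g.1.1 + q.1.1) = f n q.1.1
      rw [map_add, show f n g.1.1 = 0 from g.1.2.1, zero_add]
    · change fDual n (g.2.1 + q.1.2.2) = fDual n q.1.2.2
      rw [map_add, show fDual n g.2.1 = 0 from g.2.2.1, zero_add])

variable {n k₁ k₂} in
theorem quotientMap_toX (p : XTilde n k₁ k₂) : quotientMap n k₁ k₂ (toX p) =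
    (torusMap (dualVertexMatrix n * (dualVertexMatrix n).transpose) (tildeHomeo n k₁ k₂ p).1,
      (tildeHomeo n k₁ k₂ p).2.1,
      torusMap (vertexMatrix n * (dualVertexMatrix n).transpose) (tildeHomeo n k₁ k₂ p).2.2) := by
  rw [torusMap_mul, torusMap_mul]
  exact Prod.ext (congrArg (f n) (tildeHomeo_fst p).symm)
    (Prod.ext rfl (congrArg (fDual n) (tildeHomeo_snd_snd p).symm))

/-- `Ker f_{Δ_n}` and `Ker f_{Δ_n^*}` meet the subtorus in `D_{Δ_n}` and `D_{Δ_n^*}`. -/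
theorem quotientMap_injective : Function.Injective (quotientMap n k₁ k₂) := by
  intro x y h
  induction x using Quotient.inductionOn with | h p
  induction y using Quotient.inductionOn with | h q
  have h1 : f n p.1.1 = f n q.1.1 := congrArg Prod.fst h
  have h2 : p.1.2.1 = q.1.2.1 := congrArg (fun x ↦ x.2.1.1) h
  have h3 : fDual n p.1.2.2 = fDual n q.1.2.2 := congrArg (fun x ↦ x.2.2) h
  have h4 : p.1.1 - q.1.1 ∈ D n := AddSubgroup.mem_inf.2
    ⟨by rw [AddMonoidHom.mem_ker, map_sub, h1, sub_self], sub_mem p.2.1 q.2.1⟩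
  have h5 : p.1.2.2 - q.1.2.2 ∈ DDual n := AddSubgroup.mem_inf.2
    ⟨by rw [AddMonoidHom.mem_ker, map_sub, h3, sub_self], sub_mem p.2.2.1 q.2.2.1⟩
  exact Quotient.sound ⟨(⟨_, h4⟩, ⟨_, h5⟩),
    Subtype.ext (Prod.ext (sub_add_cancel _ _) (Prod.ext h2.symm (sub_add_cancel _ _)))⟩

variable {n} in
theorem linearMap_surjective_of_injective {A : Matrix (Fin n) (Fin n) ℤ}
    (h : Function.Injective (realMap A)) : Function.Surjective (realMap A) :=
  LinearMap.surjective_of_injective (f := (realMap A).toLinearMap) h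

theorem quotientMap_surjective : Function.Surjective (quotientMap n k₁ k₂) := by
  rintro ⟨a, s, b⟩
  obtain ⟨x, rfl⟩ := torusMap_surjective
    (linearMap_surjective_of_injective (realMap_injective_f_fTr n)) a
  obtain ⟨y, rfl⟩ := torusMap_surjective
    (linearMap_surjective_of_injective (realMap_injective_fDual_fTr n)) b
  refine ⟨toX ((tildeHomeo n k₁ k₂).symm (x, s, y)), ?_⟩
  rw [quotientMap_toX, Homeomorph.apply_symm_apply]

theorem continuous_quotientMap : Continuous (quotientMap n k₁ k₂) := by
  refine Continuous.quotient_lift ?_ _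
  exact ((continuous_torusMap _).comp continuous_subtype_val.fst).prodMk
    ((continuous_subtype_val.snd.fst.subtype_mk _).prodMk
      ((continuous_torusMap _).comp continuous_subtype_val.snd.snd))

theorem compactSpace_XSpace : CompactSpace (XSpace n k₁ k₂) := by
  have := compactSpace_XTilde n k₁ k₂
  exact inferInstanceAs (CompactSpace (Quotient _))

/-- The homeomorphism of `𝕏` with the product, given by `quotientMap`. -/
def quotientHomeo : XSpace n k₁ k₂ ≃ₜ Torus n × RadialSpace n k₁ k₂ × Torus n :=
  have := compactSpace_XSpace n k₁ k₂
  have : Fact ((0 : ℝ) < 1) := ⟨one_pos⟩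
  Continuous.homeoOfEquivCompactToT2
    (f := Equiv.ofBijective _ ⟨quotientMap_injective n k₁ k₂, quotientMap_surjective n k₁ k₂⟩)
    (continuous_quotientMap n k₁ k₂)

theorem t2Space_XSpace : T2Space (XSpace n k₁ k₂) := by
  have : Fact ((0 : ℝ) < 1) := ⟨one_pos⟩
  exact (quotientHomeo n k₁ k₂).symm.t2Space

theorem secondCountableTopology_XSpace : SecondCountableTopology (XSpace n k₁ k₂) :=
  (quotientHomeo n k₁ k₂).secondCountableTopology

theorem radial_eq (x : XSpace n k₁ k₂) : radial n k₁ k₂ x = (quotientHomeo n k₁ k₂ x).2.1 := by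
  induction x using Quotient.inductionOn with | h p
  rfl

theorem sectionMap_eq (s : RadialSpace n k₁ k₂) :
    sectionMap n k₁ k₂ s = (quotientHomeo n k₁ k₂).symm (0, s, 0) := by
  rw [Homeomorph.eq_symm_apply]
  exact Prod.ext (map_zero (f n)) (Prod.ext rfl (map_zero (fDual n)))

/-- An integral matrix which is invertible over `ℝ`, as a linear automorphism. -/
def realMapEquiv {A : Matrix (Fin n) (Fin n) ℤ} (h : Function.Injective (realMap A)) :
    (Fin n → ℝ) ≃L[ℝ] (Fin n → ℝ) :=
  (LinearEquiv.ofBijective (realMap A).toLinearMap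
    ⟨h, linearMap_surjective_of_injective h⟩).toContinuousLinearEquiv

end Homeomorphisms

/-! ### The differentials of `μ₁` and `μ₂` -/

section MomentMaps

variable {n : ℕ} {k₁ k₂ : ℝ}

/-- `μ₁` and `μ₂` are, up to non-zero factors, the components of `radialMap`, whose differential is
surjective. -/
theorem wedge_mfderiv_ne_zero
    (hk : (n : ℝ) + 1 < -k₁ / Real.pi * Real.exp (4 * Real.pi / ((n : ℝ) + 1) * k₂))
    (p : FibredProduct n) (h₁ : μ₁ p = k₁) (h₂ : μ₂ p = k₂) :
    wedge (mfderiv (ambientModel n) 𝓘(ℝ, ℝ) μ₁ p) (mfderiv (ambientModel n) 𝓘(ℝ, ℝ) μ₂ p) ≠ 0 := by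
  have hpi := Real.pi_pos
  have hne := exists_ne_of_mem_RadialSpace hk (s := p.2.1) ⟨h₁, h₂⟩
  let I := 𝓘(ℝ, Fin (n + 1) → ℝ)
  have e1 : HasMFDerivAt (ambientModel n) I (fun q : FibredProduct n ↦ q.2.1) p _ :=
    HasMFDerivAt.comp (I' := I.prod I) (g := Prod.fst) p (hasMFDerivAt_fst p.2) (hasMFDerivAt_snd p)
  have e2 : HasFDerivAt (radialMap n) (radialDeriv p.2.1.1) p.2.1.1 := hasFDerivAt_radialMap p.2.1
  have e3 : HasMFDerivAt (ambientModel n) 𝓘(ℝ, ℝ × ℝ)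
      (fun q : FibredProduct n ↦ radialMap n q.2.1.1) p _ :=
    HasMFDerivAt.comp (g := radialMap n) p e2.hasMFDerivAt (hasMFDerivAt_opens.1 e1)
  have d1 : HasMFDerivAt (ambientModel n) 𝓘(ℝ, ℝ) μ₁ p _ :=
    (HasMFDerivAt.comp p
      (((-Real.pi) • ContinuousLinearMap.fst ℝ ℝ ℝ).hasFDerivAt.hasMFDerivAt) e3).congr_of_eventuallyEq
      (Filter.Eventually.of_forall fun q ↦ (μ₁_eq q).trans (neg_mul _ _).symm)
  have d2 : HasMFDerivAt (ambientModel n) 𝓘(ℝ, ℝ) μ₂ p _ :=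
    (HasMFDerivAt.comp p
      (((-(1 / (2 * Real.pi))) • ContinuousLinearMap.snd ℝ ℝ ℝ).hasFDerivAt.hasMFDerivAt)
      e3).congr_of_eventuallyEq
      (Filter.Eventually.of_forall fun q ↦ (μ₂_eq q).trans (neg_mul _ _).symm)
  obtain ⟨a, ha⟩ := radialDeriv_surjective hne (1, 0)
  obtain ⟨b, hb⟩ := radialDeriv_surjective hne (0, 1)
  intro h
  have v1 : ∀ v : AmbientVec n, mfderiv (ambientModel n) 𝓘(ℝ, ℝ) μ₁ p v =
      -Real.pi * (radialDeriv p.2.1.1 v.2.1).1 := fun v ↦ by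
    rw [d1.mfderiv]; rfl
  have v2 : ∀ v : AmbientVec n, mfderiv (ambientModel n) 𝓘(ℝ, ℝ) μ₂ p v =
      -(1 / (2 * Real.pi)) * (radialDeriv p.2.1.1 v.2.1).2 := fun v ↦ by
    rw [d2.mfderiv]; rfl
  have h3 := (wedge_apply _ _ _ _).symm.trans
    (DFunLike.congr_fun h ![((0, a, 0) : AmbientVec n), ((0, b, 0) : AmbientVec n)])
  have h4 : _ = (0 : ℝ) := (congrArg₂ (fun x y : ℝ ↦ x - y)
    (congrArg₂ (fun x y : ℝ ↦ x * y) (v1 (0, a, 0)) (v2 (0, b, 0)))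
    (congrArg₂ (fun x y : ℝ ↦ x * y) (v1 (0, b, 0)) (v2 (0, a, 0)))).symm.trans h3
  simp [ha, hb] at h4

end MomentMaps

end WSD

end

theorem mainTheorem1 (n : ℕ) (hn : 1 ≤ n) (k₁ k₂ : ℝ)
    (hk : (n : ℝ) + 1 < -k₁ / Real.pi * Real.exp (4 * Real.pi / ((n : ℝ) + 1) * k₂)) :
    (∀ p : WSD.FibredProduct n, WSD.μ₁ p = k₁ → WSD.μ₂ p = k₂ →
      WSD.wedge (mfderiv (WSD.ambientModel n) 𝓘(ℝ, ℝ) WSD.μ₁ p)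
        (mfderiv (WSD.ambientModel n) 𝓘(ℝ, ℝ) WSD.μ₂ p) ≠ 0) ∧
    Finite (WSD.D n × WSD.DDual n) ∧
    CompactSpace (WSD.XSpace n k₁ k₂) ∧ T2Space (WSD.XSpace n k₁ k₂) ∧
    SecondCountableTopology (WSD.XSpace n k₁ k₂) ∧ Nonempty (WSD.XSpace n k₁ k₂) ∧
    ∃ (_ : ChartedSpace (EuclideanSpace ℝ (Fin (3 * (n - 1) + 2))) (WSD.XTilde n k₁ k₂))
      (_ : IsManifold (𝓡 (3 * (n - 1) + 2)) ∞ (WSD.XTilde n k₁ k₂))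
      (_ : ChartedSpace (EuclideanSpace ℝ (Fin (3 * (n - 1) + 2))) (WSD.XSpace n k₁ k₂))
      (_ : IsManifold (𝓡 (3 * (n - 1) + 2)) ∞ (WSD.XSpace n k₁ k₂))
      (_ : ChartedSpace (EuclideanSpace ℝ (Fin (n - 1))) (WSD.RadialSpace n k₁ k₂))
      (_ : IsManifold (𝓡 (n - 1)) ∞ (WSD.RadialSpace n k₁ k₂))
      (S' : WSD.WSDStructure (𝓡 (3 * (n - 1) + 2)) (WSD.XTilde n k₁ k₂) (n - 1) 1)
      (S : WSD.WSDStructure (𝓡 (3 * (n - 1) + 2)) (WSD.XSpace n k₁ k₂) (n - 1) 1),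
      -- the inclusion of the submanifold, and the restriction of the ambient structure to it
      WSD.IsSmoothEmbedding (𝓡 (3 * (n - 1) + 2)) (WSD.ambientModel n)
        (Subtype.val : WSD.XTilde n k₁ k₂ → WSD.FibredProduct n) ∧
      S'.ω₁ = WSD.TwoForm.pullback _ _ Subtype.val WSD.ambientω₁ ∧
      S'.ω₂ = WSD.TwoForm.pullback _ _ Subtype.val WSD.ambientω₂ ∧
      S'.ωD = WSD.TwoForm.pullback _ _ Subtype.val WSD.ambientωD ∧
      (∀ p v w, S'.metric.inner p v w = WSD.ambientMetric p.1
        (mfderiv (𝓡 (3 * (n - 1) + 2)) (WSD.ambientModel n) Subtype.val p v)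
        (mfderiv (𝓡 (3 * (n - 1) + 2)) (WSD.ambientModel n) Subtype.val p w)) ∧
      -- the quotient map, and the descent of the structure to the quotient
      IsLocalDiffeomorph (𝓡 (3 * (n - 1) + 2)) (𝓡 (3 * (n - 1) + 2)) ∞
        (WSD.toX : WSD.XTilde n k₁ k₂ → WSD.XSpace n k₁ k₂) ∧
      S'.ω₁ = WSD.TwoForm.pullback _ _ WSD.toX S.ω₁ ∧
      S'.ω₂ = WSD.TwoForm.pullback _ _ WSD.toX S.ω₂ ∧
      S'.ωD = WSD.TwoForm.pullback _ _ WSD.toX S.ωD ∧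
      (∀ p v w, S'.metric.inner p v w = S.metric.inner (WSD.toX p)
        (mfderiv (𝓡 (3 * (n - 1) + 2)) (𝓡 (3 * (n - 1) + 2)) WSD.toX p v)
        (mfderiv (𝓡 (3 * (n - 1) + 2)) (𝓡 (3 * (n - 1) + 2)) WSD.toX p w)) ∧
      -- the structure is degenerate
      (∀ x, Module.finrank ℝ ↥(WSD.TwoForm.ker S.ω₁ x ⊓ WSD.TwoForm.ker S.ω₂ x) = 2) ∧
      -- the section
      WSD.IsSmoothEmbedding (𝓡 (n - 1)) 𝓘(ℝ, Fin (n + 1) → ℝ)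
        (Subtype.val : WSD.RadialSpace n k₁ k₂ → WSD.Radii n) ∧
      ContMDiff (𝓡 (3 * (n - 1) + 2)) (𝓡 (n - 1)) ∞ (WSD.radial n k₁ k₂) ∧
      ContMDiff (𝓡 (n - 1)) (𝓡 (3 * (n - 1) + 2)) ∞ (WSD.sectionMap n k₁ k₂) ∧
      (∀ s, WSD.radial n k₁ k₂ (WSD.sectionMap n k₁ k₂ s) = s) := by
  obtain ⟨R⟩ := WSD.nonempty_radialAtlas hn hk
  obtain ⟨Λ⟩ := WSD.nonempty_flatEquiv hn
  have hne : ∀ t : WSD.RadialSpace n k₁ k₂, ∃ i j, t.1.1 i ≠ t.1.1 j :=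
    fun t ↦ WSD.exists_ne_of_mem_RadialSpace hk t.2
  let Φ := WSD.tildeHomeo n k₁ k₂
  let Φ' := WSD.quotientHomeo n k₁ k₂
  let A := WSD.realMapEquiv n (WSD.realMap_injective_f_fTr n)
  let B := WSD.realMapEquiv n (WSD.realMap_injective_fDual_fTr n)
  let L := WSD.realMap (WSD.dualVertexMatrix n).transpose
  have hL : Function.Injective L := WSD.realMap_dual_transpose_injective n
  have hL' : ∀ y, (∃ x, L x = y) ↔ ∑ i, y i = 0 := WSD.mem_range_realMap_dual_transpose
  -- on `𝕏` the coordinates of the tori are the images under `A` and `B` of those on `𝕏̃`, hence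
  -- `θ̄` and `η̄` are their images under `L ∘ A⁻¹` and `L ∘ B⁻¹`
  have hequiv : ∀ C : (Fin n → ℝ) ≃L[ℝ] (Fin n → ℝ),
      Function.Injective (L.comp (C.symm : (Fin n → ℝ) →L[ℝ] (Fin n → ℝ))) ∧
      ∀ y, (∃ x, L.comp (C.symm : (Fin n → ℝ) →L[ℝ] (Fin n → ℝ)) x = y) ↔ ∑ i, y i = 0 := by
    refine fun C ↦ ⟨hL.comp C.symm.injective, fun y ↦ ?_⟩
    rw [← hL']
    exact ⟨fun ⟨x, hx⟩ ↦ ⟨C.symm x, hx⟩, fun ⟨x, hx⟩ ↦ ⟨C x, by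
      rw [ContinuousLinearMap.comp_apply, ContinuousLinearEquiv.coe_coe,
        ContinuousLinearEquiv.symm_apply_apply, hx]⟩⟩
  let _ := WSD.productChartedSpace R Λ Φ
  let _ := WSD.productChartedSpace R Λ Φ'
  let _ := R.chartedSpace
  let _ := WSD.isManifold_productChartedSpace R Λ Φ
  let _ := WSD.isManifold_productChartedSpace R Λ Φ'
  let _ := R.isManifold
  let G := WSD.productDevelopingMaps R Λ Φ L L (fun _ ↦ rfl) hn hne hL hL' hL hL'
  let G' := WSD.productDevelopingMaps R Λ Φ' _ _ (fun _ ↦ rfl) hn hne (hequiv A).1 (hequiv A).2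
    (hequiv B).1 (hequiv B).2
  have hlift : ∀ (a : Fin n → ℝ) (x : WSD.Torus n),
      WSD.torusCoe (L (WSD.torusChart a x)) = WSD.fTr n x := fun a x ↦
    (WSD.torusMap_torusCoe _ _).symm.trans (congrArg (WSD.fTr n) (WSD.torusCoe_torusChart a x))
  have hcoord : ∀ x, ∀ y ∈ (chartAt (EuclideanSpace ℝ (Fin (3 * (n - 1) + 2))) x).source,
      y.1.1 = WSD.torusCoe (G.toFun x (chartAt _ x y)).1 ∧ y.1.2.1 = G.radius y ∧
        y.1.2.2 = WSD.torusCoe (G.toFun x (chartAt _ x y)).2.2 := by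
    intro x y _
    have h : Λ.symm (chartAt _ x y) = _ := Λ.symm_apply_apply _
    refine ⟨?_, rfl, ?_⟩
    · change y.1.1 = WSD.torusCoe (L (Λ.symm (chartAt _ x y)).1)
      rw [h]
      exact (WSD.tildeHomeo_fst y).symm.trans (hlift _ _).symm
    · change y.1.2.2 = WSD.torusCoe (L (Λ.symm (chartAt _ x y)).2.2)
      rw [h]
      exact (WSD.tildeHomeo_snd_snd y).symm.trans (hlift _ _).symm
  have hG : ∀ p, HasMFDerivAt (𝓡 (3 * (n - 1) + 2)) (WSD.ambientModel n)
      (Subtype.val : WSD.XTilde n k₁ k₂ → WSD.FibredProduct n) p (G.components p) :=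
    G.hasMFDerivAt_of_coord hcoord
  have hr : ∀ p, G'.radius (WSD.toX p) = G.radius p := fun p ↦ rfl
  have hg : ∀ p, Φ' (WSD.toX p) = _ := WSD.quotientMap_toX
  have hcomp := WSD.productDevelopingMaps_components_comp_mfderiv R Λ Φ Φ' hg (fun _ ↦ rfl)
    (fun _ ↦ rfl) A B (fun _ ↦ rfl) (fun _ ↦ rfl) G rfl G' rfl
    (fun z ↦ congrArg L (A.symm_apply_apply z)) (fun z ↦ congrArg L (B.symm_apply_apply z))
  refine ⟨WSD.wedge_mfderiv_ne_zero hk, WSD.finite_D_prod_DDual n, WSD.compactSpace_XSpace n k₁ k₂,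
    WSD.t2Space_XSpace n k₁ k₂, WSD.secondCountableTopology_XSpace n k₁ k₂,
    (WSD.nonempty_RadialSpace hn hk).map (WSD.sectionMap n k₁ k₂), inferInstance, inferInstance,
    inferInstance, inferInstance, inferInstance, inferInstance,
    G.toWSDStructure hn fun x ↦ hne (Φ x).2.1, G'.toWSDStructure hn fun x ↦ hne (Φ' x).2.1,
    ⟨G.contMDiff_of_coord hcoord, Topology.IsEmbedding.subtypeVal, fun p ↦ ?_⟩,
    funext fun p ↦ ?_, funext fun p ↦ ?_, funext fun p ↦ ?_, fun p v w ↦ ?_,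
    WSD.isLocalDiffeomorph_of_torusMap R Λ Φ Φ' hg (fun _ ↦ rfl) (fun _ ↦ rfl) A B (fun _ ↦ rfl)
      fun _ ↦ rfl,
    WSD.DevelopingMaps.form_eq_pullback hr hcomp _ _ _,
    WSD.DevelopingMaps.form_eq_pullback hr hcomp _ _ _,
    WSD.DevelopingMaps.form_eq_pullback hr hcomp _ _ _,
    WSD.DevelopingMaps.metric_eq_pullback hr hcomp, WSD.finrank_ker_inf_ker _,
    R.isSmoothEmbedding fun _ ↦ rfl, ?_, ?_, fun s ↦ rfl⟩
  · rw [(hG p).mfderiv]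
    exact G.components_injective p
  · rw [WSD.TwoForm.pullback, (hG p).mfderiv]
    exact G.ω₁_apply p
  · rw [WSD.TwoForm.pullback, (hG p).mfderiv]
    exact G.ω₂_apply p
  · rw [WSD.TwoForm.pullback, (hG p).mfderiv]
    exact G.ωD_apply p
  · rw [(hG p).mfderiv]
    exact G.metric_inner p v w
  · rw [funext (WSD.radial_eq n k₁ k₂)]
    exact WSD.contMDiff_radial_of_product R Λ Φ' (fun _ ↦ rfl) fun _ ↦ rfl
  · rw [funext (WSD.sectionMap_eq n k₁ k₂)]
    exact WSD.contMDiff_section_of_product R Λ Φ' (fun _ ↦ rfl) (fun _ ↦ rfl) 0 0
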